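/- **Proposition.** Let $k\ge 1$, $d\ge 0$ be integers and let $0<\beta<\min(k,2)$, or $k=1=\beta$. On a probability space let $W=(W_1,\dots,W_d)$ be a $\mathbb C^d$-valued white noise on $\mathbb R\times\mathbb R^k$: the real and imaginary parts of $W_1,\dots,W_d$ are independent real Gaussian white noises based on Lebesgue measure. Write $\mathcal F_{s,y}\varphi(\tau,\xi)=\int_{\mathbb R}\int_{\mathbb R^k}e^{-i(\tau s+\xi\cdot y)}\varphi(s,y)\,dy\,ds$ (extended to $L^2$ by Plancherel's theorem), and let $\mathcal H(\mathbb R)$, $\mathcal H(\mathbb C)$ be the sets of real, respectively complex, functions $\varphi\in L^2(\mathbb R_+\times\mathbb R^k)$, extended by $0$ to negative times, which, unless $k=1=\beta$, also satisfy $\int_{\mathbb R_+}dr\int_{\mathbb R^k}dy\int_{\mathbb R^k}dz\,|\varphi(r,y)|\,|y-z|^{-\beta}\,|\varphi(r,z)|<\infty$. For $\varphi\in\mathcal H(\mathbb C)$, $t\ge 0$, $x\in\mathbb R^k$ and $j=1,\dots,d$ put $$\tilde W_j(\varphi)=\int_{\mathbb R}\int_{\mathbb R^k}|\xi|^{(\beta-k)/2}\,\mathcal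 F_{s,y}\varphi(\tau,\xi)\,W_j(d\tau,d\xi),$$ $$v_j(t,x)=\int_{\mathbb R}\int_{\mathbb R^k}e^{-i\xi\cdot x}\,\frac{e^{-i\tau t}-e^{-t|\xi|^2}}{|\xi|^2-i\tau}\,|\xi|^{(\beta-k)/2}\,W_j(d\tau,d\xi),$$ where the integrals are $L^2(P)$-limits of integrals of simple functions that approximate the integrand in $L^2(d\tau\,d\xi)$. A *standard noise* on a class $D$ of real functions, with independent components $X_i$, is a centered, jointly Gaussian family $(X_i(\varphi))_{i,\ \varphi\in D}$ with $$E[X_i(\varphi)X_j(\psi)]=\delta_{ij}\int_{\mathbb R_+}dr\int_{\mathbb R^k}dy\int_{\mathbb R^k}dz\,\varphi(r,y)\,|y-z|^{-\beta}\,\psi(r,z)$$ (spatially homogeneous noise, white in time, with Riesz covariance), unless $k=1=\beta$, in which case $E[X_i(\varphi)X_j(\psi)]=\delta_{ij}\int_{\mathbb R_+}dr\int_{\mathbb R}dy\,\varphi(r,y)\psi(r,y)$ (space-time white noise). A real- or complex-valued family $X_j(\varphi)$, $\varphi\in D$, is integrated against a deterministic $g$ by taking $L^2(P)$-limits of $X_j(\varphi_n)$,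 where $\varphi_n\in D$ and $\varphi_n\to g$ in the sense that $\int_{\mathbb R_+}dr\iint|\varphi_n-g|(r,y)\,|y-z|^{-\beta}\,|\varphi_n-g|(r,z)\,dy\,dz\to0$ (for $k=1=\beta$: $\int_{\mathbb R_+}\int_{\mathbb R}|\varphi_n-g|^2\to 0$). A *mild solution* of $$\frac{\partial}{\partial t}u_j=\Delta u_j+\dot X_j,\qquad u_j(0,\cdot)=0,\qquad j=1,\dots,d,$$ is a field with $u_j(0,x)=0$ and $u_j(t,x)=\iint 1_{[0,t]}(s)\,G(t-s,x-y)\,X_j(ds,dy)$ a.s. for all $t\ge0$, $x\in\mathbb R^k$, where $G(t,x)=(4\pi t)^{-k/2}e^{-|x|^2/(4t)}$ for $t>0$ and $G(t,x)=0$ for $t\le 0$. Finally let $c=(2\pi)^2$ if $k=1=\beta$, and otherwise $$c=(2\pi)^{k+1}\Big/\frac{\pi^{k/2}\,2^{k-\beta}\,\Gamma((k-\beta)/2)}{\Gamma(\beta/2)}.$$ The random variables $\tilde W_j(\varphi)$ and $v_j(t,x)$ are well defined: all the integrands are in $L^2(d\tau\,d\xi)$ and all the integrals exist. Moreover: (a)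 $c>0$; the $2d$ families $\varphi\mapsto c^{-1/2}\,\mathrm{Re}\,\tilde W_j(\varphi)$ and $\varphi\mapsto c^{-1/2}\,\mathrm{Im}\,\tilde W_j(\varphi)$, $\varphi\in\mathcal H(\mathbb R)$, $j=1,\dots,d$, are the independent components of a standard noise on $\mathcal H(\mathbb R)$; and $\tilde W_j(\varphi)=\tilde W_j(\mathrm{Re}\,\varphi)+i\,\tilde W_j(\mathrm{Im}\,\varphi)$ a.s. for $\varphi\in\mathcal H(\mathbb C)$. That is, up to the factor $c^{1/2}$, $\tilde W_j$ is a $\mathbb C$-valued space-time white noise if $k=1=\beta$, and otherwise a $\mathbb C$-valued spatially homogeneous noise that is white in time with spatial covariance $|x-y|^{-\beta}$. (b) $v=(v_1,\dots,v_d)$ is a ($\mathbb C^d$-valued) mild solution of $\frac{\partial}{\partial t}v_j=\Delta v_j+\dot{\tilde W}_j$, $v_j(0,\cdot)=0$, $j=1,\dots,d$. (c) Let $\hat W=(\hat W_1,\dots,\hat W_d)$, on any probability space, be a standard noise on the real $C^\infty$ functions with compact support in $\mathbb R\times\mathbb R^k$, and let $\hat v$ be a (real) mild solution of $\frac{\partial}{\partial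 t}\hat v_j=\Delta\hat v_j+\dot{\hat W}_j$, $\hat v_j(0,\cdot)=0$, $j=1,\dots,d$. Then $(\mathrm{Re}\,v(t,x))_{t\ge 0,\,x\in\mathbb R^k}$ and $(c^{1/2}\,\hat v(t,x))_{t\ge0,\,x\in\mathbb R^k}$ have the same law (the same finite-dimensional distributions). -/

import Mathlib

open MeasureTheory ProbabilityTheory Filter Topology
open scoped NNReal ENNReal

namespace HeatNoise

noncomputable section

/-- The space-time `ℝ × ℝᵏ`, with points `(s, y)` (or `(τ, ξ)` on the Fourier side).
Its `volume` is Lebesgue measure. -/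
abbrev SpaceTime (k : ℕ) : Type := ℝ × EuclideanSpace ℝ (Fin k)

section WhiteNoise

variable {Ω : Type*} [MeasurableSpace Ω] {S : Type*} [MeasurableSpace S] {ι : Type*}

open scoped Classical in
/-- A real white noise based on the measure `ν`, with independent components indexed by `ι`:
a centered Gaussian process indexed by the measurable sets of finite `ν`-measure, with
`E[Wᵢ(A) Wⱼ(B)] = δᵢⱼ ν(A ∩ B)`.  (Additivity and independence on disjoint sets, and independence
of the components, are consequences.) -/
structure IsWhiteNoise (P : Measure Ω) (ν : Measure S) (W : ι → Set S → Ω → ℝ) : Prop where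
  gaussian : IsGaussianProcess
    (fun q : ι × {A : Set S // MeasurableSet A ∧ ν A ≠ ∞} => W q.1 q.2.1) P
  centered : ∀ i A, MeasurableSet A → ν A ≠ ∞ → ∫ ω, W i A ω ∂P = 0
  covariance : ∀ i j A B, MeasurableSet A → ν A ≠ ∞ → MeasurableSet B → ν B ≠ ∞ →
    ∫ ω, W i A ω * W j B ω ∂P = if i = j then ν.real (A ∩ B) else 0

/-- The real and imaginary parts of a family of complex random variables, as one real family. -/
def reIm {T : Type*} (Z : ι → T → Ω → ℂ) : ι ⊕ ι → T → Ω → ℝ :=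
  Sum.elim (fun i a ω => (Z i a ω).re) (fun i a ω => (Z i a ω).im)

/-- A complex white noise with independent components: the real and the imaginary parts of all the
components are independent real white noises based on `ν`. -/
def IsComplexWhiteNoise (P : Measure Ω) (ν : Measure S) (W : ι → Set S → Ω → ℂ) : Prop :=
  IsWhiteNoise P ν (reIm W)

/-- The integral `∑ c · W(f = c)` of a complex simple function `f` with respect to `W`. -/
def simpleWienerIntegral (W : Set S → Ω → ℂ) (f : SimpleFunc S ℂ) (ω : Ω) : ℂ :=
  ∑ c ∈ f.range, c * W (f ⁻¹' {c}) ω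

/-- `Z` is the stochastic integral `∫ f dW`: the `L²(P)`-limit of the integrals of square integrable
simple functions that converge to `f` in `L²(ν)`. -/
def HasWienerIntegral (P : Measure Ω) (ν : Measure S) (W : Set S → Ω → ℂ) (f : S → ℂ)
    (Z : Ω → ℂ) : Prop :=
  MemLp Z 2 P ∧ ∃ F : ℕ → SimpleFunc S ℂ, (∀ n, MemLp (F n) 2 ν) ∧
    Tendsto (fun n => eLpNorm (fun x => F n x - f x) 2 ν) atTop (𝓝 0) ∧
    Tendsto (fun n => eLpNorm (fun ω => simpleWienerIntegral W (F n) ω - Z ω) 2 P) atTop (𝓝 0)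

open scoped Classical in
/-- The stochastic integral `∫ f dW` (determined up to almost sure equality; `0` if it does not
exist). -/
def wienerIntegral (P : Measure Ω) (ν : Measure S) (W : Set S → Ω → ℂ) (f : S → ℂ) : Ω → ℂ :=
  if h : ∃ Z, HasWienerIntegral P ν W f Z then h.choose else 0

end WhiteNoise

section Fourier

variable {k : ℕ}

/-- The space-time Fourier transform `∫ e^{-i(τ s + ξ·y)} φ(s, y) ds dy` of an integrable function. -/
def fourierL1 (φ : SpaceTime k → ℂ) (p : SpaceTime k) : ℂ :=
  ∫ q : SpaceTime k,
    Complex.exp (-Complex.I * ((p.1 * q.1 + inner ℝ p.2 q.2 : ℝ) : ℂ)) * φ q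

/-- `f` is the Fourier transform of `φ ∈ L²`, in the sense of the Plancherel extension. -/
def IsFourierL2 (φ f : SpaceTime k → ℂ) : Prop :=
  MemLp f 2 volume ∧ ∃ Φ : ℕ → SpaceTime k → ℂ,
    (∀ n, Integrable (Φ n) volume ∧ MemLp (Φ n) 2 volume) ∧
    Tendsto (fun n => eLpNorm (fun p => Φ n p - φ p) 2 volume) atTop (𝓝 0) ∧
    Tendsto (fun n => eLpNorm (fun p => fourierL1 (Φ n) p - f p) 2 volume) atTop (𝓝 0)

open scoped Classical in
/-- The Fourier transform on `L²` (determined up to almost everywhere equality). -/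
def fourierL2 (φ : SpaceTime k → ℂ) : SpaceTime k → ℂ :=
  if h : ∃ f, IsFourierL2 φ f then h.choose else 0

end Fourier

section Noise

variable {k : ℕ}

open scoped Classical in
/-- The covariance of the noise on `ℝ₊ × ℝᵏ` that is white in time: space-time white noise if
`k = 1 = β`, and spatial covariance `|y - z|^{-β}` otherwise. -/
def noiseCov (β : ℝ) (φ ψ : SpaceTime k → ℝ) : ℝ :=
  if k = 1 ∧ β = 1 then
    ∫ r in Set.Ici (0 : ℝ), ∫ y, φ (r, y) * ψ (r, y)
  else
    ∫ r in Set.Ici (0 : ℝ), ∫ y, ∫ z, φ (r, y) * ‖y - z‖ ^ (-β) * ψ (r, z)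

open scoped Classical in
/-- The squared norm of the space of integrands of the noise: the covariance form evaluated at
absolute values, so that no cancellation is used. -/
def noiseNormSq {F : Type*} [NormedAddCommGroup F] (β : ℝ) (φ : SpaceTime k → F) : ℝ≥0∞ :=
  if k = 1 ∧ β = 1 then
    ∫⁻ r in Set.Ici (0 : ℝ), ∫⁻ y, ‖φ (r, y)‖ₑ * ‖φ (r, y)‖ₑ
  else
    ∫⁻ r in Set.Ici (0 : ℝ), ∫⁻ y, ∫⁻ z,
      ‖φ (r, y)‖ₑ * ENNReal.ofReal (‖y - z‖ ^ (-β)) * ‖φ (r, z)‖ₑ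

/-- Real `C^∞` functions with compact support in `ℝ × ℝᵏ`. -/
def testFunctions (k : ℕ) : Set (SpaceTime k → ℝ) :=
  {φ | ContDiff ℝ ((⊤ : ℕ∞) : WithTop ℕ∞) φ ∧ HasCompactSupport φ}

/-- The functions of `L²(ℝ₊ × ℝᵏ)`, extended by `0` to negative times, of finite `noiseNormSq`.
If `k = 1 = β` the last condition holds for all functions of `L²(ℝ₊ × ℝᵏ)`. -/
def noiseDomain (k : ℕ) (β : ℝ) (F : Type*) [NormedAddCommGroup F] : Set (SpaceTime k → F) :=
  {φ | MemLp φ 2 volume ∧ (∀ p, p.1 < 0 → φ p = 0) ∧ noiseNormSq β φ < ∞}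

variable {Ω : Type*} [MeasurableSpace Ω] {ι : Type*}

open scoped Classical in
/-- `X` is a real Gaussian noise on the class `D` of functions, with independent components indexed
by `ι`, white in time, each component being a space-time white noise if `k = 1 = β` and having
spatial covariance `|y - z|^{-β}` otherwise. -/
structure IsNoise (P : Measure Ω) (β : ℝ) (D : Set (SpaceTime k → ℝ))
    (X : ι → (SpaceTime k → ℝ) → Ω → ℝ) : Prop where
  gaussian : IsGaussianProcess (fun q : ι × D => X q.1 q.2.1) P
  centered : ∀ i, ∀ φ ∈ D, ∫ ω, X i φ ω ∂P = 0
  covariance : ∀ i j, ∀ φ ∈ D, ∀ ψ ∈ D,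
    ∫ ω, X i φ ω * X j ψ ω ∂P = if i = j then noiseCov β φ ψ else 0

/-- `Z` is the stochastic integral `∫ g(s, y) X(ds, dy)` of the deterministic function `g` with
respect to the (real or complex) noise `X`, which is given on the class `D` of functions: the
`L²(P)`-limit of `X(φₙ)` for some `φₙ ∈ D` that converge to `g` in the norm of the integrands. -/
def HasNoiseIntegral {F : Type*} [NormedAddCommGroup F] (P : Measure Ω) (β : ℝ)
    (D : Set (SpaceTime k → ℝ)) (X : (SpaceTime k → ℝ) → Ω → F) (g : SpaceTime k → ℝ)
    (Z : Ω → F) : Prop :=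
  MemLp Z 2 P ∧ ∃ Φ : ℕ → SpaceTime k → ℝ, (∀ n, Φ n ∈ D) ∧
    Tendsto (fun n => noiseNormSq β (fun p => Φ n p - g p)) atTop (𝓝 0) ∧
    Tendsto (fun n => eLpNorm (fun ω => X (Φ n) ω - Z ω) 2 P) atTop (𝓝 0)

/-- The fundamental solution `(4πt)^{-k/2} exp(-|x|²/(4t))`, `t > 0`, of the heat equation
`∂u/∂t = Δu`. -/
def heatKernel (t : ℝ) (x : EuclideanSpace ℝ (Fin k)) : ℝ :=
  if 0 < t then (4 * Real.pi * t) ^ (-(k : ℝ) / 2) * Real.exp (-‖x‖ ^ 2 / (4 * t)) else 0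

/-- `u` is a mild solution of the system `∂uⱼ/∂t = Δuⱼ + Ẋⱼ`, `uⱼ(0, ·) = 0`, that is,
`uⱼ(t, x) = ∫∫ 1_{[0,t]}(s) G(t - s, x - y) Xⱼ(ds, dy)` almost surely. -/
def IsMildSolution {F : Type*} [NormedAddCommGroup F] (P : Measure Ω) (β : ℝ)
    (D : Set (SpaceTime k → ℝ)) (X : ι → (SpaceTime k → ℝ) → Ω → F)
    (u : ι → ℝ≥0 → EuclideanSpace ℝ (Fin k) → Ω → F) : Prop :=
  (∀ j (t : ℝ≥0) x, HasNoiseIntegral P β D (X j)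
    (fun p => Set.indicator (Set.Icc 0 (t : ℝ)) (fun s => heatKernel (t - s) (x - p.2)) p.1)
    (u j t x)) ∧
  ∀ j x, u j 0 x =ᵐ[P] 0

end Noise

section Harmonizable

variable {k : ℕ} {Ω : Type*} [MeasurableSpace Ω] {ι : Type*}

/-- The integrand `|ξ|^{(β-k)/2} ℱφ(τ, ξ)`. -/
def tildeIntegrand (β : ℝ) (φ : SpaceTime k → ℂ) (p : SpaceTime k) : ℂ :=
  ((‖p.2‖ ^ ((β - k) / 2) : ℝ) : ℂ) * fourierL2 φ p

/-- `W̃ⱼ(φ) = ∫∫ |ξ|^{(β-k)/2} ℱφ(τ, ξ) Wⱼ(dτ, dξ)`. -/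
def tildeNoise (P : Measure Ω) (β : ℝ) (W : ι → Set (SpaceTime k) → Ω → ℂ)
    (j : ι) (φ : SpaceTime k → ℂ) : Ω → ℂ :=
  wienerIntegral P volume (W j) (tildeIntegrand β φ)

/-- The integrand
`e^{-iξ·x} (e^{-iτt} - e^{-t|ξ|²}) / (|ξ|² - iτ) |ξ|^{(β-k)/2}`. -/
def harmonizableKernel (β t : ℝ) (x : EuclideanSpace ℝ (Fin k)) (p : SpaceTime k) : ℂ :=
  Complex.exp (-Complex.I * ((inner ℝ p.2 x : ℝ) : ℂ)) *
    ((Complex.exp (-Complex.I * ((p.1 * t : ℝ) : ℂ)) - ((Real.exp (-(t * ‖p.2‖ ^ 2)) : ℝ) : ℂ)) /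
      (((‖p.2‖ ^ 2 : ℝ) : ℂ) - Complex.I * (p.1 : ℂ))) *
    ((‖p.2‖ ^ ((β - k) / 2) : ℝ) : ℂ)

/-- The harmonizable random field `vⱼ(t, x)`. -/
def harmonizableField (P : Measure Ω) (β : ℝ) (W : ι → Set (SpaceTime k) → Ω → ℂ)
    (j : ι) (t : ℝ≥0) (x : EuclideanSpace ℝ (Fin k)) : Ω → ℂ :=
  wienerIntegral P volume (W j) (harmonizableKernel β t x)

open scoped Classical in
/-- The normalizing constant of `W̃`, due to the Fourier transform without normalization:
`(2π)²` if `k = 1 = β`, and otherwise `(2π)^{k+1}` divided by the factor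
`π^{k/2} 2^{k-β} Γ((k-β)/2) / Γ(β/2)` in the Fourier transform of `|x|^{-β}`. -/
def noiseConst (k : ℕ) (β : ℝ) : ℝ :=
  if k = 1 ∧ β = 1 then (2 * Real.pi) ^ 2
  else (2 * Real.pi) ^ (k + 1) /
    (Real.pi ^ ((k : ℝ) / 2) * 2 ^ ((k : ℝ) - β) * Real.Gamma (((k : ℝ) - β) / 2) /
      Real.Gamma (β / 2))

end Harmonizable

end

end HeatNoise

open HeatNoise

/-!
Everything is a computation in `L²`, and the heart of the matter is that the weighted Fourier
transform `φ ↦ |ξ|^{(β-k)/2} ℱφ` is, up to the factor `c^{1/2}`, an isometry for the covariance form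
of the noise (`integral_tildeIntegrand_mul_conj`).

*The isometry.* For space-time white noise it is Plancherel's theorem. Otherwise both sides are
mixed from heat kernels with the same weight `s^{(k-β)/2-1} ds`: the Riesz kernel `|x|^{-β}` is a
constant multiple of `∫ G(s, x) s^{(k-β)/2-1} ds`, and `|ξ|^{β-k}` is a constant multiple of
`∫ e^{-s|ξ|²} s^{(k-β)/2-1} ds`. For a fixed `s` the identity
`∫ e^{-s|ξ|²} ℱφ conj ℱψ = (2π)^{k+1} ∫∫∫ G(s, y - z) φ(r, z) conj ψ(r, y)`
(`integral_exp_mul_fourierL2_mul_conj`) is Plancherel's identity for translated functions, averaged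
over the translations. Since all the weights are positive, Tonelli's theorem shows first that the
transform is in `L²`, and Fubini's theorem then gives the identity itself. The same mixture shows
that the covariance form satisfies the Cauchy–Schwarz inequality on nonnegative functions
(`pairForm_noisePair_le`), so that covariances pass to limits (`tendsto_noiseCov`).

*Gaussian part.* The integral with respect to a complex white noise satisfies `E[Z conj Z'] =
2 ∫ f conj g` and `E[Z Z'] = 0`; hence real and imaginary parts are uncorrelated as soon as the
inner products of the integrands are real (`integral_reIm_wiener`), as they are by the isometry when
`φ` and `ψ` are real. Joint normality is inherited by `L²` limits, because the closed linear span of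
a centered Gaussian process consists of centered Gaussian variables
(`hasGaussianLaw_of_mem_gaussianSpan`). This proves (a).

*The heat equation.* The Fourier transform of `1_{[0,a]}(s) G(t - s, x - y)` is explicit
(`fourierL1_heatIntegrand`), and converges pointwise to the integrand of `v`, without the weight, as
`a ↑ t`. The energy of `G(s, ·)` is of order `s^{-β/2}`, which is integrable at `0` as `β < 2`, so
that the cut-off functions converge in the norm of the integrands; by the isometry and Fatou's lemma
the weighted Fourier transforms converge in `L²` (`memLp_harmonizableKernel_and_tendsto`). This is
(b). For (c), mild solutions are centered Gaussian processes whose covariance is determined by that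
of the noise, whatever class of functions the noise is given on (`IsNoise.noiseIntegral`).
-/

open scoped ComplexConjugate

/-! ### Closed linear spans of centered Gaussian processes -/

section L2Limits

variable {α 𝕜 : Type*} [MeasurableSpace α] [RCLike 𝕜] {μ : Measure α}

theorem integral_mul_norm_le_eLpNorm {f g : α → 𝕜} (hf : MemLp f 2 μ) (hg : MemLp g 2 μ) :
    ‖∫ x, f x * g x ∂μ‖ₑ ≤ eLpNorm f 2 μ * eLpNorm g 2 μ := by
  refine (enorm_integral_le_lintegral_enorm _).trans ?_
  have h := eLpNorm_smul_le_mul_eLpNorm (p := 2) (q := 2) (r := 1) hg.1 hf.1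
  rw [eLpNorm_one_eq_lintegral_enorm] at h
  simpa [smul_eq_mul] using h

/-- The pairing `∫ f g` is continuous in the `L²` seminorm. -/
theorem tendsto_integral_mul {ι : Type*} {l : Filter ι} {f : ι → α → 𝕜} {g : ι → α → 𝕜}
    {f₀ g₀ : α → 𝕜} (hf : ∀ i, MemLp (f i) 2 μ) (hg : ∀ i, MemLp (g i) 2 μ)
    (hf₀ : MemLp f₀ 2 μ) (hg₀ : MemLp g₀ 2 μ)
    (hfl : Tendsto (fun i => eLpNorm (fun x => f i x - f₀ x) 2 μ) l (𝓝 0))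
    (hgl : Tendsto (fun i => eLpNorm (fun x => g i x - g₀ x) 2 μ) l (𝓝 0)) :
    Tendsto (fun i => ∫ x, f i x * g i x ∂μ) l (𝓝 (∫ x, f₀ x * g₀ x ∂μ)) := by
  have hI : ∀ {u v : α → 𝕜}, MemLp u 2 μ → MemLp v 2 μ → Integrable (fun x => u x * v x) μ :=
    fun hu hv => MemLp.integrable_mul hu hv
  rw [tendsto_iff_edist_tendsto_0]
  have hle : ∀ i, edist (∫ x, f i x * g i x ∂μ) (∫ x, f₀ x * g₀ x ∂μ) ≤
      eLpNorm (fun x => f i x - f₀ x) 2 μ * eLpNorm (fun x => g i x - g₀ x) 2 μ +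
      (eLpNorm (fun x => f i x - f₀ x) 2 μ * eLpNorm g₀ 2 μ +
      eLpNorm f₀ 2 μ * eLpNorm (fun x => g i x - g₀ x) 2 μ) := by
    intro i
    have hu : MemLp (fun x => f i x - f₀ x) 2 μ := (hf i).sub hf₀
    have hv : MemLp (fun x => g i x - g₀ x) 2 μ := (hg i).sub hg₀
    have : ∫ x, f i x * g i x ∂μ - ∫ x, f₀ x * g₀ x ∂μ =
        ∫ x, (f i x - f₀ x) * (g i x - g₀ x) ∂μ + (∫ x, (f i x - f₀ x) * g₀ x ∂μ +
          ∫ x, f₀ x * (g i x - g₀ x) ∂μ) := by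
      rw [← integral_add (hI hu hg₀) (hI hf₀ hv),
        ← integral_add (hI hu hv) (by exact (hI hu hg₀).add (hI hf₀ hv)),
        ← integral_sub (hI (hf i) (hg i)) (hI hf₀ hg₀)]
      congr 1; ext x; ring
    rw [edist_eq_enorm_sub, this]
    refine (enorm_add_le _ _).trans (add_le_add (integral_mul_norm_le_eLpNorm hu hv) ?_)
    exact (enorm_add_le _ _).trans (add_le_add (integral_mul_norm_le_eLpNorm hu hg₀)
      (integral_mul_norm_le_eLpNorm hf₀ hv))
  refine tendsto_of_tendsto_of_tendsto_of_le_of_le tendsto_const_nhds ?_ (fun _ => zero_le) hle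
  have h1 := ENNReal.Tendsto.mul hfl (Or.inr ENNReal.zero_ne_top) hgl (Or.inr ENNReal.zero_ne_top)
  have h2 := ENNReal.Tendsto.mul_const (b := eLpNorm g₀ 2 μ) hfl (Or.inr hg₀.2.ne)
  have h3 := ENNReal.Tendsto.const_mul (a := eLpNorm f₀ 2 μ) hgl (Or.inr hf₀.2.ne)
  simpa using h1.add (h2.add h3)

end L2Limits

section GaussianSpan

variable {Ω T : Type*} [MeasurableSpace Ω] {P : Measure Ω}

/-- The Gaussian Hilbert space of a real process `X`: the closed linear span in `L²(P)` of the
variables `X t`. -/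
noncomputable def gaussianSpan (P : Measure Ω) (X : T → Ω → ℝ) : Submodule ℝ (Lp ℝ 2 P) :=
  (Submodule.span ℝ {f : Lp ℝ 2 P | ∃ t, f =ᵐ[P] X t}).topologicalClosure

/-- The centered Gaussian law in terms of the characteristic function, with the variance written as
the squared norm: a condition that is closed in `L²`. -/
theorem hasGaussianLaw_centered_iff [IsProbabilityMeasure P] (f : Lp ℝ 2 P) :
    (HasGaussianLaw f P ∧ ∫ ω, f ω ∂P = 0) ↔
      ∀ t : ℝ, ∫ ω, Complex.exp ((t * f ω : ℝ) * Complex.I) ∂P =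
        Complex.exp (-((t ^ 2 * ‖f‖ ^ 2 / 2 : ℝ) : ℂ)) := by
  have hm : AEMeasurable f P := (Lp.aestronglyMeasurable f).aemeasurable
  have hsq : ∫ ω, f ω ^ 2 ∂P = ‖f‖ ^ 2 := by
    have := L2.inner_def (𝕜 := ℝ) f f
    rw [real_inner_self_eq_norm_sq] at this
    rw [this]
    congr 1; ext ω; simp [sq]
  have hch : ∀ t : ℝ, charFun (P.map f) t =
      ∫ ω, Complex.exp ((t * f ω : ℝ) * Complex.I) ∂P := by
    intro t
    rw [charFun_apply_real, integral_map hm (by fun_prop)]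
    congr 1; ext ω; push_cast; ring_nf
  constructor
  · rintro ⟨hg, h0⟩ t
    have hv : Var[f; P] = ‖f‖ ^ 2 := by
      rw [variance_of_integral_eq_zero hm h0, hsq]
    rw [← hch, hg.map_eq_gaussianReal, charFun_gaussianReal, h0, hv]
    rw [Real.coe_toNNReal _ (by positivity)]
    congr 1; push_cast; ring
  · intro h
    have hmap : P.map f = gaussianReal 0 (‖f‖ ^ 2).toNNReal := by
      have : IsProbabilityMeasure (P.map f) := Measure.isProbabilityMeasure_map hm
      apply Measure.ext_of_charFun
      ext t
      rw [hch, h, charFun_gaussianReal, Real.coe_toNNReal _ (by positivity)]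
      congr 1; push_cast; ring
    refine ⟨⟨by rw [hmap]; infer_instance⟩, ?_⟩
    have := integral_map (μ := P) (φ := f) (f := id) hm (by fun_prop)
    rw [hmap] at this
    simpa [integral_id_gaussianReal] using this.symm

/-- Centered Gaussian variables form a closed set, since characteristic functions are continuous in
`L²`. -/
theorem isClosed_setOf_hasGaussianLaw_centered [IsProbabilityMeasure P] :
    IsClosed {f : Lp ℝ 2 P | HasGaussianLaw f P ∧ ∫ ω, f ω ∂P = 0} := by
  simp_rw [hasGaussianLaw_centered_iff, Set.ofPred_forall]
  refine isClosed_iInter fun t => isClosed_eq ?_ (by fun_prop)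
  refine (LipschitzWith.of_dist_le_mul (K := ‖t‖₊) fun f g => ?_).continuous
  have hi : ∀ f : Lp ℝ 2 P, Integrable (fun ω => Complex.exp ((t * f ω : ℝ) * Complex.I)) P := by
    intro f
    have hm : AEMeasurable f P := (Lp.aestronglyMeasurable f).aemeasurable
    refine Integrable.mono' (integrable_const (1 : ℝ)) (by fun_prop) (ae_of_all _ fun ω => ?_)
    rw [Complex.norm_exp_ofReal_mul_I]
  have hfg : MemLp (fun ω => f ω - g ω) 1 P :=
    (((Lp.memLp f).sub (Lp.memLp g)).mono_exponent (by norm_num))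
  have hfi : Integrable (fun ω => f ω - g ω) P := memLp_one_iff_integrable.1 hfg
  rw [dist_eq_norm, ← integral_sub (hi f) (hi g)]
  calc ‖∫ ω, (Complex.exp ((t * f ω : ℝ) * Complex.I) -
          Complex.exp ((t * g ω : ℝ) * Complex.I)) ∂P‖
      ≤ ∫ ω, ‖t‖ * ‖f ω - g ω‖ ∂P := by
        refine norm_integral_le_of_norm_le (hfi.norm.const_mul _) (ae_of_all _ fun ω => ?_)
        have h1 : Complex.exp ((t * f ω : ℝ) * Complex.I) - Complex.exp ((t * g ω : ℝ) * Complex.I)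
            = Complex.exp ((t * g ω : ℝ) * Complex.I) *
              (Complex.exp (Complex.I * (t * f ω - t * g ω : ℝ)) - 1) := by
          rw [mul_sub, ← Complex.exp_add, mul_one]
          congr 2; push_cast; ring
        rw [h1, norm_mul, Complex.norm_exp_ofReal_mul_I, one_mul]
        refine (Real.norm_exp_I_mul_ofReal_sub_one_le).trans ?_
        rw [← mul_sub, norm_mul]
    _ = ‖t‖ * (eLpNorm (fun ω => f ω - g ω) 1 P).toReal := by
        rw [integral_const_mul, eLpNorm_one_eq_lintegral_enorm,
          integral_norm_eq_lintegral_enorm hfi.1]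
    _ ≤ ‖t‖ * ‖f - g‖ := by
        gcongr
        rw [Lp.norm_def]
        refine ENNReal.toReal_mono (Lp.eLpNorm_ne_top _) ?_
        rw [eLpNorm_congr_ae (Lp.coeFn_sub f g)]
        exact eLpNorm_le_eLpNorm_of_exponent_le (by norm_num) hfi.1
    _ = ‖t‖₊ * dist f g := by rw [dist_eq_norm]; rfl

variable {X : T → Ω → ℝ}

theorem subset_gaussianSpan {f : Lp ℝ 2 P} {t : T} (h : f =ᵐ[P] X t) : f ∈ gaussianSpan P X :=
  Submodule.le_topologicalClosure _ (Submodule.subset_span ⟨t, h⟩)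

/-- All the elements of the closed linear span of a centered Gaussian process are centered
Gaussian variables. -/
theorem hasGaussianLaw_of_mem_gaussianSpan [IsProbabilityMeasure P] (hX : IsGaussianProcess X P)
    (hX0 : ∀ t, ∫ ω, X t ω ∂P = 0) {f : Lp ℝ 2 P} (hf : f ∈ gaussianSpan P X) :
    HasGaussianLaw f P ∧ ∫ ω, f ω ∂P = 0 := by
  suffices h : ∀ f ∈ Submodule.span ℝ {f : Lp ℝ 2 P | ∃ t, f =ᵐ[P] X t},
      HasGaussianLaw f P ∧ ∫ ω, f ω ∂P = 0 from
    closure_minimal (t := {f : Lp ℝ 2 P | HasGaussianLaw f P ∧ ∫ ω, f ω ∂P = 0})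
      h isClosed_setOf_hasGaussianLaw_centered hf
  intro f hf
  obtain ⟨n, c, g, hfg⟩ := Submodule.mem_span_set'.1 hf
  choose t ht using fun i => (g i).2
  classical
  have hae : f =ᵐ[P] fun ω => ∑ i, c i * X (t i) ω := by
    rw [← hfg]
    have h1 : ⇑(∑ i, c i • (g i : Lp ℝ 2 P)) =ᵐ[P] ∑ i, ⇑(c i • (g i : Lp ℝ 2 P)) :=
      Lp.coeFn_finsetSum ..
    have h2 : ∀ᵐ ω ∂P, ∀ i, (c i • (g i : Lp ℝ 2 P)) ω = c i * X (t i) ω := by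
      rw [ae_all_iff]
      intro i
      filter_upwards [Lp.coeFn_smul (c i) (g i : Lp ℝ 2 P), ht i] with ω h3 h4
      rw [h3, Pi.smul_apply, h4, smul_eq_mul]
    filter_upwards [h1, h2] with ω h3 h4
    rw [h3, Finset.sum_apply]
    exact Finset.sum_congr rfl fun i _ => h4 i
  have hY : IsGaussianProcess (fun i ω => c i * X (t i) ω) P := by
    simpa [Function.comp_def] using (hX.comp_right t).smul c
  refine ⟨(hY.hasGaussianLaw_fun_sum (I := Finset.univ)).congr hae.symm, ?_⟩
  rw [integral_congr_ae hae, integral_finsetSum]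
  · simp [integral_const_mul, hX0]
  · intro i _
    exact (hY.hasGaussianLaw_eval i).integrable

/-- A process with values in the closed linear span of a centered Gaussian process is a Gaussian
process. -/
theorem isGaussianProcess_of_mem_gaussianSpan [IsProbabilityMeasure P] {T' : Type*}
    (hX : IsGaussianProcess X P) (hX0 : ∀ t, ∫ ω, X t ω ∂P = 0) {Y : T' → Ω → ℝ}
    (hY : ∀ t, ∃ f ∈ gaussianSpan P X, f =ᵐ[P] Y t) :
    IsGaussianProcess Y P := by
  choose f hf hfY using hY
  refine IsGaussianProcess.congr (X := fun t => ⇑(f t)) ⟨fun I => ⟨?_⟩⟩ hfY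
  have hm : AEMeasurable (fun ω => I.restrict (fun t => (f t : Ω → ℝ) ω)) P :=
    aemeasurable_pi_iff.2 fun t => (Lp.aestronglyMeasurable (f t)).aemeasurable
  refine isGaussian_of_isGaussian_map fun L => ?_
  classical
  rw [AEMeasurable.map_map_of_aemeasurable (by fun_prop) hm]
  have hmem : ∑ i : I, L (Pi.single i 1) • f i ∈ gaussianSpan P X :=
    Submodule.sum_mem _ fun i _ => Submodule.smul_mem _ _ (hf i)
  have hG := (hasGaussianLaw_of_mem_gaussianSpan hX hX0 hmem).1
  refine (hG.congr ?_).isGaussian_map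
  have h1 : ⇑(∑ i : I, L (Pi.single i 1) • f i) =ᵐ[P]
      ∑ i : I, ⇑(L (Pi.single i 1) • f i) := Lp.coeFn_finsetSum ..
  have h2 : ∀ᵐ ω ∂P, ∀ i : I, (L (Pi.single i 1) • f i) ω = L (Pi.single i 1) * f i ω := by
    rw [ae_all_iff]
    intro i
    filter_upwards [Lp.coeFn_smul (L (Pi.single i 1)) (f i)] with ω h3
    rw [h3, Pi.smul_apply, smul_eq_mul]
  filter_upwards [h1, h2] with ω h3 h4
  rw [h3, Finset.sum_apply, Function.comp_apply,
    pi_eq_sum_univ' (I.restrict (fun t => (f t : Ω → ℝ) ω)), map_sum]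
  refine Finset.sum_congr rfl fun i _ => ?_
  rw [h4, map_smul, smul_eq_mul, mul_comm]
  simp [Pi.single]

theorem integral_eq_zero_of_mem_gaussianSpan [IsProbabilityMeasure P]
    (hX : IsGaussianProcess X P) (hX0 : ∀ t, ∫ ω, X t ω ∂P = 0) {Y : Ω → ℝ}
    (hY : ∃ f ∈ gaussianSpan P X, f =ᵐ[P] Y) : ∫ ω, Y ω ∂P = 0 := by
  obtain ⟨f, hf, hfY⟩ := hY
  rw [← integral_congr_ae hfY]
  exact (hasGaussianLaw_of_mem_gaussianSpan hX hX0 hf).2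

/-- `L²` limits of elements of the closed linear span belong to the closed linear span. -/
theorem exists_mem_gaussianSpan_of_tendsto {Z : Ω → ℝ} (hZ : MemLp Z 2 P) {Y : ℕ → Ω → ℝ}
    (hY : ∀ n, ∃ f ∈ gaussianSpan P X, f =ᵐ[P] Y n)
    (h : Tendsto (fun n => eLpNorm (fun ω => Y n ω - Z ω) 2 P) atTop (𝓝 0)) :
    ∃ f ∈ gaussianSpan P X, f =ᵐ[P] Z := by
  choose f hf hfY using hY
  refine ⟨hZ.toLp Z, ?_, hZ.coeFn_toLp⟩
  refine (Submodule.isClosed_topologicalClosure _).mem_of_tendsto (b := atTop) (f := f) ?_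
    (Eventually.of_forall hf)
  rw [tendsto_iff_edist_tendsto_0]
  refine h.congr fun n => ?_
  rw [Lp.edist_def]
  refine eLpNorm_congr_ae ?_
  filter_upwards [hfY n, hZ.coeFn_toLp] with ω h1 h2
  simp [h1, h2]

theorem exists_mem_gaussianSpan_linearCombination {ι : Type*} (s : Finset ι) (c : ι → ℝ)
    {Y : ι → Ω → ℝ} (hY : ∀ i ∈ s, ∃ f ∈ gaussianSpan P X, f =ᵐ[P] Y i) :
    ∃ f ∈ gaussianSpan P X, f =ᵐ[P] fun ω => ∑ i ∈ s, c i * Y i ω := by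
  classical
  induction s using Finset.induction_on with
  | empty =>
    exact ⟨0, Submodule.zero_mem _, by simp only [Finset.sum_empty]; exact Lp.coeFn_zero ℝ 2 P⟩
  | insert i s hi ih =>
    obtain ⟨f, hf, hfY⟩ := ih fun j hj => hY j (Finset.mem_insert_of_mem hj)
    obtain ⟨g, hg, hgY⟩ := hY i (Finset.mem_insert_self _ _)
    refine ⟨c i • g + f, Submodule.add_mem _ (Submodule.smul_mem _ _ hg) hf, ?_⟩
    filter_upwards [hfY, hgY, Lp.coeFn_add (c i • g) f, Lp.coeFn_smul (c i) g] with ω h1 h2 h3 h4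
    rw [h3, Pi.add_apply, h4, Pi.smul_apply, h1, h2, Finset.sum_insert hi, smul_eq_mul]

/-- The variance of a linear combination of centered square integrable variables. -/
theorem variance_sum_mul_of_centered [IsProbabilityMeasure P] {J : Type*} [Fintype J]
    {Y : J → Ω → ℝ} (hY : ∀ i, MemLp (Y i) 2 P) (h0 : ∀ i, ∫ ω, Y i ω ∂P = 0) (c : J → ℝ) :
    Var[fun ω => ∑ i, c i * Y i ω; P] = ∑ i, ∑ j, c i * c j * ∫ ω, Y i ω * Y j ω ∂P := by
  have hm : MemLp (fun ω => ∑ i, c i * Y i ω) 2 P :=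
    memLp_finsetSum _ fun i _ => (hY i).const_mul (c i)
  have hz : ∫ ω, ∑ i, c i * Y i ω ∂P = 0 := by
    rw [integral_finsetSum]
    · simp [integral_const_mul, h0]
    · exact fun i _ => ((hY i).const_mul (c i)).integrable (by norm_num)
  rw [variance_of_integral_eq_zero hm.1.aemeasurable hz]
  have : ∀ ω, (∑ i, c i * Y i ω) ^ 2 = ∑ i, ∑ j, c i * c j * (Y i ω * Y j ω) := by
    intro ω
    rw [sq, Finset.sum_mul_sum]
    refine Finset.sum_congr rfl fun i _ => Finset.sum_congr rfl fun j _ => by ring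
  have hint : ∀ i j, Integrable (fun ω => Y i ω * Y j ω) P :=
    fun i j => MemLp.integrable_mul (hY i) (hY j)
  simp_rw [this]
  rw [integral_finsetSum _ fun i _ => integrable_finsetSum _ fun j _ => (hint i j).const_mul _]
  refine Finset.sum_congr rfl fun i _ => ?_
  rw [integral_finsetSum _ fun j _ => (hint i j).const_mul _]
  exact Finset.sum_congr rfl fun j _ => integral_const_mul _ _

/-- Two centered Gaussian vectors with the same covariances have the same law. -/
theorem identDistrib_of_gaussian_of_covariance_eq {Ω' J : Type*} [MeasurableSpace Ω']
    {P' : Measure Ω'} [IsProbabilityMeasure P] [IsProbabilityMeasure P'] [Fintype J]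
    {Y : J → Ω → ℝ} {Y' : J → Ω' → ℝ}
    (hY : HasGaussianLaw (fun ω j => Y j ω) P) (hY' : HasGaussianLaw (fun ω j => Y' j ω) P')
    (h0 : ∀ i, ∫ ω, Y i ω ∂P = 0) (h0' : ∀ i, ∫ ω, Y' i ω ∂P' = 0)
    (hcov : ∀ i j, ∫ ω, Y i ω * Y j ω ∂P = ∫ ω, Y' i ω * Y' j ω ∂P') :
    IdentDistrib (fun ω j => Y j ω) (fun ω j => Y' j ω) P P' := by
  classical
  refine ⟨hY.aemeasurable, hY'.aemeasurable, ?_⟩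
  have : IsProbabilityMeasure (P.map fun ω j => Y j ω) :=
    Measure.isProbabilityMeasure_map hY.aemeasurable
  have : IsProbabilityMeasure (P'.map fun ω j => Y' j ω) :=
    Measure.isProbabilityMeasure_map hY'.aemeasurable
  apply Measure.ext_of_charFunDual
  ext L
  obtain ⟨c, hL⟩ : ∃ c : J → ℝ, ∀ y : J → ℝ, L y = ∑ i, c i * y i := by
    refine ⟨fun i => L (Pi.single i 1), fun y => ?_⟩
    conv_lhs => rw [pi_eq_sum_univ' y, map_sum]
    refine Finset.sum_congr rfl fun i _ => ?_
    rw [map_smul, smul_eq_mul, mul_comm]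
  have hmY : ∀ i, MemLp (Y i) 2 P := fun i => (hY.eval i).memLp_two
  have hmY' : ∀ i, MemLp (Y' i) 2 P' := fun i => (hY'.eval i).memLp_two
  rw [hY.charFunDual_map_eq_fun, hY'.charFunDual_map_eq_fun]
  simp_rw [hL]
  rw [variance_sum_mul_of_centered hmY h0, variance_sum_mul_of_centered hmY' h0']
  simp_rw [hcov]
  congr 3
  have e1 : ∫ ω, ∑ i, c i * Y i ω ∂P = 0 := by
    rw [integral_finsetSum _ fun i _ => ((hmY i).const_mul _).integrable (by norm_num)]
    simp [integral_const_mul, h0]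
  have e2 : ∫ ω, ∑ i, c i * Y' i ω ∂P' = 0 := by
    rw [integral_finsetSum _ fun i _ => ((hmY' i).const_mul _).integrable (by norm_num)]
    simp [integral_const_mul, h0']
  rw [e1, e2]

end GaussianSpan

/-! ### Stochastic integrals with respect to complex white noise -/

section L2Isometry

variable {α : Type*} [MeasurableSpace α] {μ : Measure α}

theorem integral_sum_mul_sum {I J : Type*} (s : Finset I) (t : Finset J) (a : I → ℂ) (b : J → ℂ)
    {X : I → α → ℂ} {Y : J → α → ℂ} (hX : ∀ i ∈ s, MemLp (X i) 2 μ)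
    (hY : ∀ j ∈ t, MemLp (Y j) 2 μ) :
    ∫ x, (∑ i ∈ s, a i * X i x) * (∑ j ∈ t, b j * Y j x) ∂μ =
      ∑ i ∈ s, ∑ j ∈ t, a i * b j * ∫ x, X i x * Y j x ∂μ := by
  have hint : ∀ i ∈ s, ∀ j ∈ t, Integrable (fun x => a i * b j * (X i x * Y j x)) μ :=
    fun i hi j hj => (MemLp.integrable_mul (hX i hi) (hY j hj)).const_mul _
  have : ∀ x, (∑ i ∈ s, a i * X i x) * (∑ j ∈ t, b j * Y j x) =
      ∑ i ∈ s, ∑ j ∈ t, a i * b j * (X i x * Y j x) := by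
    intro x
    rw [Finset.sum_mul_sum]
    exact Finset.sum_congr rfl fun i _ => Finset.sum_congr rfl fun j _ => by ring
  simp_rw [this]
  rw [integral_finsetSum _ fun i hi => integrable_finsetSum _ fun j hj => hint i hi j hj]
  refine Finset.sum_congr rfl fun i hi => ?_
  rw [integral_finsetSum _ fun j hj => hint i hi j hj]
  exact Finset.sum_congr rfl fun j _ => integral_const_mul _ _

theorem memLp_conj {f : α → ℂ} {p : ℝ≥0∞} (hf : MemLp f p μ) : MemLp (fun x => conj (f x)) p μ :=
  hf.star

theorem integral_mul_conj_self_eq (f : α → ℂ) :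
    ∫ x, f x * conj (f x) ∂μ = ((∫ x, ‖f x‖ ^ 2 ∂μ : ℝ) : ℂ) := by
  rw [← integral_complex_ofReal]
  congr 1; ext x
  rw [Complex.mul_conj, Complex.normSq_eq_norm_sq]

theorem eLpNorm_two_sq_eq_ofReal {E : Type*} [NormedAddCommGroup E] {f : α → E}
    (hf : MemLp f 2 μ) :
    eLpNorm f 2 μ ^ 2 = ENNReal.ofReal (∫ x, ‖f x‖ ^ 2 ∂μ) := by
  rw [ofReal_integral_eq_lintegral_ofReal ((memLp_two_iff_integrable_sq_norm hf.1).1 hf)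
    (ae_of_all _ fun x => by positivity)]
  have := eLpNorm_nnreal_pow_eq_lintegral (μ := μ) (f := f) (p := 2) (by norm_num)
  norm_num at this
  rw [this]
  congr 1; ext x
  rw [ENNReal.ofReal_pow (norm_nonneg _), ofReal_norm]

theorem integral_norm_sum_sq {I : Type*} (s : Finset I) (a : I → ℂ) {V : I → α → ℂ}
    (hV : ∀ i ∈ s, MemLp (V i) 2 μ) :
    ((∫ x, ‖∑ i ∈ s, a i * V i x‖ ^ 2 ∂μ : ℝ) : ℂ) =
      ∑ i ∈ s, ∑ j ∈ s, a i * conj (a j) * ∫ x, V i x * conj (V j x) ∂μ := by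
  rw [← integral_mul_conj_self_eq]
  simp only [map_sum, map_mul]
  exact integral_sum_mul_sum s s a (fun j => conj (a j)) hV fun j hj => memLp_conj (hV j hj)

theorem tendsto_eLpNorm_conj_sub {u : ℕ → α → ℂ} {v : α → ℂ}
    (h : Tendsto (fun n => eLpNorm (fun x => u n x - v x) 2 μ) atTop (𝓝 0)) :
    Tendsto (fun n => eLpNorm (fun x => conj (u n x) - conj (v x)) 2 μ) atTop (𝓝 0) := by
  refine h.congr fun n => ?_
  refine eLpNorm_congr_norm_ae (ae_of_all _ fun x => ?_)
  rw [← map_sub, RCLike.norm_conj]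

/-- If the Gram matrices of two families of `L²` functions are proportional, so are the norms of
their linear combinations. -/
theorem eLpNorm_sum_eq_of_gram {β I : Type*} [MeasurableSpace β] {ν : Measure β} (s : Finset I)
    {U : I → α → ℂ} {u : I → β → ℂ} (hU : ∀ i ∈ s, MemLp (U i) 2 μ) (hu : ∀ i ∈ s, MemLp (u i) 2 ν)
    {C : ℝ} (hC : 0 ≤ C) (h : ∀ i ∈ s, ∀ j ∈ s,
      ∫ x, U i x * conj (U j x) ∂μ = C * ∫ y, u i y * conj (u j y) ∂ν) (a : I → ℂ) :
    eLpNorm (fun x => ∑ i ∈ s, a i * U i x) 2 μ ^ 2 =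
      ENNReal.ofReal C * eLpNorm (fun y => ∑ i ∈ s, a i * u i y) 2 ν ^ 2 := by
  have hU' : MemLp (fun x => ∑ i ∈ s, a i * U i x) 2 μ :=
    memLp_finsetSum _ fun i hi => (hU i hi).const_mul (a i)
  have hu' : MemLp (fun x => ∑ i ∈ s, a i * u i x) 2 ν :=
    memLp_finsetSum _ fun i hi => (hu i hi).const_mul (a i)
  rw [eLpNorm_two_sq_eq_ofReal hU', eLpNorm_two_sq_eq_ofReal hu', ← ENNReal.ofReal_mul hC]
  congr 1
  apply Complex.ofReal_injective
  rw [Complex.ofReal_mul, integral_norm_sum_sq s a hU, integral_norm_sum_sq s a hu, Finset.mul_sum]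
  refine Finset.sum_congr rfl fun i hi => ?_
  rw [Finset.mul_sum]
  refine Finset.sum_congr rfl fun j hj => ?_
  rw [h i hi j hj]; ring

/-- A bound between squared norms transfers convergence to zero. It is applied to the isometries up
to a constant factor. -/
theorem tendsto_eLpNorm_of_le_sq {E F : Type*} [NormedAddCommGroup E] [NormedAddCommGroup F]
    {β : Type*} [MeasurableSpace β] {ν : Measure β} {U : ℕ → α → E} {u : ℕ → β → F} {C : ℝ≥0∞}
    (hC : C ≠ ∞) (h : ∀ n, eLpNorm (U n) 2 μ ^ 2 ≤ C * eLpNorm (u n) 2 ν ^ 2)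
    (hu : Tendsto (fun n => eLpNorm (u n) 2 ν) atTop (𝓝 0)) :
    Tendsto (fun n => eLpNorm (U n) 2 μ) atTop (𝓝 0) := by
  have h2 : Tendsto (fun n => eLpNorm (U n) 2 μ ^ 2) atTop (𝓝 0) := by
    refine tendsto_of_tendsto_of_tendsto_of_le_of_le tendsto_const_nhds ?_ (fun _ => zero_le) h
    have := ENNReal.Tendsto.const_mul (a := C) (ENNReal.Tendsto.pow (n := 2) hu) (Or.inr hC)
    simpa using this
  have h3 := ((ENNReal.continuous_rpow_const (y := (2 : ℝ)⁻¹)).tendsto 0).comp h2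
  rw [ENNReal.zero_rpow_of_pos (by norm_num)] at h3
  refine h3.congr fun n => ?_
  rw [Function.comp_apply, ← ENNReal.rpow_natCast, ← ENNReal.rpow_mul]
  norm_num

end L2Isometry

section WienerIntegral

variable {Ω S ι : Type*} [MeasurableSpace Ω] [MeasurableSpace S] {P : Measure Ω} {ν : Measure S}
  {W : ι → Set S → Ω → ℂ}

namespace HeatNoise.IsComplexWhiteNoise

theorem memLp_reIm (hW : IsComplexWhiteNoise P ν W) (i : ι ⊕ ι) {A : Set S}
    (hA : MeasurableSet A) (hA' : ν A ≠ ∞) : MemLp (reIm W i A) 2 P :=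
  (hW.gaussian.hasGaussianLaw_eval (i, ⟨A, hA, hA'⟩)).memLp_two

theorem memLp (hW : IsComplexWhiteNoise P ν W) (i : ι) {A : Set S} (hA : MeasurableSet A)
    (hA' : ν A ≠ ∞) : MemLp (W i A) 2 P :=
  memLp_re_im_iff.1 ⟨hW.memLp_reIm (.inl i) hA hA', hW.memLp_reIm (.inr i) hA hA'⟩

open scoped Classical in
/-- The factor `2` comes from the real and the imaginary part of the noise. -/
theorem integral_mul_conj (hW : IsComplexWhiteNoise P ν W) (i j : ι) {A B : Set S}
    (hA : MeasurableSet A) (hA' : ν A ≠ ∞) (hB : MeasurableSet B) (hB' : ν B ≠ ∞) :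
    ∫ ω, W i A ω * conj (W j B ω) ∂P = if i = j then 2 * (ν.real (A ∩ B) : ℂ) else 0 := by
  have hint : ∀ p q, Integrable (fun ω => reIm W p A ω * reIm W q B ω) P := fun p q =>
    MemLp.integrable_mul (hW.memLp_reIm p hA hA') (hW.memLp_reIm q hB hB')
  have hcov := fun p q => hW.covariance p q A B hA hA' hB hB'
  have hp : ∀ ω, W i A ω * conj (W j B ω) =
      ((reIm W (.inl i) A ω * reIm W (.inl j) B ω + reIm W (.inr i) A ω * reIm W (.inr j) B ω : ℝ)
        : ℂ) + ((reIm W (.inr i) A ω * reIm W (.inl j) B ω -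
          reIm W (.inl i) A ω * reIm W (.inr j) B ω : ℝ) : ℂ) * Complex.I := by
    intro ω
    apply Complex.ext <;> simp [reIm] <;> ring
  simp_rw [hp]
  rw [integral_add, integral_mul_const, integral_complex_ofReal, integral_complex_ofReal,
    integral_add (hint _ _) (hint _ _), integral_sub (hint _ _) (hint _ _), hcov, hcov, hcov, hcov]
  · by_cases h : i = j <;> simp [h, two_mul]
  · exact ((hint _ _).add (hint _ _)).ofReal
  · exact ((hint _ _).sub (hint _ _)).ofReal.mul_const _

/-- The contributions of the real and the imaginary part cancel: complex white noise is proper. -/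
theorem integral_mul (hW : IsComplexWhiteNoise P ν W) (i j : ι) {A B : Set S}
    (hA : MeasurableSet A) (hA' : ν A ≠ ∞) (hB : MeasurableSet B) (hB' : ν B ≠ ∞) :
    ∫ ω, W i A ω * W j B ω ∂P = 0 := by
  have hint : ∀ p q, Integrable (fun ω => reIm W p A ω * reIm W q B ω) P := fun p q =>
    MemLp.integrable_mul (hW.memLp_reIm p hA hA') (hW.memLp_reIm q hB hB')
  have hcov := fun p q => hW.covariance p q A B hA hA' hB hB'
  have hp : ∀ ω, W i A ω * W j B ω =
      ((reIm W (.inl i) A ω * reIm W (.inl j) B ω - reIm W (.inr i) A ω * reIm W (.inr j) B ω : ℝ)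
        : ℂ) + ((reIm W (.inr i) A ω * reIm W (.inl j) B ω +
          reIm W (.inl i) A ω * reIm W (.inr j) B ω : ℝ) : ℂ) * Complex.I := by
    intro ω
    apply Complex.ext <;> simp [reIm] <;> ring
  simp_rw [hp]
  rw [integral_add, integral_mul_const, integral_complex_ofReal, integral_complex_ofReal,
    integral_sub (hint _ _) (hint _ _), integral_add (hint _ _) (hint _ _), hcov, hcov, hcov, hcov]
  · by_cases h : i = j <;> simp [h]
  · exact ((hint _ _).sub (hint _ _)).ofReal
  · exact ((hint _ _).add (hint _ _)).ofReal.mul_const _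

end HeatNoise.IsComplexWhiteNoise

omit [MeasurableSpace Ω] in
/-- The value `0` of a simple function may be taken on a set of infinite measure, where the value of
`W` is unspecified; it does not contribute to the integral. -/
theorem simpleWienerIntegral_eq_sum_filter (W : Set S → Ω → ℂ) (F : SimpleFunc S ℂ) :
    simpleWienerIntegral W F = fun ω => ∑ c ∈ F.range with c ≠ 0, c * W (F ⁻¹' {c}) ω := by
  ext ω
  rw [simpleWienerIntegral, Finset.sum_filter]
  refine Finset.sum_congr rfl fun c _ => ?_
  by_cases h : c = 0 <;> simp [h]

theorem simpleFunc_eq_sum_filter (F : SimpleFunc S ℂ) (x : S) :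
    F x = ∑ c ∈ F.range with c ≠ 0, c * (F ⁻¹' {c}).indicator (fun _ => (1 : ℂ)) x := by
  by_cases h : F x = 0
  · rw [Finset.sum_eq_zero, h]
    intro c hc
    have : F x ≠ c := by rw [h]; exact (Finset.mem_filter.1 hc).2.symm
    rw [Set.indicator_of_notMem (by simpa using this), mul_zero]
  · rw [Finset.sum_eq_single (F x)]
    · simp
    · intro c _ hc
      rw [Set.indicator_of_notMem (by simpa using hc.symm), mul_zero]
    · simp [h]

theorem measure_preimage_ne_top {F : SimpleFunc S ℂ} (hF : MemLp F 2 ν) {c : ℂ}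
    (hc : c ∈ F.range.filter (· ≠ 0)) : ν (F ⁻¹' {c}) ≠ ∞ :=
  (SimpleFunc.measure_preimage_lt_top_of_memLp (by norm_num) (by norm_num) F hF c
    (Finset.mem_filter.1 hc).2).ne

namespace HeatNoise.IsComplexWhiteNoise

variable (hW : IsComplexWhiteNoise P ν W)
include hW

theorem memLp_simple (i : ι) {F : SimpleFunc S ℂ} (hF : MemLp F 2 ν) :
    MemLp (simpleWienerIntegral (W i) F) 2 P := by
  rw [simpleWienerIntegral_eq_sum_filter]
  exact memLp_finsetSum _ fun c hc =>
    (hW.memLp i (F.measurableSet_preimage _) (measure_preimage_ne_top hF hc)).const_mul c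

open scoped Classical in
theorem integral_simple_mul_conj (i j : ι) {F G : SimpleFunc S ℂ} (hF : MemLp F 2 ν)
    (hG : MemLp G 2 ν) :
    ∫ ω, simpleWienerIntegral (W i) F ω * conj (simpleWienerIntegral (W j) G ω) ∂P =
      if i = j then 2 * ∫ x, F x * conj (G x) ∂ν else 0 := by
  simp_rw [simpleWienerIntegral_eq_sum_filter, map_sum, map_mul]
  rw [integral_sum_mul_sum]
  rotate_left
  · exact fun c hc => hW.memLp i (F.measurableSet_preimage _) (measure_preimage_ne_top hF hc)
  · exact fun c hc => memLp_conj
      (hW.memLp j (G.measurableSet_preimage _) (measure_preimage_ne_top hG hc))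
  have h1 : ∫ x, F x * conj (G x) ∂ν = ∑ c ∈ F.range with c ≠ 0, ∑ c' ∈ G.range with c' ≠ 0,
      c * conj c' * (ν.real (F ⁻¹' {c} ∩ G ⁻¹' {c'}) : ℂ) := by
    have hind : ∀ {F : SimpleFunc S ℂ}, MemLp F 2 ν → ∀ c ∈ F.range.filter (· ≠ 0),
        MemLp ((F ⁻¹' {c}).indicator (fun _ => (1 : ℂ))) 2 ν := fun hF c hc =>
      memLp_indicator_const _ (SimpleFunc.measurableSet_preimage _ _) _
        (Or.inr (measure_preimage_ne_top hF hc))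
    have h2 : ∀ x, conj (G x) = ∑ c ∈ G.range with c ≠ 0,
        conj c * (G ⁻¹' {c}).indicator (fun _ => (1 : ℂ)) x := by
      intro x
      conv_lhs => rw [simpleFunc_eq_sum_filter G x, map_sum]
      refine Finset.sum_congr rfl fun c _ => ?_
      rw [map_mul]
      congr 1
      by_cases h : x ∈ G ⁻¹' {c} <;> simp [Set.indicator, h]
    simp_rw [h2]
    conv_lhs => enter [2, x]; rw [simpleFunc_eq_sum_filter F x]
    rw [integral_sum_mul_sum _ _ _ _ (hind hF) (hind hG)]
    refine Finset.sum_congr rfl fun c _ => Finset.sum_congr rfl fun c' _ => ?_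
    congr 1
    simp_rw [← Set.inter_indicator_mul]
    rw [integral_indicator ((F.measurableSet_preimage _).inter (G.measurableSet_preimage _))]
    simp
  by_cases h : i = j
  · rw [if_pos h, h1, Finset.mul_sum]
    refine Finset.sum_congr rfl fun c hc => ?_
    rw [Finset.mul_sum]
    refine Finset.sum_congr rfl fun c' hc' => ?_
    rw [hW.integral_mul_conj i j (F.measurableSet_preimage _) (measure_preimage_ne_top hF hc)
      (G.measurableSet_preimage _) (measure_preimage_ne_top hG hc'), if_pos h]
    ring
  · rw [if_neg h]
    refine Finset.sum_eq_zero fun c hc => Finset.sum_eq_zero fun c' hc' => ?_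
    rw [hW.integral_mul_conj i j (F.measurableSet_preimage _) (measure_preimage_ne_top hF hc)
      (G.measurableSet_preimage _) (measure_preimage_ne_top hG hc'), if_neg h, mul_zero]

theorem integral_simple_mul (i j : ι) {F G : SimpleFunc S ℂ} (hF : MemLp F 2 ν)
    (hG : MemLp G 2 ν) :
    ∫ ω, simpleWienerIntegral (W i) F ω * simpleWienerIntegral (W j) G ω ∂P = 0 := by
  simp_rw [simpleWienerIntegral_eq_sum_filter]
  rw [integral_sum_mul_sum]
  rotate_left
  · exact fun c hc => hW.memLp i (F.measurableSet_preimage _) (measure_preimage_ne_top hF hc)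
  · exact fun c hc => hW.memLp j (G.measurableSet_preimage _) (measure_preimage_ne_top hG hc)
  refine Finset.sum_eq_zero fun c hc => Finset.sum_eq_zero fun c' hc' => ?_
  rw [hW.integral_mul i j (F.measurableSet_preimage _) (measure_preimage_ne_top hF hc)
    (G.measurableSet_preimage _) (measure_preimage_ne_top hG hc'), mul_zero]

theorem eLpNorm_simple_sub (i : ι) {F G : SimpleFunc S ℂ} (hF : MemLp F 2 ν) (hG : MemLp G 2 ν) :
    eLpNorm (fun ω => simpleWienerIntegral (W i) F ω - simpleWienerIntegral (W i) G ω) 2 P ^ 2 =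
      2 * eLpNorm (fun x => F x - G x) 2 ν ^ 2 := by
  have := eLpNorm_sum_eq_of_gram (μ := P) (ν := ν) (s := (Finset.univ : Finset (Fin 2)))
    (U := ![simpleWienerIntegral (W i) F, simpleWienerIntegral (W i) G]) (u := ![F, G]) (C := 2)
    (by simp [Fin.forall_fin_two, hW.memLp_simple i hF, hW.memLp_simple i hG])
    (by simp [Fin.forall_fin_two, hF, hG]) (by norm_num)
    (by simp [Fin.forall_fin_two, hW.integral_simple_mul_conj i i, hF, hG]) ![1, -1]
  simpa [Fin.sum_univ_two, ← sub_eq_add_neg] using this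

/-- Every square integrable function has a stochastic integral: the integrals of approximating
simple functions form a Cauchy sequence by the isometry. -/
theorem exists_hasWienerIntegral (i : ι) {f : S → ℂ} (hf : MemLp f 2 ν) :
    ∃ Z, HasWienerIntegral P ν (W i) f Z := by
  have hex : ∀ n : ℕ, ∃ F : SimpleFunc S ℂ, eLpNorm (f - ⇑F) 2 ν < (2⁻¹ : ℝ≥0∞) ^ n ∧
      MemLp F 2 ν := fun n => hf.exists_simpleFunc_eLpNorm_sub_lt (by norm_num)
    (pow_ne_zero _ (by simp))
  choose F hF hFm using hex
  have hFt : Tendsto (fun n => eLpNorm (fun x => F n x - f x) 2 ν) atTop (𝓝 0) := by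
    refine tendsto_of_tendsto_of_tendsto_of_le_of_le tendsto_const_nhds
      (ENNReal.tendsto_pow_atTop_nhds_zero_of_lt_one (r := 2⁻¹) (by simp)) (fun _ => zero_le)
      fun n => ?_
    have := (hF n).le
    rwa [eLpNorm_sub_comm] at this
  let Z : ℕ → Lp ℂ 2 P := fun n => (hW.memLp_simple i (hFm n)).toLp
  have hdist : ∀ n m, edist (Z n) (Z m) ^ 2 ≤
      2 * (eLpNorm (fun x => F n x - f x) 2 ν + eLpNorm (fun x => F m x - f x) 2 ν) ^ 2 := by
    intro n m
    have h1 : edist (Z n) (Z m) = eLpNorm (fun ω => simpleWienerIntegral (W i) (F n) ω -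
        simpleWienerIntegral (W i) (F m) ω) 2 P := by
      rw [Lp.edist_toLp_toLp]; rfl
    rw [h1, hW.eLpNorm_simple_sub i (hFm n) (hFm m)]
    gcongr
    have h2 : (fun x => F n x - F m x) = (fun x => F n x - f x) - (fun x => F m x - f x) := by
      ext x; simp
    rw [h2]
    exact eLpNorm_sub_le ((hFm n).sub hf).1 ((hFm m).sub hf).1 (by norm_num)
  have hcauchy : CauchySeq Z := by
    rw [EMetric.cauchySeq_iff]
    intro ε hε
    have h3 : Tendsto (fun p : ℕ × ℕ => 2 * (eLpNorm (fun x => F p.1 x - f x) 2 ν +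
        eLpNorm (fun x => F p.2 x - f x) 2 ν) ^ 2) atTop (𝓝 0) := by
      rw [← prod_atTop_atTop_eq]
      have h4 := (hFt.comp tendsto_fst).add (hFt.comp (tendsto_snd (f := (atTop : Filter ℕ))))
      have h5 := ENNReal.Tendsto.const_mul (a := 2) (ENNReal.Tendsto.pow (n := 2) h4)
        (Or.inr (by norm_num))
      simpa [Function.comp_def] using h5
    have h6 := h3.eventually (gt_mem_nhds (show (0 : ℝ≥0∞) < ε ^ 2 from by positivity))
    rw [eventually_atTop_prod_self] at h6
    obtain ⟨N, hN⟩ := h6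
    refine ⟨N, fun m hm n hn => ?_⟩
    have := (hdist m n).trans_lt (hN m n hm hn)
    exact not_le.1 fun hle => (pow_le_pow_left₀ zero_le hle 2).not_gt this
  obtain ⟨Z₀, hZ₀⟩ := cauchySeq_tendsto_of_complete hcauchy
  refine ⟨Z₀, Lp.memLp Z₀, F, hFm, hFt, ?_⟩
  rw [tendsto_iff_edist_tendsto_0] at hZ₀
  refine hZ₀.congr fun n => ?_
  rw [Lp.edist_def]
  refine eLpNorm_congr_ae ?_
  filter_upwards [(hW.memLp_simple i (hFm n)).coeFn_toLp] with ω h1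
  simp [Z, h1]

theorem hasWienerIntegral_wienerIntegral (i : ι) {f : S → ℂ} (hf : MemLp f 2 ν) :
    HasWienerIntegral P ν (W i) f (wienerIntegral P ν (W i) f) := by
  rw [wienerIntegral, dif_pos (hW.exists_hasWienerIntegral i hf)]
  exact (hW.exists_hasWienerIntegral i hf).choose_spec

open scoped Classical in
/-- The covariance `E[Z conj Z'] = 2 ∫ f conj g`: the factor `2` is due to the real and the
imaginary part of the noise, each of variance `ν`. -/
theorem integral_wiener_mul_conj {i j : ι} {f g : S → ℂ} {Z Z' : Ω → ℂ} (hf : MemLp f 2 ν)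
    (hg : MemLp g 2 ν) (hZ : HasWienerIntegral P ν (W i) f Z)
    (hZ' : HasWienerIntegral P ν (W j) g Z') :
    ∫ ω, Z ω * conj (Z' ω) ∂P = if i = j then 2 * ∫ x, f x * conj (g x) ∂ν else 0 := by
  obtain ⟨hZm, F, hF, hFf, hFZ⟩ := hZ
  obtain ⟨hZm', G, hG, hGg, hGZ⟩ := hZ'
  have h1 := tendsto_integral_mul (fun n => hW.memLp_simple i (hF n))
    (fun n => memLp_conj (hW.memLp_simple j (hG n))) hZm (memLp_conj hZm') hFZ
    (tendsto_eLpNorm_conj_sub hGZ)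
  have h2 := tendsto_integral_mul hF (fun n => memLp_conj (hG n)) hf (memLp_conj hg) hFf
    (tendsto_eLpNorm_conj_sub hGg)
  refine tendsto_nhds_unique h1 ?_
  simp_rw [fun n => hW.integral_simple_mul_conj i j (hF n) (hG n)]
  by_cases h : i = j
  · simpa [h] using h2.const_mul 2
  · simp [h]

theorem integral_wiener_mul {i j : ι} {f g : S → ℂ} {Z Z' : Ω → ℂ}
    (hZ : HasWienerIntegral P ν (W i) f Z) (hZ' : HasWienerIntegral P ν (W j) g Z') :
    ∫ ω, Z ω * Z' ω ∂P = 0 := by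
  obtain ⟨hZm, F, hF, hFf, hFZ⟩ := hZ
  obtain ⟨hZm', G, hG, hGg, hGZ⟩ := hZ'
  have h1 := tendsto_integral_mul (fun n => hW.memLp_simple i (hF n))
    (fun n => hW.memLp_simple j (hG n)) hZm hZm' hFZ hGZ
  refine tendsto_nhds_unique h1 ?_
  simp_rw [fun n => hW.integral_simple_mul i j (hF n) (hG n)]
  exact tendsto_const_nhds

/-- The stochastic integral is linear and, up to the factor `2`, isometric. -/
theorem eLpNorm_sum_wiener {I : Type*} (s : Finset I) (i : ι) {f : I → S → ℂ} {Z : I → Ω → ℂ}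
    (hf : ∀ m ∈ s, MemLp (f m) 2 ν) (hZ : ∀ m ∈ s, HasWienerIntegral P ν (W i) (f m) (Z m))
    (a : I → ℂ) :
    eLpNorm (fun ω => ∑ m ∈ s, a m * Z m ω) 2 P ^ 2 =
      2 * eLpNorm (fun x => ∑ m ∈ s, a m * f m x) 2 ν ^ 2 := by
  have := eLpNorm_sum_eq_of_gram (μ := P) (ν := ν) s (fun m hm => (hZ m hm).1) hf
    (C := 2) (by norm_num) (fun m hm n hn => by
      rw [hW.integral_wiener_mul_conj (hf m hm) (hf n hn) (hZ m hm) (hZ n hn), if_pos rfl]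
      norm_num) a
  simpa using this

theorem eLpNorm_wiener_sub (i : ι) {f g : S → ℂ} {Z Z' : Ω → ℂ} (hf : MemLp f 2 ν)
    (hg : MemLp g 2 ν) (hZ : HasWienerIntegral P ν (W i) f Z)
    (hZ' : HasWienerIntegral P ν (W i) g Z') :
    eLpNorm (fun ω => Z ω - Z' ω) 2 P ^ 2 = 2 * eLpNorm (fun x => f x - g x) 2 ν ^ 2 := by
  have := hW.eLpNorm_sum_wiener (Finset.univ : Finset (Fin 2)) i (f := ![f, g]) (Z := ![Z, Z'])
    (by simp [Fin.forall_fin_two, hf, hg]) (by simp [Fin.forall_fin_two, hZ, hZ']) ![1, -1]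
  simpa [Fin.sum_univ_two, ← sub_eq_add_neg] using this

/-- Linearity, in the form of a linear relation between three integrands. -/
theorem wiener_ae_eq_add_mul (i : ι) {f g h : S → ℂ} {Z Z' Z'' : Ω → ℂ} (hf : MemLp f 2 ν)
    (hg : MemLp g 2 ν) (hh : MemLp h 2 ν) (hZ : HasWienerIntegral P ν (W i) f Z)
    (hZ' : HasWienerIntegral P ν (W i) g Z') (hZ'' : HasWienerIntegral P ν (W i) h Z'') (b : ℂ)
    (hfgh : f =ᵐ[ν] fun x => g x + b * h x) :
    Z =ᵐ[P] fun ω => Z' ω + b * Z'' ω := by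
  have := hW.eLpNorm_sum_wiener (Finset.univ : Finset (Fin 3)) i (f := ![f, g, h])
    (Z := ![Z, Z', Z'']) (by simp [Fin.forall_fin_succ, hf, hg, hh])
    (by simp [Fin.forall_fin_succ, hZ, hZ', hZ'']) ![1, -1, -b]
  have h0 : (fun x => ∑ m, (![1, -1, -b] : Fin 3 → ℂ) m * (![f, g, h] : Fin 3 → S → ℂ) m x) =ᵐ[ν]
      0 := by
    filter_upwards [hfgh] with x hx
    simp [Fin.sum_univ_succ, hx]
    ring
  rw [eLpNorm_congr_ae h0, eLpNorm_zero, zero_pow (by norm_num), mul_zero,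
    pow_eq_zero_iff (by norm_num), eLpNorm_eq_zero_iff _ (by norm_num)] at this
  · filter_upwards [this] with ω hω
    simp [Fin.sum_univ_succ] at hω
    linear_combination hω
  · simp only [Fin.sum_univ_succ]
    have := (hZ.1.1.add ((hZ'.1.1.const_mul (-1)).add (hZ''.1.1.const_mul (-b))))
    refine this.congr (ae_of_all _ fun ω => ?_)
    simp

theorem wiener_ae_eq_zero (i : ι) {f : S → ℂ} {Z : Ω → ℂ} (hf : MemLp f 2 ν)
    (hZ : HasWienerIntegral P ν (W i) f Z) (h0 : f =ᵐ[ν] 0) : Z =ᵐ[P] 0 := by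
  have := hW.wiener_ae_eq_add_mul i hf hf hf hZ hZ hZ (-1) (by
    filter_upwards [h0] with x hx; simp [hx])
  filter_upwards [this] with ω h
  rw [h]; simp

open scoped Classical in
/-- The real and imaginary parts of stochastic integrals of functions with a real inner product
are uncorrelated. -/
theorem integral_reIm_wiener {T : Type*} {f : ι → T → S → ℂ} {Z : ι → T → Ω → ℂ}
    (hf : ∀ i t, MemLp (f i t) 2 ν) (hZ : ∀ i t, HasWienerIntegral P ν (W i) (f i t) (Z i t))
    (p q : ι ⊕ ι) (t t' : T) {r : ℝ}
    (hr : ∀ i, ∫ x, f i t x * conj (f i t' x) ∂ν = r) :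
    ∫ ω, reIm Z p t ω * reIm Z q t' ω ∂P = if p = q then r else 0 := by
  have h1 := fun i j => hW.integral_wiener_mul_conj (hf i t) (hf j t') (hZ i t) (hZ j t')
  have h2 := fun i j => hW.integral_wiener_mul (hZ i t) (hZ j t')
  have hi1 : ∀ i j, Integrable (fun ω => Z i t ω * conj (Z j t' ω)) P := fun i j =>
    MemLp.integrable_mul (hZ i t).1 (memLp_conj (hZ j t').1)
  have hi2 : ∀ i j, Integrable (fun ω => Z i t ω * Z j t' ω) P := fun i j =>
    MemLp.integrable_mul (hZ i t).1 (hZ j t').1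
  have hre : ∀ (u : ℂ) {g : Ω → ℂ}, Integrable g P →
      ∫ ω, (u * g ω).re ∂P = (u * ∫ ω, g ω ∂P).re := by
    intro u g hg
    rw [← integral_const_mul]
    exact integral_re (hg.const_mul u)
  -- each of the four products is of the form `Re (u Z conj Z') + Re (v Z Z')`
  have key : ∀ (i j : ι) (u v : ℂ), ∫ ω, ((u * (Z i t ω * conj (Z j t' ω))).re +
      (v * (Z i t ω * Z j t' ω)).re) ∂P = if i = j then 2 * (u * r).re else 0 := by
    intro i j u v
    rw [integral_add (by exact ((hi1 i j).const_mul u).re)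
      (by exact ((hi2 i j).const_mul v).re), hre _ (hi1 i j),
      hre _ (hi2 i j), h1, h2]
    by_cases h : i = j
    · simp only [h, if_true, hr]
      simp; ring
    · simp [h]
  rcases p with i | i <;> rcases q with j | j
  · have := key i j (1 / 2) (1 / 2)
    simp only [Sum.inl.injEq]
    convert this using 1
    · congr 1; ext ω; simp [reIm]; ring
    · congr 1; simp
  · have := key i j (Complex.I / 2) (-Complex.I / 2)
    simp only [reduceCtorEq, if_false]
    convert this using 1
    · congr 1; ext ω; simp [reIm]; ring
    · simp
  · have := key i j (-Complex.I / 2) (-Complex.I / 2)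
    simp only [reduceCtorEq, if_false]
    convert this using 1
    · congr 1; ext ω; simp [reIm]; ring
    · simp
  · have := key i j (1 / 2) (-1 / 2)
    simp only [Sum.inr.injEq]
    convert this using 1
    · congr 1; ext ω; simp [reIm]; ring
    · congr 1; simp

/-- All real linear functionals of the integral belong to the Gaussian space of the noise; a
functional is encoded as `z ↦ Re (u z)`. -/
theorem exists_mem_gaussianSpan_simple [IsProbabilityMeasure P] (i : ι) {F : SimpleFunc S ℂ}
    (hF : MemLp F 2 ν) (u : ℂ) :
    ∃ f ∈ gaussianSpan P (fun q : (ι ⊕ ι) × {A : Set S // MeasurableSet A ∧ ν A ≠ ∞} =>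
        reIm W q.1 q.2.1),
      f =ᵐ[P] fun ω => (u * simpleWienerIntegral (W i) F ω).re := by
  have hmem : ∀ (p : ι ⊕ ι) (c : ℂ), c ∈ F.range.filter (· ≠ 0) →
      ∃ f ∈ gaussianSpan P (fun q : (ι ⊕ ι) × {A : Set S // MeasurableSet A ∧ ν A ≠ ∞} =>
        reIm W q.1 q.2.1), f =ᵐ[P] reIm W p (F ⁻¹' {c}) := by
    intro p c hc
    have hm := hW.memLp_reIm p (F.measurableSet_preimage _) (measure_preimage_ne_top hF hc)
    exact ⟨hm.toLp, subset_gaussianSpan (t := (p, ⟨F ⁻¹' {c}, F.measurableSet_preimage _,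
      measure_preimage_ne_top hF hc⟩)) hm.coeFn_toLp, hm.coeFn_toLp⟩
  obtain ⟨f, hf, hfe⟩ := exists_mem_gaussianSpan_linearCombination
    (F.range.filter (· ≠ 0)) (fun c => (u * c).re) (hmem (.inl i))
  obtain ⟨g, hg, hge⟩ := exists_mem_gaussianSpan_linearCombination
    (F.range.filter (· ≠ 0)) (fun c => (u * c).im) (hmem (.inr i))
  refine ⟨f - g, Submodule.sub_mem _ hf hg, ?_⟩
  filter_upwards [hfe, hge, Lp.coeFn_sub f g] with ω h1 h2 h3
  rw [h3, Pi.sub_apply, h1, h2, simpleWienerIntegral_eq_sum_filter, ← Finset.sum_sub_distrib,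
    Finset.mul_sum, Complex.re_sum]
  refine Finset.sum_congr rfl fun c _ => ?_
  simp [reIm]
  ring

theorem exists_mem_gaussianSpan_wiener [IsProbabilityMeasure P] {i : ι} {f : S → ℂ} {Z : Ω → ℂ}
    (hZ : HasWienerIntegral P ν (W i) f Z) (u : ℂ) :
    ∃ f ∈ gaussianSpan P (fun q : (ι ⊕ ι) × {A : Set S // MeasurableSet A ∧ ν A ≠ ∞} =>
        reIm W q.1 q.2.1), f =ᵐ[P] fun ω => (u * Z ω).re := by
  obtain ⟨hZm, F, hF, hFf, hFZ⟩ := hZ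
  refine exists_mem_gaussianSpan_of_tendsto (hZm.const_mul u).re
    (fun n => hW.exists_mem_gaussianSpan_simple i (hF n) u) ?_
  have h := ENNReal.Tendsto.const_mul (a := ‖u‖ₑ) hFZ (Or.inr enorm_ne_top)
  rw [mul_zero] at h
  refine tendsto_of_tendsto_of_tendsto_of_le_of_le tendsto_const_nhds h (fun _ => zero_le)
    fun n => ?_
  rw [← eLpNorm_const_smul]
  refine eLpNorm_mono fun ω => ?_
  rw [Pi.smul_apply, smul_eq_mul, mul_sub]
  change ‖(u * simpleWienerIntegral (W i) (F n) ω).re - (u * Z ω).re‖ ≤ _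
  rw [← Complex.sub_re]
  exact Complex.abs_re_le_norm _

/-- The real and imaginary parts of a family of stochastic integrals form a centered Gaussian
process. -/
theorem isGaussianProcess_reIm_wiener [IsProbabilityMeasure P] {T : Type*} {f : ι → T → S → ℂ}
    {Z : ι → T → Ω → ℂ} (hZ : ∀ i t, HasWienerIntegral P ν (W i) (f i t) (Z i t)) :
    IsGaussianProcess (fun q : (ι ⊕ ι) × T => reIm Z q.1 q.2) P ∧
      ∀ p t, ∫ ω, reIm Z p t ω ∂P = 0 := by
  have h0 : ∀ q : (ι ⊕ ι) × {A : Set S // MeasurableSet A ∧ ν A ≠ ∞},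
      ∫ ω, reIm W q.1 q.2.1 ω ∂P = 0 := fun q => hW.centered _ _ q.2.2.1 q.2.2.2
  have hmem : ∀ q : (ι ⊕ ι) × T, ∃ f ∈ gaussianSpan P
      (fun q : (ι ⊕ ι) × {A : Set S // MeasurableSet A ∧ ν A ≠ ∞} => reIm W q.1 q.2.1),
      f =ᵐ[P] reIm Z q.1 q.2 := by
    rintro ⟨i | i, t⟩
    · obtain ⟨f, hf, hfe⟩ := hW.exists_mem_gaussianSpan_wiener (hZ i t) 1
      exact ⟨f, hf, by simpa [reIm] using hfe⟩
    · obtain ⟨f, hf, hfe⟩ := hW.exists_mem_gaussianSpan_wiener (hZ i t) (-Complex.I)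
      exact ⟨f, hf, by simpa [reIm] using hfe⟩
  exact ⟨isGaussianProcess_of_mem_gaussianSpan hW.gaussian h0 hmem,
    fun p t => integral_eq_zero_of_mem_gaussianSpan hW.gaussian h0 (hmem (p, t))⟩

end HeatNoise.IsComplexWhiteNoise

end WienerIntegral

/-! ### The Fourier transform on `L²(ℝ × ℝᵏ)` -/

section FourierTransform

open scoped FourierTransform SchwartzMap

section General

variable {E : Type*} [NormedAddCommGroup E] [InnerProductSpace ℝ E] [FiniteDimensional ℝ E]
  [MeasurableSpace E] [BorelSpace E]

/-- On `L¹ ∩ L²` the Fourier transform of Plancherel's theorem is given by the Fourier integral: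
both define the same tempered distribution. -/
theorem fourier_toLp_ae_eq {g : E → ℂ} (h1 : Integrable g) (h2 : MemLp g 2) :
    (𝓕 (h2.toLp g) : Lp ℂ 2 (volume : Measure E)) =ᵐ[volume] 𝓕 g := by
  have hcont : Continuous (𝓕 g) := VectorFourier.fourierIntegral_continuous
    Real.continuous_fourierChar (by exact continuous_inner) h1
  refine ae_eq_of_integral_contDiff_smul_eq
    ((Lp.memLp _).locallyIntegrable (by norm_num)) hcont.locallyIntegrable fun u hu hus => ?_
  have hu' : ContDiff ℝ ((⊤ : ℕ∞) : WithTop ℕ∞) (fun x => (u x : ℂ)) :=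
    Complex.ofRealCLM.contDiff.comp hu
  have hus' : HasCompactSupport (fun x => (u x : ℂ)) :=
    hus.comp_left (g := fun r : ℝ => (r : ℂ)) (by simp)
  let ψ : 𝓢(E, ℂ) := hus'.toSchwartzMap hu'
  have hψ : ∀ x, ψ x = (u x : ℂ) := fun x => rfl
  have e1 : ∫ x, u x • (𝓕 (h2.toLp g) : Lp ℂ 2 (volume : Measure E)) x = ∫ x, (𝓕 ψ) x • g x := by
    have h3 := congrArg (fun T : 𝓢'(E, ℂ) => T ψ)
      (Lp.fourier_toTemperedDistribution_eq (h2.toLp g))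
    simp only [TemperedDistribution.fourier_apply, Lp.toTemperedDistribution_apply] at h3
    calc _ = ∫ x, ψ x • (𝓕 (h2.toLp g) : Lp ℂ 2 (volume : Measure E)) x := by
          congr 1
      _ = _ := by
          rw [← h3]
          refine integral_congr_ae ?_
          filter_upwards [h2.coeFn_toLp] with x hx
          rw [hx]
  have e2 : ∫ x, (𝓕 ψ) x • g x = ∫ x, u x • 𝓕 g x := by
    have h4 := VectorFourier.integral_fourierIntegral_smul_eq_flip (μ := volume) (ν := volume)
      (L := innerₗ E) (f := ψ) (g := g) Real.continuous_fourierChar (by exact continuous_inner)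
      ψ.integrable h1
    rw [flip_innerₗ] at h4
    exact h4
  rw [e1, e2]

end General

section SpaceTime

variable {k : ℕ}

instance : (volume : Measure (SpaceTime k)).IsAddHaarMeasure :=
  Measure.prod.instIsAddHaarMeasure volume volume

/-- The rescaling `p ↦ p / 2π` from space-time to the corresponding Euclidean space, which
relates the Fourier transforms with the characters `e^{-i x·ξ}` and `e^{-2πi x·ξ}`. -/
noncomputable def fourierScale (p : SpaceTime k) : WithLp 2 (SpaceTime k) :=
  WithLp.toLp 2 ((2 * Real.pi)⁻¹ • p)

theorem measurable_fourierScale : Measurable (fourierScale (k := k)) := by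
  have h1 := (WithLp.volume_preserving_toLp ℝ (EuclideanSpace ℝ (Fin k))).measurable
  exact h1.comp (measurable_const_smul _)

theorem map_fourierScale : Measure.map (fourierScale (k := k)) volume =
    ENNReal.ofReal ((2 * Real.pi) ^ (k + 1)) • volume := by
  have h1 := WithLp.volume_preserving_toLp ℝ (EuclideanSpace ℝ (Fin k))
  have h2 : Measure.map ((2 * Real.pi)⁻¹ • · : SpaceTime k → SpaceTime k) volume =
      ENNReal.ofReal ((2 * Real.pi) ^ (k + 1)) • volume := by
    rw [Measure.map_addHaar_smul volume (by positivity)]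
    congr 2
    rw [Module.finrank_prod, finrank_euclideanSpace, Fintype.card_fin, Module.finrank_self,
      add_comm, inv_pow, inv_inv, abs_of_nonneg (by positivity)]
  have h3 : fourierScale (k := k) = WithLp.toLp 2 ∘ ((2 * Real.pi)⁻¹ • ·) := rfl
  rw [h3, ← Measure.map_map h1.measurable (measurable_const_smul _), h2, Measure.map_smul,
    h1.map_eq]

theorem memLp_comp_ofLp {φ : SpaceTime k → ℂ} (hφ : MemLp φ 2) :
    MemLp (fun v : WithLp 2 (SpaceTime k) => φ (WithLp.ofLp v)) 2 :=
  hφ.comp_measurePreserving (WithLp.volume_preserving_ofLp ℝ (EuclideanSpace ℝ (Fin k)))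

/-- The element of `L²` of the Euclidean space of pairs that corresponds to a function on
space-time. -/
noncomputable def euclideanLp {φ : SpaceTime k → ℂ} (hφ : MemLp φ 2) :
    Lp ℂ 2 (volume : Measure (WithLp 2 (SpaceTime k))) := (memLp_comp_ofLp hφ).toLp

/-- A representative of the Fourier transform of a function in `L²`. -/
noncomputable def fourierRep {φ : SpaceTime k → ℂ} (hφ : MemLp φ 2) (p : SpaceTime k) : ℂ :=
  (𝓕 (euclideanLp hφ) : Lp ℂ 2 (volume : Measure (WithLp 2 (SpaceTime k)))) (fourierScale p)

theorem quasiMeasurePreserving_fourierScale :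
    Measure.QuasiMeasurePreserving (fourierScale (k := k)) volume volume :=
  ⟨measurable_fourierScale, by
    rw [map_fourierScale]; exact Measure.smul_absolutelyContinuous⟩

theorem eLpNorm_comp_fourierScale {h : WithLp 2 (SpaceTime k) → ℂ}
    (hh : AEStronglyMeasurable h volume) :
    eLpNorm (fun p => h (fourierScale p)) 2 volume ^ 2 =
      ENNReal.ofReal ((2 * Real.pi) ^ (k + 1)) * eLpNorm h 2 volume ^ 2 := by
  have h1 : AEStronglyMeasurable h (Measure.map (fourierScale (k := k)) volume) := by
    rw [map_fourierScale]; exact hh.smul_measure _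
  have h2 := eLpNorm_map_measure (p := 2) h1 measurable_fourierScale.aemeasurable
  rw [Function.comp_def] at h2
  rw [← h2, map_fourierScale, eLpNorm_smul_measure_of_ne_top (by norm_num), smul_eq_mul, mul_pow,
    ← ENNReal.rpow_natCast, ← ENNReal.rpow_mul]
  norm_num

theorem memLp_fourierRep {φ : SpaceTime k → ℂ} (hφ : MemLp φ 2) : MemLp (fourierRep hφ) 2 := by
  have h0 := Lp.memLp (𝓕 (euclideanLp hφ) : Lp ℂ 2 (volume : Measure (WithLp 2 (SpaceTime k))))
  refine ⟨h0.1.comp_quasiMeasurePreserving quasiMeasurePreserving_fourierScale, ?_⟩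
  have h1 := eLpNorm_comp_fourierScale h0.1
  by_contra h
  rw [not_lt, top_le_iff] at h
  have h2 : eLpNorm (fun p => (𝓕 (euclideanLp hφ) : Lp ℂ 2 (volume : Measure (WithLp 2
    (SpaceTime k)))) (fourierScale p)) 2 volume = ∞ := h
  rw [h2] at h1
  exact (ENNReal.mul_ne_top ENNReal.ofReal_ne_top (ENNReal.pow_ne_top h0.2.ne))
    (by simpa using h1.symm)

/-- Plancherel's theorem for the representatives. -/
theorem integral_fourierRep_mul_conj {φ ψ : SpaceTime k → ℂ} (hφ : MemLp φ 2) (hψ : MemLp ψ 2) :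
    ∫ p, fourierRep hφ p * conj (fourierRep hψ p) =
      ((2 * Real.pi) ^ (k + 1) : ℝ) * ∫ q, φ q * conj (ψ q) := by
  set F := (𝓕 (euclideanLp hφ) : Lp ℂ 2 (volume : Measure (WithLp 2 (SpaceTime k))))
  set G := (𝓕 (euclideanLp hψ) : Lp ℂ 2 (volume : Measure (WithLp 2 (SpaceTime k))))
  have h1 : AEStronglyMeasurable (fun v => F v * conj (G v))
      (volume : Measure (WithLp 2 (SpaceTime k))) :=
    (Lp.memLp F).1.mul (memLp_conj (Lp.memLp G)).1
  have h2 : ∫ p, fourierRep hφ p * conj (fourierRep hψ p) =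
      ((2 * Real.pi) ^ (k + 1) : ℝ) * ∫ v, F v * conj (G v) := by
    have := integral_map (μ := (volume : Measure (SpaceTime k))) (φ := fourierScale)
      (f := fun v => F v * conj (G v)) measurable_fourierScale.aemeasurable
      (by rw [map_fourierScale]; exact h1.smul_measure _)
    rw [map_fourierScale, integral_smul_measure, ENNReal.toReal_ofReal (by positivity)] at this
    rw [← Complex.real_smul, this]
    rfl
  rw [h2]
  congr 1
  have h3 : ∫ v, F v * conj (G v) = inner ℂ G F := by
    rw [L2.inner_def]; rfl
  rw [h3, Lp.inner_fourier_eq, L2.inner_def]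
  have h4 := (WithLp.volume_preserving_ofLp ℝ (EuclideanSpace ℝ (Fin k)))
  have h5 := h4.integral_comp (MeasurableEquiv.toLp 2 (SpaceTime k)).symm.measurableEmbedding
    (fun q => φ q * conj (ψ q))
  rw [← h5]
  refine integral_congr_ae ?_
  filter_upwards [(memLp_comp_ofLp hφ).coeFn_toLp, (memLp_comp_ofLp hψ).coeFn_toLp] with v h6 h7
  rw [euclideanLp, euclideanLp, h6, h7]
  rfl

theorem eLpNorm_sum_fourierRep {I : Type*} (s : Finset I) {φ : I → SpaceTime k → ℂ}
    (hφ : ∀ i, MemLp (φ i) 2) (a : I → ℂ) :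
    eLpNorm (fun p => ∑ i ∈ s, a i * fourierRep (hφ i) p) 2 volume ^ 2 =
      ENNReal.ofReal ((2 * Real.pi) ^ (k + 1)) *
        eLpNorm (fun q => ∑ i ∈ s, a i * φ i q) 2 volume ^ 2 :=
  eLpNorm_sum_eq_of_gram s (fun i _ => memLp_fourierRep (hφ i)) (fun i _ => hφ i) (by positivity)
    (fun i _ j _ => integral_fourierRep_mul_conj (hφ i) (hφ j)) a

theorem eLpNorm_fourierRep_sub {φ ψ : SpaceTime k → ℂ} (hφ : MemLp φ 2) (hψ : MemLp ψ 2) :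
    eLpNorm (fun p => fourierRep hφ p - fourierRep hψ p) 2 volume ^ 2 =
      ENNReal.ofReal ((2 * Real.pi) ^ (k + 1)) * eLpNorm (fun q => φ q - ψ q) 2 volume ^ 2 := by
  have h : ∀ i, MemLp ((![φ, ψ] : Fin 2 → SpaceTime k → ℂ) i) 2 := by
    simp [Fin.forall_fin_two, hφ, hψ]
  have := eLpNorm_sum_fourierRep (Finset.univ : Finset (Fin 2)) h ![1, -1]
  simpa [Fin.sum_univ_two, ← sub_eq_add_neg] using this

theorem fourierL1_eq_fourier (φ : SpaceTime k → ℂ) (p : SpaceTime k) :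
    fourierL1 φ p = 𝓕 (fun v : WithLp 2 (SpaceTime k) => φ (WithLp.ofLp v)) (fourierScale p) := by
  have h4 := (WithLp.volume_preserving_ofLp ℝ (EuclideanSpace ℝ (Fin k)))
  have h5 := h4.integral_comp (MeasurableEquiv.toLp 2 (SpaceTime k)).symm.measurableEmbedding
    (fun q => Complex.exp (-Complex.I * ((p.1 * q.1 + inner ℝ p.2 q.2 : ℝ) : ℂ)) * φ q)
  rw [fourierL1, ← h5, Real.fourier_eq']
  congr 1; ext v
  rw [smul_eq_mul]
  congr 2
  have h6 : (inner ℝ v (fourierScale p) : ℝ) =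
      (2 * Real.pi)⁻¹ * (p.1 * (WithLp.ofLp v).1 + inner ℝ p.2 (WithLp.ofLp v).2) := by
    rw [WithLp.prod_inner_apply, fourierScale]
    simp only [Prod.smul_fst, Prod.smul_snd, inner_smul_right, real_inner_comm]
    simp
    ring
  rw [h6]
  have : (Real.pi : ℂ) ≠ 0 := by exact_mod_cast Real.pi_ne_zero
  push_cast
  field_simp

theorem fourierL1_ae_eq_fourierRep {φ : SpaceTime k → ℂ} (h1 : Integrable φ) (h2 : MemLp φ 2) :
    fourierL1 φ =ᵐ[volume] fourierRep h2 := by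
  have h4 := (WithLp.volume_preserving_ofLp ℝ (EuclideanSpace ℝ (Fin k)))
  have h5 := fourier_toLp_ae_eq (h4.integrable_comp_of_integrable h1) (memLp_comp_ofLp h2)
  have h6 := quasiMeasurePreserving_fourierScale.ae_eq_comp h5
  filter_upwards [h6] with p hp
  rw [fourierL1_eq_fourier]
  exact hp.symm

theorem exists_integrable_approx {φ : SpaceTime k → ℂ} (hφ : MemLp φ 2) :
    ∃ Φ : ℕ → SpaceTime k → ℂ, (∀ n, Integrable (Φ n) volume ∧ MemLp (Φ n) 2 volume) ∧
      Tendsto (fun n => eLpNorm (fun p => Φ n p - φ p) 2 volume) atTop (𝓝 0) := by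
  have hex : ∀ n : ℕ, ∃ F : SimpleFunc (SpaceTime k) ℂ,
      eLpNorm (φ - ⇑F) 2 volume < (2⁻¹ : ℝ≥0∞) ^ n ∧
      MemLp F 2 volume := fun n => hφ.exists_simpleFunc_eLpNorm_sub_lt (by norm_num)
    (pow_ne_zero _ (by simp))
  choose F hF hFm using hex
  refine ⟨fun n => F n, fun n => ⟨(SimpleFunc.memLp_iff_integrable (by norm_num)
    (by norm_num)).1 (hFm n), hFm n⟩, ?_⟩
  refine tendsto_of_tendsto_of_tendsto_of_le_of_le tendsto_const_nhds
    (ENNReal.tendsto_pow_atTop_nhds_zero_of_lt_one (r := 2⁻¹) (by simp)) (fun _ => zero_le)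
    fun n => ?_
  have := (hF n).le
  rwa [eLpNorm_sub_comm] at this

/-- The limit in `L²` is unique. -/
theorem ae_eq_of_tendsto_eLpNorm_sub {α : Type*} [MeasurableSpace α] {μ : Measure α}
    {u : ℕ → α → ℂ} {v w : α → ℂ} (hu : ∀ n, AEStronglyMeasurable (u n) μ)
    (hv : AEStronglyMeasurable v μ) (hw : AEStronglyMeasurable w μ)
    (h1 : Tendsto (fun n => eLpNorm (fun x => u n x - v x) 2 μ) atTop (𝓝 0))
    (h2 : Tendsto (fun n => eLpNorm (fun x => u n x - w x) 2 μ) atTop (𝓝 0)) : v =ᵐ[μ] w := by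
  have h3 : eLpNorm (v - w) 2 μ ≤ 0 := by
    refine ge_of_tendsto' (by simpa using h1.add h2) fun n => ?_
    have h4 : v - w = (fun x => u n x - w x) - (fun x => u n x - v x) := by ext x; simp
    rw [h4, add_comm]
    exact eLpNorm_sub_le ((hu n).sub hw) ((hu n).sub hv) (by norm_num)
  rw [nonpos_iff_eq_zero, eLpNorm_eq_zero_iff (hv.sub hw) (by norm_num)] at h3
  filter_upwards [h3] with x hx
  exact sub_eq_zero.1 hx

theorem isFourierL2_fourierRep {φ : SpaceTime k → ℂ} (hφ : MemLp φ 2) :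
    IsFourierL2 φ (fourierRep hφ) := by
  obtain ⟨Φ, hΦ, hΦt⟩ := exists_integrable_approx hφ
  refine ⟨memLp_fourierRep hφ, Φ, hΦ, hΦt, ?_⟩
  refine tendsto_eLpNorm_of_le_sq (C := ENNReal.ofReal ((2 * Real.pi) ^ (k + 1)))
    ENNReal.ofReal_ne_top (fun n => ?_) hΦt
  rw [← eLpNorm_fourierRep_sub (hΦ n).2 hφ]
  refine le_of_eq (congrArg (· ^ 2) (eLpNorm_congr_ae ?_))
  filter_upwards [fourierL1_ae_eq_fourierRep (hΦ n).1 (hΦ n).2] with p hp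
  rw [hp]

/-- The relation `IsFourierL2` determines the transform up to almost everywhere equality. -/
theorem isFourierL2_iff {φ f : SpaceTime k → ℂ} (hφ : MemLp φ 2) :
    IsFourierL2 φ f ↔ f =ᵐ[volume] fourierRep hφ := by
  constructor
  · rintro ⟨hf, Φ, hΦ, hΦt, hΦf⟩
    have hm : ∀ n, AEStronglyMeasurable (fourierL1 (Φ n)) volume := fun n =>
      (memLp_fourierRep (hΦ n).2).1.congr (fourierL1_ae_eq_fourierRep (hΦ n).1 (hΦ n).2).symm
    refine ae_eq_of_tendsto_eLpNorm_sub hm hf.1 (memLp_fourierRep hφ).1 hΦf ?_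
    refine tendsto_eLpNorm_of_le_sq (C := ENNReal.ofReal ((2 * Real.pi) ^ (k + 1)))
      ENNReal.ofReal_ne_top (fun n => ?_) hΦt
    rw [← eLpNorm_fourierRep_sub (hΦ n).2 hφ]
    refine le_of_eq (congrArg (· ^ 2) (eLpNorm_congr_ae ?_))
    filter_upwards [fourierL1_ae_eq_fourierRep (hΦ n).1 (hΦ n).2] with p hp
    rw [hp]
  · intro h
    obtain ⟨hm, Φ, hΦ, hΦt, hΦf⟩ := isFourierL2_fourierRep hφ
    refine ⟨hm.ae_eq h.symm, Φ, hΦ, hΦt, hΦf.congr fun n => eLpNorm_congr_ae ?_⟩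
    filter_upwards [h] with p hp
    rw [hp]

theorem isFourierL2_fourierL2 {φ : SpaceTime k → ℂ} (hφ : MemLp φ 2) :
    IsFourierL2 φ (fourierL2 φ) := by
  have h : ∃ f, IsFourierL2 φ f := ⟨_, isFourierL2_fourierRep hφ⟩
  rw [fourierL2, dif_pos h]
  exact h.choose_spec

theorem fourierL2_ae_eq {φ f : SpaceTime k → ℂ} (hφ : MemLp φ 2) (hf : IsFourierL2 φ f) :
    fourierL2 φ =ᵐ[volume] f :=
  ((isFourierL2_iff hφ).1 (isFourierL2_fourierL2 hφ)).trans ((isFourierL2_iff hφ).1 hf).symm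

theorem fourierL2_ae_eq_fourierL1 {φ : SpaceTime k → ℂ} (h1 : Integrable φ) (h2 : MemLp φ 2) :
    fourierL2 φ =ᵐ[volume] fourierL1 φ :=
  ((isFourierL2_iff h2).1 (isFourierL2_fourierL2 h2)).trans (fourierL1_ae_eq_fourierRep h1 h2).symm

theorem memLp_fourierL2 {φ : SpaceTime k → ℂ} (hφ : MemLp φ 2) : MemLp (fourierL2 φ) 2 :=
  (isFourierL2_fourierL2 hφ).1

theorem integral_fourierL2_mul_conj {φ ψ : SpaceTime k → ℂ} (hφ : MemLp φ 2) (hψ : MemLp ψ 2) :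
    ∫ p, fourierL2 φ p * conj (fourierL2 ψ p) =
      ((2 * Real.pi) ^ (k + 1) : ℝ) * ∫ q, φ q * conj (ψ q) := by
  rw [← integral_fourierRep_mul_conj hφ hψ]
  refine integral_congr_ae ?_
  filter_upwards [(isFourierL2_iff hφ).1 (isFourierL2_fourierL2 hφ),
    (isFourierL2_iff hψ).1 (isFourierL2_fourierL2 hψ)] with p h1 h2
  rw [h1, h2]

theorem eLpNorm_sum_fourierL2 {I : Type*} (s : Finset I) {φ : I → SpaceTime k → ℂ}
    (hφ : ∀ i, MemLp (φ i) 2) (a : I → ℂ) :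
    eLpNorm (fun p => ∑ i ∈ s, a i * fourierL2 (φ i) p) 2 volume ^ 2 =
      ENNReal.ofReal ((2 * Real.pi) ^ (k + 1)) *
        eLpNorm (fun q => ∑ i ∈ s, a i * φ i q) 2 volume ^ 2 :=
  eLpNorm_sum_eq_of_gram s (fun i _ => memLp_fourierL2 (hφ i)) (fun i _ => hφ i) (by positivity)
    (fun i _ j _ => integral_fourierL2_mul_conj (hφ i) (hφ j)) a

/-- Linearity, in the form of a linear relation between three functions. -/
theorem fourierL2_add_mul {φ ψ χ : SpaceTime k → ℂ} (hφ : MemLp φ 2) (hψ : MemLp ψ 2)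
    (hχ : MemLp χ 2) (b : ℂ) (h : φ =ᵐ[volume] fun q => ψ q + b * χ q) :
    fourierL2 φ =ᵐ[volume] fun p => fourierL2 ψ p + b * fourierL2 χ p := by
  have hm : ∀ i, MemLp ((![φ, ψ, χ] : Fin 3 → SpaceTime k → ℂ) i) 2 := by
    simp [Fin.forall_fin_succ, hφ, hψ, hχ]
  have := eLpNorm_sum_fourierL2 (Finset.univ : Finset (Fin 3)) hm ![1, -1, -b]
  have h0 : (fun x => ∑ m, (![1, -1, -b] : Fin 3 → ℂ) m *
      (![φ, ψ, χ] : Fin 3 → SpaceTime k → ℂ) m x) =ᵐ[volume] 0 := by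
    filter_upwards [h] with x hx
    simp [Fin.sum_univ_succ, hx]
    ring
  rw [eLpNorm_congr_ae h0, eLpNorm_zero, zero_pow (by norm_num), mul_zero,
    pow_eq_zero_iff (by norm_num), eLpNorm_eq_zero_iff _ (by norm_num)] at this
  · filter_upwards [this] with ω hω
    simp [Fin.sum_univ_succ] at hω
    linear_combination hω
  · simp only [Fin.sum_univ_succ]
    have := ((memLp_fourierL2 hφ).1.add (((memLp_fourierL2 hψ).1.const_mul (-1)).add
      ((memLp_fourierL2 hχ).1.const_mul (-b))))
    refine this.congr (ae_of_all _ fun ω => ?_)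
    simp

end SpaceTime

end FourierTransform

/-! ### The heat kernel and Riesz kernels -/

section HeatKernel

variable {k : ℕ}

theorem heatKernel_of_pos {t : ℝ} (ht : 0 < t) (x : EuclideanSpace ℝ (Fin k)) :
    heatKernel t x =
      (4 * Real.pi * t) ^ (-(k : ℝ) / 2) * Real.exp (-(4 * t)⁻¹ * ‖x‖ ^ 2) := by
  rw [heatKernel, if_pos ht]
  congr 2
  field_simp

theorem heatKernel_of_nonpos {t : ℝ} (ht : t ≤ 0) (x : EuclideanSpace ℝ (Fin k)) :
    heatKernel t x = 0 := by
  rw [heatKernel, if_neg ht.not_gt]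

theorem heatKernel_nonneg (t : ℝ) (x : EuclideanSpace ℝ (Fin k)) : 0 ≤ heatKernel t x := by
  rcases lt_or_ge 0 t with ht | ht
  · rw [heatKernel_of_pos ht]; positivity
  · rw [heatKernel_of_nonpos ht]

theorem heatKernel_neg (t : ℝ) (x : EuclideanSpace ℝ (Fin k)) :
    heatKernel t (-x) = heatKernel t x := by
  simp [heatKernel]

theorem heatKernel_le {t : ℝ} (ht : 0 < t) (x : EuclideanSpace ℝ (Fin k)) :
    heatKernel t x ≤ (4 * Real.pi * t) ^ (-(k : ℝ) / 2) := by
  rw [heatKernel_of_pos ht]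
  refine mul_le_of_le_one_right (by positivity) (Real.exp_le_one_iff.2 ?_)
  have : 0 ≤ (4 * t)⁻¹ * ‖x‖ ^ 2 := by positivity
  linarith

@[fun_prop]
theorem measurable_heatKernel :
    Measurable (fun p : ℝ × EuclideanSpace ℝ (Fin k) => heatKernel p.1 p.2) := by
  unfold heatKernel
  refine Measurable.ite (measurableSet_lt measurable_const measurable_fst) ?_ measurable_const
  fun_prop

@[fun_prop]
theorem Measurable.heatKernel {α : Type*} [MeasurableSpace α] {f : α → ℝ}
    {g : α → EuclideanSpace ℝ (Fin k)} (hf : Measurable f) (hg : Measurable g) :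
    Measurable (fun a => heatKernel (f a) (g a)) :=
  measurable_heatKernel.comp (hf.prodMk hg)

/-- The heat semigroup is the Fourier multiplier `e^{-t|ξ|²}`. -/
theorem integral_cexp_mul_heatKernel {t : ℝ} (ht : 0 < t) (ξ : EuclideanSpace ℝ (Fin k)) :
    ∫ z, Complex.exp (-Complex.I * ((inner ℝ ξ z : ℝ) : ℂ)) * (heatKernel t z : ℂ) =
      (Real.exp (-(t * ‖ξ‖ ^ 2)) : ℝ) := by
  have hb : 0 < ((((4 * t)⁻¹ : ℝ) : ℂ)).re := by rw [Complex.ofReal_re]; positivity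
  have h := GaussianFourier.integral_cexp_neg_mul_sq_norm_add hb (-Complex.I) ξ
  have h1 : ∀ z, Complex.exp (-Complex.I * ((inner ℝ ξ z : ℝ) : ℂ)) * (heatKernel t z : ℂ) =
      (((4 * Real.pi * t) ^ (-(k : ℝ) / 2) : ℝ) : ℂ) *
      Complex.exp (-(((4 * t)⁻¹ : ℝ) : ℂ) * ‖z‖ ^ 2 + -Complex.I * ((inner ℝ ξ z : ℝ) : ℂ)) := by
    intro z
    rw [heatKernel_of_pos ht, Complex.exp_add]
    push_cast
    ring
  simp_rw [h1]
  rw [integral_const_mul, h, finrank_euclideanSpace, Fintype.card_fin]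
  have h2 : ((Real.pi : ℂ) / (((4 * t)⁻¹ : ℝ) : ℂ)) ^ ((k : ℂ) / 2) =
      (((4 * Real.pi * t) ^ ((k : ℝ) / 2) : ℝ) : ℂ) := by
    rw [Complex.ofReal_cpow (by positivity)]
    congr 1
    · push_cast; field_simp
    · push_cast; rfl
  rw [h2, ← mul_assoc, ← Complex.ofReal_mul, ← Real.rpow_add (by positivity)]
  rw [show -(k : ℝ) / 2 + (k : ℝ) / 2 = 0 by ring, Real.rpow_zero, Complex.ofReal_one, one_mul,
    Complex.ofReal_exp]
  congr 1
  have : (t : ℂ) ≠ 0 := by exact_mod_cast ht.ne'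
  push_cast
  rw [neg_sq, Complex.I_sq]
  field_simp

theorem integrable_heatKernel {t : ℝ} (ht : 0 < t) :
    Integrable (fun z : EuclideanSpace ℝ (Fin k) => heatKernel t z) := by
  have h := integral_cexp_mul_heatKernel (k := k) ht 0
  simp only [inner_zero_left, Complex.ofReal_zero, mul_zero, Complex.exp_zero, one_mul,
    norm_zero] at h
  rw [integral_complex_ofReal] at h
  norm_num at h
  by_contra hn
  rw [integral_undef hn] at h
  exact zero_ne_one h

theorem lintegral_heatKernel {t : ℝ} (ht : 0 < t) :
    ∫⁻ z : EuclideanSpace ℝ (Fin k), ENNReal.ofReal (heatKernel t z) = 1 := by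
  rw [← ofReal_integral_eq_lintegral_ofReal (integrable_heatKernel ht)
    (ae_of_all _ fun z => heatKernel_nonneg t z)]
  have h := integral_cexp_mul_heatKernel (k := k) ht 0
  simp only [inner_zero_left, Complex.ofReal_zero, mul_zero, Complex.exp_zero, one_mul,
    norm_zero] at h
  rw [integral_complex_ofReal] at h
  norm_num at h
  rw [h, ENNReal.ofReal_one]

theorem lintegral_heatKernel_sub_left {t : ℝ} (ht : 0 < t) (x : EuclideanSpace ℝ (Fin k)) :
    ∫⁻ z, ENNReal.ofReal (heatKernel t (x - z)) = 1 := by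
  rw [lintegral_sub_left_eq_self (fun z => ENNReal.ofReal (heatKernel t z)) x,
    lintegral_heatKernel ht]

/-- The semigroup property of the heat kernel, for equal times. -/
theorem lintegral_heatKernel_mul_heatKernel {t : ℝ} (ht : 0 < t)
    (y z : EuclideanSpace ℝ (Fin k)) :
    ∫⁻ u, ENNReal.ofReal (heatKernel t (y - u)) * ENNReal.ofReal (heatKernel t (z - u)) =
      ENNReal.ofReal (heatKernel (2 * t) (y - z)) := by
  have h2t : 0 < 2 * t := by positivity
  have ht2 : 0 < t / 2 := by positivity
  -- complete the square around the midpoint of `y` and `z`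
  have key : ∀ u, heatKernel t (y - u) * heatKernel t (z - u) =
      heatKernel (2 * t) (y - z) * heatKernel (t / 2) (((2 : ℝ)⁻¹ • (y + z)) - u) := by
    intro u
    simp only [heatKernel_of_pos ht, heatKernel_of_pos h2t, heatKernel_of_pos ht2]
    have e1 : ((4 * Real.pi * t) ^ (-(k : ℝ) / 2)) * ((4 * Real.pi * t) ^ (-(k : ℝ) / 2)) =
        ((4 * Real.pi * (2 * t)) ^ (-(k : ℝ) / 2)) *
          ((4 * Real.pi * (t / 2)) ^ (-(k : ℝ) / 2)) := by
      rw [← Real.mul_rpow (by positivity) (by positivity),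
        ← Real.mul_rpow (by positivity) (by positivity)]
      congr 1; ring
    have e2 : ‖y - u‖ ^ 2 + ‖z - u‖ ^ 2 =
        2 * ‖((2 : ℝ)⁻¹ • (y + z)) - u‖ ^ 2 + ‖y - z‖ ^ 2 / 2 := by
      have h1 := parallelogram_law_with_norm ℝ (y - u) (z - u)
      have h3 : y - u + (z - u) = (2 : ℝ) • (((2 : ℝ)⁻¹ • (y + z)) - u) := by
        rw [smul_sub, smul_smul]; norm_num; rw [two_smul]; abel
      have h4 : y - u - (z - u) = y - z := by abel
      rw [h3, h4, norm_smul] at h1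
      rw [Real.norm_ofNat, mul_pow] at h1
      linarith
    calc _ = ((4 * Real.pi * t) ^ (-(k : ℝ) / 2)) * ((4 * Real.pi * t) ^ (-(k : ℝ) / 2)) *
          Real.exp (-(4 * t)⁻¹ * (‖y - u‖ ^ 2 + ‖z - u‖ ^ 2)) := by
          rw [mul_add, Real.exp_add]; ring
      _ = _ := by
          rw [e1, e2]
          have : -(4 * t)⁻¹ * (2 * ‖((2 : ℝ)⁻¹ • (y + z)) - u‖ ^ 2 + ‖y - z‖ ^ 2 / 2) =
              -(4 * (2 * t))⁻¹ * ‖y - z‖ ^ 2 +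
                -(4 * (t / 2))⁻¹ * ‖((2 : ℝ)⁻¹ • (y + z)) - u‖ ^ 2 := by
            field_simp; ring
          rw [this, Real.exp_add]; ring
  simp_rw [← ENNReal.ofReal_mul (heatKernel_nonneg _ _), key,
    ENNReal.ofReal_mul (heatKernel_nonneg _ _)]
  rw [lintegral_const_mul _ (by fun_prop), lintegral_heatKernel_sub_left ht2, mul_one]

theorem lintegral_rpow_mul_exp_neg {a r : ℝ} (ha : 0 < a) (hr : 0 < r) :
    ∫⁻ s in Set.Ioi (0 : ℝ), ENNReal.ofReal (s ^ (a - 1) * Real.exp (-(s * r))) =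
      ENNReal.ofReal (Real.Gamma a * r ^ (-a)) := by
  have h := Real.integral_rpow_mul_exp_neg_mul_Ioi ha hr
  have hpos : 0 < (1 / r) ^ a * Real.Gamma a := mul_pos (by positivity) (Real.Gamma_pos_of_pos ha)
  have h' : ∫ s in Set.Ioi (0 : ℝ), s ^ (a - 1) * Real.exp (-(s * r)) =
      Real.Gamma a * r ^ (-a) := by
    rw [mul_comm (Real.Gamma a), Real.rpow_neg hr.le, ← Real.inv_rpow hr.le, inv_eq_one_div, ← h]
    simp_rw [mul_comm r]
  rw [← h', ofReal_integral_eq_lintegral_ofReal]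
  -- a nonzero Bochner integral is the integral of an integrable function
  · by_contra hn
    rw [integral_undef hn] at h'
    have : 0 < Real.Gamma a * r ^ (-a) := mul_pos (Real.Gamma_pos_of_pos ha) (by positivity)
    exact this.ne h'
  · filter_upwards [ae_restrict_mem measurableSet_Ioi] with s hs
    have hs : 0 < s := hs
    change (0 : ℝ) ≤ s ^ (a - 1) * Real.exp (-(s * r))
    positivity

/-- The constant in the formula that represents the Riesz kernel `|x|^{-β}` as a mixture of heat
kernels. -/
noncomputable def rieszHeatConst (k : ℕ) (β : ℝ) : ℝ :=
  (4 * Real.pi) ^ (-(k : ℝ) / 2) * (Real.Gamma (β / 2) * 2 ^ β)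

theorem rieszHeatConst_pos {β : ℝ} (hβ : 0 < β) : 0 < rieszHeatConst k β := by
  have := Real.Gamma_pos_of_pos (half_pos hβ)
  unfold rieszHeatConst
  positivity

/-- The Riesz kernel is a mixture of heat kernels. -/
theorem lintegral_rpow_mul_heatKernel {β : ℝ} (hβ : 0 < β) {x : EuclideanSpace ℝ (Fin k)}
    (hx : x ≠ 0) :
    ∫⁻ s in Set.Ioi (0 : ℝ), ENNReal.ofReal (s ^ (((k : ℝ) - β) / 2 - 1) * heatKernel s x) =
      ENNReal.ofReal (rieszHeatConst k β * ‖x‖ ^ (-β)) := by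
  have hx' : 0 < ‖x‖ := norm_pos_iff.2 hx
  have hr : 0 < ‖x‖ ^ 2 / 4 := by positivity
  set c : ℝ := (4 * Real.pi) ^ (-(k : ℝ) / 2) with hc
  have h0 : ∫ s in Set.Ioi (0 : ℝ), s ^ (((k : ℝ) - β) / 2 - 1) * heatKernel s x =
      rieszHeatConst k β * ‖x‖ ^ (-β) := by
    have h1 := Real.integral_rpow_mul_exp_neg_mul_Ioi (half_pos hβ) hr
    -- the substitution `s ↦ 1 / s` turns the integral into Euler's integral for `Γ(β / 2)`
    rw [← integral_comp_rpow_Ioi _ (p := -1) (by norm_num)] at h1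
    have h2 : ∫ s in Set.Ioi (0 : ℝ), s ^ (((k : ℝ) - β) / 2 - 1) * heatKernel s x =
        c * ∫ s in Set.Ioi (0 : ℝ), (|(-1 : ℝ)| * s ^ ((-1 : ℝ) - 1)) •
          ((s ^ (-1 : ℝ)) ^ (β / 2 - 1) * Real.exp (-(‖x‖ ^ 2 / 4 * s ^ (-1 : ℝ)))) := by
      rw [← integral_const_mul]
      refine setIntegral_congr_fun measurableSet_Ioi fun s hs => ?_
      have hs : 0 < s := hs
      have e1 : (4 * Real.pi * s) ^ (-(k : ℝ) / 2) = c * s ^ (-(k : ℝ) / 2) := by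
        rw [hc, Real.mul_rpow (by positivity) hs.le]
      have e2 : s ^ (((k : ℝ) - β) / 2 - 1) * s ^ (-(k : ℝ) / 2) =
          s ^ ((-1 : ℝ) - 1) * (s ^ (-1 : ℝ)) ^ (β / 2 - 1) := by
        rw [← Real.rpow_mul hs.le, ← Real.rpow_add hs, ← Real.rpow_add hs]
        congr 1; ring
      have e3 : -(4 * s)⁻¹ * ‖x‖ ^ 2 = -(‖x‖ ^ 2 / 4 * s ^ (-1 : ℝ)) := by
        rw [Real.rpow_neg_one]; field_simp
      simp only [heatKernel_of_pos hs, e1, e3, abs_neg, abs_one, one_mul, smul_eq_mul]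
      linear_combination c * Real.exp (-(‖x‖ ^ 2 / 4 * s ^ (-1 : ℝ))) * e2
    rw [h2, h1, rieszHeatConst, ← hc]
    have e4 : (1 / (‖x‖ ^ 2 / 4)) ^ (β / 2) = 2 ^ β * ‖x‖ ^ (-β) := by
      have : 1 / (‖x‖ ^ 2 / 4) = (2 * ‖x‖⁻¹) ^ (2 : ℝ) := by
        rw [Real.rpow_two]; field_simp; norm_num
      rw [this, ← Real.rpow_mul (by positivity), Real.mul_rpow (by positivity) (by positivity),
        Real.rpow_neg hx'.le, ← Real.inv_rpow hx'.le]
      congr 2 <;> ring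
    rw [e4]; ring
  rw [← h0, ofReal_integral_eq_lintegral_ofReal]
  -- a nonzero Bochner integral is the integral of an integrable function
  · by_contra hn
    rw [integral_undef hn] at h0
    have : 0 < rieszHeatConst k β * ‖x‖ ^ (-β) := mul_pos (rieszHeatConst_pos hβ) (by positivity)
    exact this.ne h0
  · filter_upwards [ae_restrict_mem measurableSet_Ioi] with s hs
    have hs : 0 < s := hs
    exact mul_nonneg (by positivity) (heatKernel_nonneg _ _)

end HeatKernel

/-! ### The covariance of the noise as a measure on pairs of points -/

section PairMeasure

variable {k : ℕ}

/-- The measure `dr dy dz` on `ℝ₊ × ℝᵏ × ℝᵏ`. -/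
noncomputable def timePairVolume (k : ℕ) :
    Measure (ℝ × EuclideanSpace ℝ (Fin k) × EuclideanSpace ℝ (Fin k)) :=
  (volume.restrict (Set.Ici (0 : ℝ))).prod (volume.prod volume)

instance : SFinite (timePairVolume k) := by unfold timePairVolume; infer_instance

/-- The pair of simultaneous space-time points `(r, y)` and `(r, z)`. -/
def simultaneous (t : ℝ × EuclideanSpace ℝ (Fin k) × EuclideanSpace ℝ (Fin k)) :
    SpaceTime k × SpaceTime k := ((t.1, t.2.1), (t.1, t.2.2))

@[fun_prop]
theorem measurable_simultaneous : Measurable (simultaneous (k := k)) := by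
  unfold simultaneous; fun_prop

/-- The measure on pairs of space-time points that is white in time and has the spatial density
`κ(y - z)`. -/
noncomputable def kernelPair (κ : EuclideanSpace ℝ (Fin k) → ℝ≥0∞) :
    Measure (SpaceTime k × SpaceTime k) :=
  ((timePairVolume k).withDensity (fun t => κ (t.2.1 - t.2.2))).map simultaneous

/-- The measure `π` on pairs of space-time points such that the covariance of the noise is
`∫ φ(p) ψ(q) π(dp, dq)`. It is carried by the diagonal in the case of space-time white noise. -/
noncomputable def noisePair (k : ℕ) (β : ℝ) : Measure (SpaceTime k × SpaceTime k) :=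
  open scoped Classical in
  if k = 1 ∧ β = 1 then
    (((volume.restrict (Set.Ici (0 : ℝ))).prod volume : Measure (SpaceTime k))).map
      (fun p => (p, p))
  else kernelPair (fun x => ENNReal.ofReal (‖x‖ ^ (-β)))

theorem lintegral_kernelPair {κ : EuclideanSpace ℝ (Fin k) → ℝ≥0∞} (hκ : Measurable κ)
    {F : SpaceTime k × SpaceTime k → ℝ≥0∞} (hF : Measurable F) :
    ∫⁻ x, F x ∂(kernelPair κ) =
      ∫⁻ t, κ (t.2.1 - t.2.2) * F (simultaneous t) ∂(timePairVolume k) := by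
  rw [kernelPair, lintegral_map hF measurable_simultaneous,
    lintegral_withDensity_eq_lintegral_mul _ (by fun_prop) (by fun_prop)]
  rfl

theorem lintegral_timePairVolume
    {f : ℝ × EuclideanSpace ℝ (Fin k) × EuclideanSpace ℝ (Fin k) → ℝ≥0∞} (hf : Measurable f) :
    ∫⁻ t, f t ∂(timePairVolume k) = ∫⁻ r in Set.Ici (0 : ℝ), ∫⁻ y, ∫⁻ z, f (r, y, z) := by
  rw [timePairVolume, lintegral_prod _ hf.aemeasurable]
  refine lintegral_congr fun r => ?_
  rw [lintegral_prod _ (by fun_prop)]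

theorem ae_restrict_prod_of_ae {p : SpaceTime k → Prop} (h : ∀ᵐ q, p q) :
    ∀ᵐ q ∂(((volume.restrict (Set.Ici (0 : ℝ))).prod volume : Measure (SpaceTime k))), p q :=
  (Measure.AbsolutelyContinuous.prod Measure.restrict_le_self.absolutelyContinuous
    Measure.AbsolutelyContinuous.rfl).ae_le h

theorem ae_ae_of_ae_spaceTime {p : SpaceTime k → Prop} (h : ∀ᵐ q, p q) :
    ∀ᵐ r ∂(volume.restrict (Set.Ici (0 : ℝ))), ∀ᵐ y, p (r, y) :=
  Measure.ae_ae_of_ae_prod (ae_restrict_prod_of_ae h)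

theorem ae_notMem_kernelPair {κ : EuclideanSpace ℝ (Fin k) → ℝ≥0∞}
    {N : Set (SpaceTime k × SpaceTime k)} (hN : MeasurableSet N)
    (h : ∀ᵐ r ∂(volume.restrict (Set.Ici (0 : ℝ))), ∀ᵐ y, ∀ᵐ z, ((r, y), (r, z)) ∉ N) :
    ∀ᵐ x ∂(kernelPair κ), x ∉ N := by
  rw [kernelPair, ae_map_iff measurable_simultaneous.aemeasurable hN.compl]
  refine (withDensity_absolutelyContinuous _ _).ae_le ?_
  have hm : Measurable fun t => N.indicator (fun _ => (1 : ℝ≥0∞)) (simultaneous (k := k) t) :=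
    (measurable_const.indicator hN).comp measurable_simultaneous
  have h2 : ∫⁻ t, N.indicator (fun _ => (1 : ℝ≥0∞)) (simultaneous t) ∂(timePairVolume k) = 0 := by
    rw [lintegral_timePairVolume hm, ← lintegral_zero (μ := volume.restrict (Set.Ici (0 : ℝ)))]
    refine lintegral_congr_ae ?_
    filter_upwards [h] with r hr
    rw [← lintegral_zero (μ := (volume : Measure (EuclideanSpace ℝ (Fin k))))]
    refine lintegral_congr_ae ?_
    filter_upwards [hr] with y hy
    rw [← lintegral_zero (μ := (volume : Measure (EuclideanSpace ℝ (Fin k))))]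
    refine lintegral_congr_ae ?_
    filter_upwards [hy] with z hz
    simp [simultaneous, hz]
  rw [lintegral_eq_zero_iff hm] at h2
  filter_upwards [h2] with t ht hp
  simp [hp] at ht

/-- Null sets of space-time are invisible to the pair measures, although these are carried by pairs
of simultaneous points; so integrands may be changed on null sets. -/
theorem ae_fst_kernelPair {κ : EuclideanSpace ℝ (Fin k) → ℝ≥0∞} {p : SpaceTime k → Prop}
    (h : ∀ᵐ q, p q) : ∀ᵐ x ∂(kernelPair κ), p x.1 := by
  obtain ⟨N, hN, hNm, hN0⟩ := exists_measurable_superset_of_null (ae_iff.1 h)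
  have h3 : ∀ᵐ q, q ∉ N := measure_eq_zero_iff_ae_notMem.1 hN0
  filter_upwards [ae_notMem_kernelPair (κ := κ) (measurable_fst hNm) (by
    filter_upwards [ae_ae_of_ae_spaceTime h3] with r hr
    filter_upwards [hr] with y hy
    exact ae_of_all _ fun z => hy)] with x hx
  by_contra hp
  exact hx (hN hp)

theorem ae_snd_kernelPair {κ : EuclideanSpace ℝ (Fin k) → ℝ≥0∞} {p : SpaceTime k → Prop}
    (h : ∀ᵐ q, p q) : ∀ᵐ x ∂(kernelPair κ), p x.2 := by
  obtain ⟨N, hN, hNm, hN0⟩ := exists_measurable_superset_of_null (ae_iff.1 h)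
  have h3 : ∀ᵐ q, q ∉ N := measure_eq_zero_iff_ae_notMem.1 hN0
  filter_upwards [ae_notMem_kernelPair (κ := κ) (measurable_snd hNm) (by
    filter_upwards [ae_ae_of_ae_spaceTime h3] with r hr
    exact ae_of_all _ fun y => hr)] with x hx
  by_contra hp
  exact hx (hN hp)

theorem ae_diag_of_ae {p : SpaceTime k → Prop} (h : ∀ᵐ q, p q) :
    ∀ᵐ x ∂((((volume.restrict (Set.Ici (0 : ℝ))).prod volume : Measure (SpaceTime k))).map
      (fun p => (p, p))), p x.1 ∧ p x.2 := by
  obtain ⟨N, hN, hNm, hN0⟩ := exists_measurable_superset_of_null (ae_iff.1 h)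
  have h3 : ∀ᵐ q, q ∉ N := measure_eq_zero_iff_ae_notMem.1 hN0
  have h4 : ∀ᵐ x ∂((((volume.restrict (Set.Ici (0 : ℝ))).prod volume : Measure (SpaceTime k))).map
      (fun p => (p, p))), x ∉ Prod.fst ⁻¹' N ∪ Prod.snd ⁻¹' N := by
    rw [ae_map_iff (by fun_prop)
      (((measurable_fst hNm).union (measurable_snd hNm)).compl)]
    filter_upwards [ae_restrict_prod_of_ae h3] with q hq
    simpa using hq
  filter_upwards [h4] with x hx
  constructor <;> by_contra hp
  · exact hx (Or.inl (hN hp))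
  · exact hx (Or.inr (hN hp))

theorem ae_fst_noisePair {β : ℝ} {p : SpaceTime k → Prop} (h : ∀ᵐ q, p q) :
    ∀ᵐ x ∂(noisePair k β), p x.1 := by
  unfold noisePair
  split_ifs
  · exact (ae_diag_of_ae h).mono fun x hx => hx.1
  · exact ae_fst_kernelPair h

theorem ae_snd_noisePair {β : ℝ} {p : SpaceTime k → Prop} (h : ∀ᵐ q, p q) :
    ∀ᵐ x ∂(noisePair k β), p x.2 := by
  unfold noisePair
  split_ifs
  · exact (ae_diag_of_ae h).mono fun x hx => hx.2
  · exact ae_snd_kernelPair h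

theorem quasiMeasurePreserving_fst_noisePair (β : ℝ) :
    Measure.QuasiMeasurePreserving Prod.fst (noisePair k β) volume :=
  ⟨measurable_fst, Measure.AbsolutelyContinuous.mk fun s hs h0 => by
    rw [Measure.map_apply measurable_fst hs]
    exact measure_eq_zero_iff_ae_notMem.2
      (ae_fst_noisePair (p := fun q => q ∉ s) (measure_eq_zero_iff_ae_notMem.1 h0))⟩

theorem quasiMeasurePreserving_snd_noisePair (β : ℝ) :
    Measure.QuasiMeasurePreserving Prod.snd (noisePair k β) volume :=
  ⟨measurable_snd, Measure.AbsolutelyContinuous.mk fun s hs h0 => by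
    rw [Measure.map_apply measurable_snd hs]
    exact measure_eq_zero_iff_ae_notMem.2
      (ae_snd_noisePair (p := fun q => q ∉ s) (measure_eq_zero_iff_ae_notMem.1 h0))⟩

/-- The bilinear form of the noise, for functions with values in `[0, ∞]`. -/
noncomputable def pairForm (π : Measure (SpaceTime k × SpaceTime k)) (f g : SpaceTime k → ℝ≥0∞) :
    ℝ≥0∞ := ∫⁻ x, f x.1 * g x.2 ∂π

theorem pairForm_congr {β : ℝ} {f g f' g' : SpaceTime k → ℝ≥0∞} (hf : f =ᵐ[volume] f')
    (hg : g =ᵐ[volume] g') : pairForm (noisePair k β) f g = pairForm (noisePair k β) f' g' := by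
  refine lintegral_congr_ae ?_
  filter_upwards [ae_fst_noisePair hf, ae_snd_noisePair hg] with x h1 h2
  rw [h1, h2]

theorem noiseNormSq_eq_pairForm {F : Type*} [NormedAddCommGroup F] (β : ℝ) {φ : SpaceTime k → F}
    (hφ : AEStronglyMeasurable φ volume) :
    noiseNormSq β φ = pairForm (noisePair k β) (fun p => ‖φ p‖ₑ) (fun p => ‖φ p‖ₑ) := by
  obtain ⟨f, hf, hφf⟩ : ∃ f : SpaceTime k → ℝ≥0∞, Measurable f ∧ (fun p => ‖φ p‖ₑ) =ᵐ[volume] f :=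
    ⟨_, hφ.enorm.measurable_mk, hφ.enorm.ae_eq_mk⟩
  rw [pairForm_congr hφf hφf]
  have hae := ae_ae_of_ae_spaceTime hφf
  unfold noiseNormSq noisePair pairForm
  split_ifs with h
  · rw [lintegral_map (by fun_prop) (by fun_prop), lintegral_prod _ (by fun_prop)]
    refine lintegral_congr_ae ?_
    filter_upwards [hae] with r hr
    refine lintegral_congr_ae ?_
    filter_upwards [hr] with y hy
    rw [hy]
  · rw [lintegral_kernelPair (by fun_prop) (by fun_prop), lintegral_timePairVolume
      (by unfold simultaneous; fun_prop)]
    refine lintegral_congr_ae ?_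
    filter_upwards [hae] with r hr
    refine lintegral_congr_ae ?_
    filter_upwards [hr] with y hy
    refine lintegral_congr_ae ?_
    filter_upwards [hr] with z hz
    rw [hy, hz]
    simp only [simultaneous]
    ring

theorem noiseCov_eq_integral (β : ℝ) {φ ψ : SpaceTime k → ℝ}
    (h : Integrable (fun x => φ x.1 * ψ x.2) (noisePair k β)) :
    noiseCov β φ ψ = ∫ x, φ x.1 * ψ x.2 ∂(noisePair k β) := by
  unfold noiseCov noisePair at *
  have hm := h.1
  split_ifs at h hm ⊢ with hc
  · rw [integrable_map_measure hm (by fun_prop)] at h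
    rw [integral_map (by fun_prop) hm]
    exact (integral_prod (fun q : SpaceTime k => φ q * ψ q) h).symm
  · have hκ : Measurable fun t : ℝ × EuclideanSpace ℝ (Fin k) × EuclideanSpace ℝ (Fin k) =>
        ENNReal.ofReal (‖t.2.1 - t.2.2‖ ^ (-β)) := by fun_prop
    rw [kernelPair] at h hm ⊢
    rw [integrable_map_measure hm (by fun_prop),
      integrable_withDensity_iff_integrable_smul' hκ (by simp)] at h
    rw [integral_map (by fun_prop) hm,
      integral_withDensity_eq_integral_toReal_smul hκ (by simp)]
    rw [timePairVolume] at h ⊢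
    have h2 := integral_prod _ h
    refine Eq.trans ?_ h2.symm
    refine integral_congr_ae ?_
    filter_upwards [h.prod_right_ae] with r hr
    rw [integral_prod _ hr]
    refine integral_congr_ae (ae_of_all _ fun y => integral_congr_ae (ae_of_all _ fun z => ?_))
    have : 0 ≤ ‖y - z‖ ^ (-β) := by positivity
    simp only [Function.comp_apply, simultaneous, ENNReal.toReal_ofReal this, smul_eq_mul]
    ring

/-! ### Positive definiteness of the covariance -/

theorem lintegral_mul_le_sqrt_mul_sqrt {α : Type*} [MeasurableSpace α] (μ : Measure α)
    {f g : α → ℝ≥0∞} (hf : Measurable f) (hg : Measurable g) :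
    ∫⁻ a, f a * g a ∂μ ≤ (∫⁻ a, f a * f a ∂μ) ^ (2⁻¹ : ℝ) * (∫⁻ a, g a * g a ∂μ) ^ (2⁻¹ : ℝ) := by
  have h := ENNReal.lintegral_mul_le_Lp_mul_Lq μ (p := 2) (q := 2)
    (Real.holderConjugate_iff.2 ⟨by norm_num, by norm_num⟩) hf.aemeasurable hg.aemeasurable
  simpa [ENNReal.rpow_two, sq] using h

/-- The form with spatial kernel `G(2s, y - z)` is of the shape `∫ (f ∗ G_s) (g ∗ G_s)`. -/
theorem pairForm_heatKernel {s : ℝ} (hs : 0 < s) {f g : SpaceTime k → ℝ≥0∞} (hf : Measurable f)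
    (hg : Measurable g) :
    pairForm (kernelPair fun x => ENNReal.ofReal (heatKernel (2 * s) x)) f g =
      ∫⁻ q, (∫⁻ y, f (q.1, y) * ENNReal.ofReal (heatKernel s (y - q.2))) *
        (∫⁻ z, g (q.1, z) * ENNReal.ofReal (heatKernel s (z - q.2)))
        ∂(((volume.restrict (Set.Ici (0 : ℝ))).prod volume : Measure (SpaceTime k))) := by
  rw [pairForm, lintegral_kernelPair (by fun_prop) (by fun_prop),
    lintegral_timePairVolume (by unfold simultaneous; fun_prop), lintegral_prod _ (by fun_prop)]
  refine lintegral_congr fun r => ?_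
  simp only [simultaneous]
  rw [← lintegral_prod (μ := volume) (ν := volume)
    (fun p : EuclideanSpace ℝ (Fin k) × EuclideanSpace ℝ (Fin k) =>
      ENNReal.ofReal (heatKernel (2 * s) (p.1 - p.2)) * (f (r, p.1) * g (r, p.2)))
    (by fun_prop)]
  simp_rw [← lintegral_heatKernel_mul_heatKernel hs]
  have e1 : ∀ p : EuclideanSpace ℝ (Fin k) × EuclideanSpace ℝ (Fin k),
      (∫⁻ u, ENNReal.ofReal (heatKernel s (p.1 - u)) * ENNReal.ofReal (heatKernel s (p.2 - u))) *
        (f (r, p.1) * g (r, p.2)) =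
      ∫⁻ u, (f (r, p.1) * ENNReal.ofReal (heatKernel s (p.1 - u))) *
        (g (r, p.2) * ENNReal.ofReal (heatKernel s (p.2 - u))) := by
    intro p
    rw [← lintegral_mul_const _ (by fun_prop)]
    exact lintegral_congr fun u => by ring
  simp_rw [e1]
  rw [lintegral_lintegral_swap (by unfold Function.uncurry; fun_prop)]
  refine lintegral_congr fun u => ?_
  exact lintegral_prod_mul (f := fun y => f (r, y) * ENNReal.ofReal (heatKernel s (y - u)))
    (g := fun z => g (r, z) * ENNReal.ofReal (heatKernel s (z - u))) (by fun_prop) (by fun_prop)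

/-- The Cauchy–Schwarz inequality for the heat kernel: the forms are `L²` inner products of
functions smoothed by the heat kernel with half the time. -/
theorem pairForm_heatKernel_le {s : ℝ} (hs : 0 < s) {f g : SpaceTime k → ℝ≥0∞} (hf : Measurable f)
    (hg : Measurable g) :
    pairForm (kernelPair fun x => ENNReal.ofReal (heatKernel s x)) f g ≤
      (pairForm (kernelPair fun x => ENNReal.ofReal (heatKernel s x)) f f) ^ (2⁻¹ : ℝ) *
      (pairForm (kernelPair fun x => ENNReal.ofReal (heatKernel s x)) g g) ^ (2⁻¹ : ℝ) := by
  obtain ⟨s, rfl⟩ : ∃ s', s = 2 * s' := ⟨s / 2, by ring⟩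
  have hs' : 0 < s := by linarith
  rw [pairForm_heatKernel hs' hf hg, pairForm_heatKernel hs' hf hf, pairForm_heatKernel hs' hg hg]
  exact lintegral_mul_le_sqrt_mul_sqrt _ (by fun_prop) (by fun_prop)

/-- The weight with which the heat kernels are mixed to form the Riesz kernel. -/
noncomputable def rieszWeight (k : ℕ) (β : ℝ) : Measure ℝ :=
  (volume.restrict (Set.Ioi (0 : ℝ))).withDensity
    fun s => ENNReal.ofReal (s ^ (((k : ℝ) - β) / 2 - 1))

instance (β : ℝ) : SFinite (rieszWeight k β) := by unfold rieszWeight; infer_instance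

theorem ae_rieszWeight_pos (β : ℝ) : ∀ᵐ s ∂(rieszWeight k β), 0 < s :=
  (withDensity_absolutelyContinuous _ _).ae_le (ae_restrict_mem measurableSet_Ioi)

theorem lintegral_rieszWeight (β : ℝ) {f : ℝ → ℝ≥0∞} (hf : Measurable f) :
    ∫⁻ s, f s ∂(rieszWeight k β) =
      ∫⁻ s in Set.Ioi (0 : ℝ), ENNReal.ofReal (s ^ (((k : ℝ) - β) / 2 - 1)) * f s := by
  rw [rieszWeight, lintegral_withDensity_eq_lintegral_mul _ (by fun_prop) hf]
  rfl

theorem lintegral_rieszWeight_heatKernel {β : ℝ} (hβ : 0 < β) {x : EuclideanSpace ℝ (Fin k)}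
    (hx : x ≠ 0) :
    ∫⁻ s, ENNReal.ofReal (heatKernel s x) ∂(rieszWeight k β) =
      ENNReal.ofReal (rieszHeatConst k β) * ENNReal.ofReal (‖x‖ ^ (-β)) := by
  rw [lintegral_rieszWeight _ (by fun_prop), ← ENNReal.ofReal_mul (rieszHeatConst_pos hβ).le,
    ← lintegral_rpow_mul_heatKernel hβ hx]
  refine setLIntegral_congr_fun measurableSet_Ioi fun s hs => ?_
  have hs : 0 < s := hs
  rw [ENNReal.ofReal_mul (by positivity)]

/-- The diagonal, where `‖y - z‖ ^ (-β)` has the junk value `0`, is a null set. -/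
theorem ae_timePairVolume_ne (hk : 1 ≤ k) :
    ∀ᵐ t ∂(timePairVolume k), t.2.1 - t.2.2 ≠ 0 := by
  have : Nonempty (Fin k) := ⟨⟨0, hk⟩⟩
  have hm : MeasurableSet {t : ℝ × EuclideanSpace ℝ (Fin k) × EuclideanSpace ℝ (Fin k) |
      t.2.1 - t.2.2 = 0} := measurableSet_eq_fun (by fun_prop) (by fun_prop)
  have hm' : Measurable ({t : ℝ × EuclideanSpace ℝ (Fin k) × EuclideanSpace ℝ (Fin k) |
      t.2.1 - t.2.2 = 0}.indicator (fun _ => (1 : ℝ≥0∞))) := measurable_const.indicator hm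
  suffices h : timePairVolume k {t : ℝ × EuclideanSpace ℝ (Fin k) × EuclideanSpace ℝ (Fin k) |
      t.2.1 - t.2.2 = 0} = 0 from measure_eq_zero_iff_ae_notMem.1 h
  rw [← lintegral_indicator_one hm]
  refine (lintegral_timePairVolume hm').trans ?_
  rw [← lintegral_zero (μ := volume.restrict (Set.Ici (0 : ℝ)))]
  refine lintegral_congr fun r => ?_
  rw [← lintegral_zero (μ := (volume : Measure (EuclideanSpace ℝ (Fin k))))]
  refine lintegral_congr fun y => ?_
  rw [← lintegral_zero (μ := (volume : Measure (EuclideanSpace ℝ (Fin k))))]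
  refine lintegral_congr_ae ?_
  have : ∀ᵐ z : EuclideanSpace ℝ (Fin k), z ≠ y := by
    rw [ae_iff]; simp
  filter_upwards [this] with z hz
  simp [sub_eq_zero, hz.symm]

/-- Integrals with respect to the measure with the Riesz kernel are mixtures of integrals with
respect to the measures with heat kernels. -/
theorem lintegral_rieszPair_eq (hk : 1 ≤ k) {β : ℝ} (hβ : 0 < β)
    {F : SpaceTime k × SpaceTime k → ℝ≥0∞} (hF : Measurable F) :
    ENNReal.ofReal (rieszHeatConst k β) *
      ∫⁻ x, F x ∂(kernelPair fun x => ENNReal.ofReal (‖x‖ ^ (-β))) =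
      ∫⁻ s, ∫⁻ x, F x ∂(kernelPair fun x => ENNReal.ofReal (heatKernel s x))
        ∂(rieszWeight k β) := by
  have h1 : ∀ s, ∫⁻ x, F x ∂(kernelPair fun x => ENNReal.ofReal (heatKernel s x)) =
      ∫⁻ t, ENNReal.ofReal (heatKernel s (t.2.1 - t.2.2)) * F (simultaneous t)
        ∂(timePairVolume k) := fun s => lintegral_kernelPair (by fun_prop) hF
  simp_rw [h1]
  rw [lintegral_lintegral_swap (by unfold Function.uncurry; fun_prop),
    lintegral_kernelPair (by fun_prop) hF, ← lintegral_const_mul _ (by fun_prop)]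
  refine lintegral_congr_ae ?_
  filter_upwards [ae_timePairVolume_ne hk] with t ht
  rw [lintegral_mul_const _ (by fun_prop), lintegral_rieszWeight_heatKernel hβ ht]
  ring

theorem measurable_lintegral_heatPair {F : SpaceTime k × SpaceTime k → ℝ≥0∞} (hF : Measurable F) :
    Measurable fun s => ∫⁻ x, F x ∂(kernelPair fun x => ENNReal.ofReal (heatKernel s x)) := by
  have h1 : ∀ s, ∫⁻ x, F x ∂(kernelPair fun x => ENNReal.ofReal (heatKernel s x)) =
      ∫⁻ t, ENNReal.ofReal (heatKernel s (t.2.1 - t.2.2)) * F (simultaneous t)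
        ∂(timePairVolume k) := fun s => lintegral_kernelPair (by fun_prop) hF
  simp_rw [h1]
  fun_prop

/-- The Cauchy–Schwarz inequality for each heat kernel is integrated with respect to their weight,
where it is applied once more. -/
theorem pairForm_noisePair_le_of_measurable (hk : 1 ≤ k) {β : ℝ} (hβ : 0 < β)
    {f g : SpaceTime k → ℝ≥0∞} (hf : Measurable f) (hg : Measurable g) :
    pairForm (noisePair k β) f g ≤
      pairForm (noisePair k β) f f ^ (2⁻¹ : ℝ) * pairForm (noisePair k β) g g ^ (2⁻¹ : ℝ) := by
  unfold noisePair
  split_ifs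
  · simp only [pairForm]
    rw [lintegral_map (by fun_prop) (by fun_prop), lintegral_map (by fun_prop) (by fun_prop),
      lintegral_map (by fun_prop) (by fun_prop)]
    exact lintegral_mul_le_sqrt_mul_sqrt _ hf hg
  · have hC0 : ENNReal.ofReal (rieszHeatConst k β) ≠ 0 :=
      (ENNReal.ofReal_pos.2 (rieszHeatConst_pos hβ)).ne'
    have hCt : ENNReal.ofReal (rieszHeatConst k β) ≠ ∞ := ENNReal.ofReal_ne_top
    have hsq : ∀ a : ℝ≥0∞, a ^ (2⁻¹ : ℝ) * a ^ (2⁻¹ : ℝ) = a := fun a => by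
      rw [← ENNReal.rpow_add_of_nonneg _ _ (by norm_num) (by norm_num)]; norm_num
    rw [← ENNReal.mul_le_mul_iff_right hC0 hCt]
    have e : ENNReal.ofReal (rieszHeatConst k β) *
        (pairForm (kernelPair fun x => ENNReal.ofReal (‖x‖ ^ (-β))) f f ^ (2⁻¹ : ℝ) *
          pairForm (kernelPair fun x => ENNReal.ofReal (‖x‖ ^ (-β))) g g ^ (2⁻¹ : ℝ)) =
        (ENNReal.ofReal (rieszHeatConst k β) *
          pairForm (kernelPair fun x => ENNReal.ofReal (‖x‖ ^ (-β))) f f) ^ (2⁻¹ : ℝ) *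
        (ENNReal.ofReal (rieszHeatConst k β) *
          pairForm (kernelPair fun x => ENNReal.ofReal (‖x‖ ^ (-β))) g g) ^ (2⁻¹ : ℝ) := by
      rw [ENNReal.mul_rpow_of_nonneg _ _ (by norm_num),
        ENNReal.mul_rpow_of_nonneg _ _ (by norm_num)]
      conv_lhs => rw [← hsq (ENNReal.ofReal (rieszHeatConst k β))]
      ring
    rw [e]
    simp only [pairForm]
    rw [lintegral_rieszPair_eq hk hβ (by fun_prop), lintegral_rieszPair_eq hk hβ (by fun_prop),
      lintegral_rieszPair_eq hk hβ (by fun_prop)]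
    have m1 := (measurable_lintegral_heatPair (F := fun x => f x.1 * f x.2) (by fun_prop)).pow_const
      (2⁻¹ : ℝ)
    have m2 := (measurable_lintegral_heatPair (F := fun x => g x.1 * g x.2) (by fun_prop)).pow_const
      (2⁻¹ : ℝ)
    have h := lintegral_mul_le_sqrt_mul_sqrt (rieszWeight k β) m1 m2
    simp_rw [hsq] at h
    refine le_trans (lintegral_mono_ae ?_) h
    filter_upwards [ae_rieszWeight_pos β] with s hs
    exact pairForm_heatKernel_le hs hf hg

/-- The Cauchy–Schwarz inequality for the covariance form on nonnegative functions. -/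
theorem pairForm_noisePair_le (hk : 1 ≤ k) {β : ℝ} (hβ : 0 < β)
    {f g : SpaceTime k → ℝ≥0∞} (hf : AEMeasurable f) (hg : AEMeasurable g) :
    pairForm (noisePair k β) f g ≤
      pairForm (noisePair k β) f f ^ (2⁻¹ : ℝ) * pairForm (noisePair k β) g g ^ (2⁻¹ : ℝ) := by
  rw [pairForm_congr hf.ae_eq_mk hg.ae_eq_mk, pairForm_congr hf.ae_eq_mk hf.ae_eq_mk,
    pairForm_congr hg.ae_eq_mk hg.ae_eq_mk]
  exact pairForm_noisePair_le_of_measurable hk hβ hf.measurable_mk hg.measurable_mk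

end PairMeasure

/-! ### Continuity of the covariance and integrals with respect to the noise -/

section Continuity

variable {k : ℕ} {β : ℝ} {𝕜 : Type*} [RCLike 𝕜]

theorem aestronglyMeasurable_fst_mul_snd {φ ψ : SpaceTime k → 𝕜}
    (hφ : AEStronglyMeasurable φ volume) (hψ : AEStronglyMeasurable ψ volume) :
    AEStronglyMeasurable (fun x : SpaceTime k × SpaceTime k => φ x.1 * ψ x.2) (noisePair k β) :=
  (hφ.comp_quasiMeasurePreserving (quasiMeasurePreserving_fst_noisePair β)).mul
    (hψ.comp_quasiMeasurePreserving (quasiMeasurePreserving_snd_noisePair β))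

/-- No cancellation is used: the bound holds for the integral of the absolute value. -/
theorem lintegral_enorm_fst_mul_snd_le (hk : 1 ≤ k) (hβ : 0 < β) {φ ψ : SpaceTime k → 𝕜}
    (hφ : AEStronglyMeasurable φ volume) (hψ : AEStronglyMeasurable ψ volume) :
    ∫⁻ x, ‖φ x.1 * ψ x.2‖ₑ ∂(noisePair k β) ≤
      noiseNormSq β φ ^ (2⁻¹ : ℝ) * noiseNormSq β ψ ^ (2⁻¹ : ℝ) := by
  rw [noiseNormSq_eq_pairForm β hφ, noiseNormSq_eq_pairForm β hψ]
  simp_rw [enorm_mul]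
  exact pairForm_noisePair_le hk hβ hφ.enorm hψ.enorm

theorem integrable_fst_mul_snd (hk : 1 ≤ k) (hβ : 0 < β) {φ ψ : SpaceTime k → 𝕜}
    (hφ : AEStronglyMeasurable φ volume) (hψ : AEStronglyMeasurable ψ volume)
    (hφN : noiseNormSq β φ < ∞) (hψN : noiseNormSq β ψ < ∞) :
    Integrable (fun x : SpaceTime k × SpaceTime k => φ x.1 * ψ x.2) (noisePair k β) := by
  refine ⟨aestronglyMeasurable_fst_mul_snd hφ hψ,
    (lintegral_enorm_fst_mul_snd_le hk hβ hφ hψ).trans_lt ?_⟩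
  exact ENNReal.mul_lt_top (ENNReal.rpow_lt_top_of_nonneg (by norm_num) hφN.ne)
    (ENNReal.rpow_lt_top_of_nonneg (by norm_num) hψN.ne)

theorem tendsto_rpow_half {ι : Type*} {l : Filter ι} {u : ι → ℝ≥0∞} (h : Tendsto u l (𝓝 0)) :
    Tendsto (fun i => u i ^ (2⁻¹ : ℝ)) l (𝓝 0) := by
  have h3 := ((ENNReal.continuous_rpow_const (y := (2 : ℝ)⁻¹)).tendsto 0).comp h
  rwa [ENNReal.zero_rpow_of_pos (by norm_num)] at h3

/-- The covariance of the noise is continuous with respect to the norm of the integrands. -/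
theorem tendsto_noiseCov (hk : 1 ≤ k) (hβ : 0 < β) {Φ Ψ : ℕ → SpaceTime k → ℝ}
    {g h : SpaceTime k → ℝ} (hΦ : ∀ n, AEStronglyMeasurable (Φ n) volume)
    (hΨ : ∀ n, AEStronglyMeasurable (Ψ n) volume) (hg : AEStronglyMeasurable g volume)
    (hh : AEStronglyMeasurable h volume) (hgN : noiseNormSq β g < ∞) (hhN : noiseNormSq β h < ∞)
    (hΦt : Tendsto (fun n => noiseNormSq β (fun p => Φ n p - g p)) atTop (𝓝 0))
    (hΨt : Tendsto (fun n => noiseNormSq β (fun p => Ψ n p - h p)) atTop (𝓝 0)) :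
    Tendsto (fun n => noiseCov β (Φ n) (Ψ n)) atTop (𝓝 (noiseCov β g h)) := by
  rw [tendsto_iff_edist_tendsto_0]
  have hle : ∀ᶠ n in atTop, edist (noiseCov β (Φ n) (Ψ n)) (noiseCov β g h) ≤
      noiseNormSq β (fun p => Φ n p - g p) ^ (2⁻¹ : ℝ) *
        noiseNormSq β (fun p => Ψ n p - h p) ^ (2⁻¹ : ℝ) +
      (noiseNormSq β (fun p => Φ n p - g p) ^ (2⁻¹ : ℝ) * noiseNormSq β h ^ (2⁻¹ : ℝ) +
        noiseNormSq β g ^ (2⁻¹ : ℝ) * noiseNormSq β (fun p => Ψ n p - h p) ^ (2⁻¹ : ℝ)) := by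
    filter_upwards [hΦt.eventually (gt_mem_nhds ENNReal.zero_lt_top),
      hΨt.eventually (gt_mem_nhds ENNReal.zero_lt_top)] with n hn1 hn2
    have hu : AEStronglyMeasurable (fun p => Φ n p - g p) volume := (hΦ n).sub hg
    have hv : AEStronglyMeasurable (fun p => Ψ n p - h p) volume := (hΨ n).sub hh
    have i1 := integrable_fst_mul_snd hk hβ hu hv hn1 hn2
    have i2 := integrable_fst_mul_snd hk hβ hu hh hn1 hhN
    have i3 := integrable_fst_mul_snd hk hβ hg hv hgN hn2
    have i4 := integrable_fst_mul_snd hk hβ hg hh hgN hhN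
    have hsum : (fun x : SpaceTime k × SpaceTime k => Φ n x.1 * Ψ n x.2) = fun x =>
        ((Φ n x.1 - g x.1) * (Ψ n x.2 - h x.2) + ((Φ n x.1 - g x.1) * h x.2 +
          g x.1 * (Ψ n x.2 - h x.2))) + g x.1 * h x.2 := by
      ext x; ring
    have i0 : Integrable (fun x : SpaceTime k × SpaceTime k => Φ n x.1 * Ψ n x.2)
        (noisePair k β) := by
      rw [hsum]; exact (i1.add (i2.add i3)).add i4
    have i23 : Integrable (fun x : SpaceTime k × SpaceTime k => (Φ n x.1 - g x.1) * h x.2 +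
          g x.1 * (Ψ n x.2 - h x.2)) (noisePair k β) := i2.add i3
    have i123 : Integrable (fun x : SpaceTime k × SpaceTime k =>
        (Φ n x.1 - g x.1) * (Ψ n x.2 - h x.2) + ((Φ n x.1 - g x.1) * h x.2 +
          g x.1 * (Ψ n x.2 - h x.2))) (noisePair k β) := i1.add i23
    rw [edist_eq_enorm_sub, noiseCov_eq_integral β i0, noiseCov_eq_integral β i4, hsum,
      integral_add i123 i4, add_sub_cancel_right, integral_add i1 i23, integral_add i2 i3]
    have hb : ∀ {a b : SpaceTime k → ℝ}, AEStronglyMeasurable a volume →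
        AEStronglyMeasurable b volume → ‖∫ x, a x.1 * b x.2 ∂(noisePair k β)‖ₑ ≤
          noiseNormSq β a ^ (2⁻¹ : ℝ) * noiseNormSq β b ^ (2⁻¹ : ℝ) := fun ha hb =>
      (enorm_integral_le_lintegral_enorm _).trans (lintegral_enorm_fst_mul_snd_le hk hβ ha hb)
    exact (enorm_add_le _ _).trans (add_le_add (hb hu hv) ((enorm_add_le _ _).trans
      (add_le_add (hb hu hh) (hb hg hv))))
  refine tendsto_of_tendsto_of_tendsto_of_le_of_le' tendsto_const_nhds ?_
    (Eventually.of_forall fun _ => zero_le) hle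
  have h1 := tendsto_rpow_half hΦt
  have h2 := tendsto_rpow_half hΨt
  have hgN' : noiseNormSq β g ^ (2⁻¹ : ℝ) ≠ ∞ :=
    (ENNReal.rpow_lt_top_of_nonneg (by norm_num) hgN.ne).ne
  have hhN' : noiseNormSq β h ^ (2⁻¹ : ℝ) ≠ ∞ :=
    (ENNReal.rpow_lt_top_of_nonneg (by norm_num) hhN.ne).ne
  have h3 := ENNReal.Tendsto.mul h1 (Or.inr ENNReal.zero_ne_top) h2 (Or.inr ENNReal.zero_ne_top)
  have h4 := ENNReal.Tendsto.mul_const (b := noiseNormSq β h ^ (2⁻¹ : ℝ)) h1 (Or.inr hhN')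
  have h5 := ENNReal.Tendsto.const_mul (a := noiseNormSq β g ^ (2⁻¹ : ℝ)) h2 (Or.inr hgN')
  simpa using h3.add (h4.add h5)

end Continuity

section NoiseIntegral

variable {k : ℕ} {β : ℝ} {Ω ι T : Type*} [MeasurableSpace Ω] {P : Measure Ω}
  {D : Set (SpaceTime k → ℝ)} {X : ι → (SpaceTime k → ℝ) → Ω → ℝ}

open scoped Classical in
/-- The integrals of deterministic functions with respect to a noise form a centered Gaussian
process, and their covariances are those given by the covariance form, whatever class of functions
the noise is defined on. -/
theorem HeatNoise.IsNoise.noiseIntegral [IsProbabilityMeasure P] (hX : IsNoise P β D X)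
    (hk : 1 ≤ k) (hβ : 0 < β) (hD : ∀ φ ∈ D, AEStronglyMeasurable φ volume)
    {g : T → SpaceTime k → ℝ} (hg : ∀ t, AEStronglyMeasurable (g t) volume)
    (hgN : ∀ t, noiseNormSq β (g t) < ∞) {u : ι → T → Ω → ℝ}
    (hu : ∀ i t, HasNoiseIntegral P β D (X i) (g t) (u i t)) :
    IsGaussianProcess (fun q : ι × T => u q.1 q.2) P ∧ (∀ i t, ∫ ω, u i t ω ∂P = 0) ∧
      ∀ i j t t', ∫ ω, u i t ω * u j t' ω ∂P =
        if i = j then noiseCov β (g t) (g t') else 0 := by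
  have h0 : ∀ q : ι × D, ∫ ω, X q.1 q.2.1 ω ∂P = 0 := fun q => hX.centered q.1 q.2.1 q.2.2
  have hXm : ∀ i, ∀ φ ∈ D, MemLp (X i φ) 2 P := fun i φ hφ =>
    (hX.gaussian.hasGaussianLaw_eval (i, ⟨φ, hφ⟩)).memLp_two
  have hmem : ∀ q : ι × T, ∃ f ∈ gaussianSpan P (fun q : ι × D => X q.1 q.2.1),
      f =ᵐ[P] u q.1 q.2 := by
    rintro ⟨i, t⟩
    obtain ⟨hm, Φ, hΦ, -, hΦX⟩ := hu i t
    refine exists_mem_gaussianSpan_of_tendsto hm (fun n => ?_) hΦX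
    exact ⟨(hXm i _ (hΦ n)).toLp, subset_gaussianSpan (t := (i, ⟨Φ n, hΦ n⟩))
      (hXm i _ (hΦ n)).coeFn_toLp, (hXm i _ (hΦ n)).coeFn_toLp⟩
  refine ⟨isGaussianProcess_of_mem_gaussianSpan hX.gaussian h0 hmem,
    fun i t => integral_eq_zero_of_mem_gaussianSpan hX.gaussian h0 (hmem (i, t)),
    fun i j t t' => ?_⟩
  obtain ⟨hm, Φ, hΦ, hΦg, hΦX⟩ := hu i t
  obtain ⟨hm', Ψ, hΨ, hΨg, hΨX⟩ := hu j t'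
  have h1 := tendsto_integral_mul (fun n => hXm i _ (hΦ n)) (fun n => hXm j _ (hΨ n)) hm hm' hΦX hΨX
  refine tendsto_nhds_unique h1 ?_
  simp_rw [fun n => hX.covariance i j _ (hΦ n) _ (hΨ n)]
  split_ifs
  · exact tendsto_noiseCov hk hβ (fun n => hD _ (hΦ n)) (fun n => hD _ (hΨ n)) (hg t) (hg t')
      (hgN t) (hgN t') hΦg hΨg
  · exact tendsto_const_nhds

end NoiseIntegral

/-! ### The spectral representation of the covariance -/

section Translation

variable {k : ℕ}

theorem measurePreserving_spaceShift (u : EuclideanSpace ℝ (Fin k)) :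
    MeasurePreserving (fun q : SpaceTime k => q - (0, u)) volume volume :=
  measurePreserving_sub_right volume ((0, u) : SpaceTime k)

theorem fourierL1_comp_sub (φ : SpaceTime k → ℂ) (u : EuclideanSpace ℝ (Fin k))
    (p : SpaceTime k) :
    fourierL1 (fun q => φ (q - (0, u))) p =
      Complex.exp (-Complex.I * ((inner ℝ p.2 u : ℝ) : ℂ)) * fourierL1 φ p := by
  rw [fourierL1, fourierL1, ← integral_const_mul]
  refine Eq.trans ?_ (integral_sub_right_eq_self (μ := (volume : Measure (SpaceTime k)))
    (fun q => Complex.exp (-Complex.I * ((inner ℝ p.2 u : ℝ) : ℂ)) *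
      (Complex.exp (-Complex.I * ((p.1 * q.1 + inner ℝ p.2 q.2 : ℝ) : ℂ)) * φ q))
    ((0, u) : SpaceTime k))
  congr 1; ext q
  rw [← mul_assoc, ← Complex.exp_add]
  congr 2
  simp only [Prod.fst_sub, Prod.snd_sub, sub_zero, inner_sub_right]
  push_cast
  ring

theorem norm_cexp_neg_I_mul (x : ℝ) : ‖Complex.exp (-Complex.I * (x : ℂ))‖ = 1 := by
  rw [show -Complex.I * (x : ℂ) = ((-x : ℝ) : ℂ) * Complex.I by push_cast; ring,
    Complex.norm_exp_ofReal_mul_I]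

/-- A translation in space multiplies the Fourier transform by a character. -/
theorem fourierL2_comp_sub {φ : SpaceTime k → ℂ} (hφ : MemLp φ 2)
    (u : EuclideanSpace ℝ (Fin k)) :
    fourierL2 (fun q => φ (q - (0, u))) =ᵐ[volume]
      fun p => Complex.exp (-Complex.I * ((inner ℝ p.2 u : ℝ) : ℂ)) * fourierL2 φ p := by
  have hT := measurePreserving_spaceShift u
  have hφu : MemLp (fun q => φ (q - (0, u))) 2 := hφ.comp_measurePreserving hT
  obtain ⟨hf, Φ, hΦ, hΦt, hΦf⟩ := isFourierL2_fourierL2 hφ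
  have hmul : ∀ (f : SpaceTime k → ℂ), ∀ᵐ p : SpaceTime k,
      ‖Complex.exp (-Complex.I * ((inner ℝ p.2 u : ℝ) : ℂ)) * f p‖ = ‖f p‖ := fun f =>
    ae_of_all _ fun p => by rw [norm_mul, norm_cexp_neg_I_mul, one_mul]
  refine fourierL2_ae_eq hφu ⟨?_, fun n q => Φ n (q - (0, u)), fun n => ?_, ?_, ?_⟩
  · refine (memLp_congr_norm ?_ hf.1 (hmul _)).2 hf
    exact AEStronglyMeasurable.mul (by fun_prop) hf.1
  · exact ⟨hT.integrable_comp_of_integrable (hΦ n).1, (hΦ n).2.comp_measurePreserving hT⟩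
  · refine hΦt.congr fun n => ?_
    exact (eLpNorm_comp_measurePreserving ((hΦ n).2.sub hφ).1 hT).symm
  · refine hΦf.congr fun n => ?_
    refine eLpNorm_congr_norm_ae ?_
    filter_upwards [hmul (fun p => fourierL1 (Φ n) p - fourierL2 φ p)] with p hp
    rw [← hp, fourierL1_comp_sub, mul_sub]

/-- Plancherel's identity for a function and a translate in space. -/
theorem integral_cexp_mul_fourierL2_mul_conj {φ ψ : SpaceTime k → ℂ} (hφ : MemLp φ 2)
    (hψ : MemLp ψ 2) (u : EuclideanSpace ℝ (Fin k)) :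
    ∫ p : SpaceTime k, Complex.exp (-Complex.I * ((inner ℝ p.2 u : ℝ) : ℂ)) *
        (fourierL2 φ p * conj (fourierL2 ψ p)) =
      ((2 * Real.pi) ^ (k + 1) : ℝ) * ∫ q, φ (q - (0, u)) * conj (ψ q) := by
  have hφu : MemLp (fun q : SpaceTime k => φ (q - (0, u))) 2 :=
    hφ.comp_measurePreserving (measurePreserving_spaceShift u)
  rw [← integral_fourierL2_mul_conj hφu hψ]
  refine integral_congr_ae ?_
  filter_upwards [fourierL2_comp_sub hφ u] with p hp
  rw [hp, mul_assoc]

end Translation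

section HeatForm

variable {k : ℕ}

/-- The change of variables `u = y - z`. -/
theorem measurePreserving_spaceDiff :
    MeasurePreserving (fun t : ℝ × EuclideanSpace ℝ (Fin k) × EuclideanSpace ℝ (Fin k) =>
      (t.2.1 - t.2.2, ((t.1, t.2.1) : SpaceTime k))) volume volume := by
  have hm : Measurable (fun t : ℝ × EuclideanSpace ℝ (Fin k) × EuclideanSpace ℝ (Fin k) =>
      (t.2.1 - t.2.2, ((t.1, t.2.1) : SpaceTime k))) := by fun_prop
  refine ⟨hm, Measure.ext_of_lintegral _ fun F hF => ?_⟩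
  rw [lintegral_map hF hm, Measure.volume_eq_prod, Measure.volume_eq_prod,
    Measure.volume_eq_prod, Measure.volume_eq_prod,
    lintegral_prod _ (by fun_prop), lintegral_prod_symm _ (by fun_prop),
    lintegral_prod _ (by fun_prop)]
  refine lintegral_congr fun r => ?_
  rw [lintegral_prod _ (by fun_prop)]
  refine lintegral_congr fun y => ?_
  exact lintegral_sub_left_eq_self (fun u => F (u, (r, y))) y

/-- The integrand of the heat form, as a function of `u = y - z` and `(r, y)`, is integrable, by the
Cauchy–Schwarz inequality for a fixed `u`. -/
theorem integrable_heatKernel_mul_shift {s : ℝ} (hs : 0 < s) {φ ψ : SpaceTime k → ℂ}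
    (hφm : Measurable φ) (hψm : Measurable ψ) (hφ : MemLp φ 2) (hψ : MemLp ψ 2) :
    Integrable (fun w : EuclideanSpace ℝ (Fin k) × SpaceTime k =>
      (heatKernel s w.1 : ℂ) * (φ (w.2 - (0, w.1)) * conj (ψ w.2))) volume := by
  have hsub : Measurable (fun w : EuclideanSpace ℝ (Fin k) × SpaceTime k =>
      w.2 - ((0 : ℝ), w.1)) := by fun_prop
  have hm : Measurable (fun w : EuclideanSpace ℝ (Fin k) × SpaceTime k =>
      (heatKernel s w.1 : ℂ) * (φ (w.2 - (0, w.1)) * conj (ψ w.2))) := by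
    have h1 := hφm.comp hsub
    have h2 : Measurable (fun w : EuclideanSpace ℝ (Fin k) × SpaceTime k => heatKernel s w.1) := by
      fun_prop
    have h3 : Measurable (fun w : EuclideanSpace ℝ (Fin k) × SpaceTime k => conj (ψ w.2)) :=
      (continuous_star.measurable).comp (hψm.comp measurable_snd)
    exact (Complex.measurable_ofReal.comp h2).mul (h1.mul h3)
  refine ⟨hm.aestronglyMeasurable, ?_⟩
  rw [hasFiniteIntegral_iff_enorm, Measure.volume_eq_prod,
    lintegral_prod _ hm.enorm.aemeasurable]
  have hbound : ∀ u : EuclideanSpace ℝ (Fin k),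
      ∫⁻ q : SpaceTime k, ‖(heatKernel s u : ℂ) * (φ (q - (0, u)) * conj (ψ q))‖ₑ ≤
      ENNReal.ofReal (heatKernel s u) * ((∫⁻ q : SpaceTime k, ‖φ q‖ₑ * ‖φ q‖ₑ) ^ (2⁻¹ : ℝ) *
        (∫⁻ q : SpaceTime k, ‖ψ q‖ₑ * ‖ψ q‖ₑ) ^ (2⁻¹ : ℝ)) := by
    intro u
    have hT := measurePreserving_spaceShift u
    have h1 : ∀ q : SpaceTime k, ‖(heatKernel s u : ℂ) * (φ (q - (0, u)) * conj (ψ q))‖ₑ =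
        ENNReal.ofReal (heatKernel s u) * (‖φ (q - (0, u))‖ₑ * ‖ψ q‖ₑ) := by
      intro q
      rw [enorm_mul, enorm_mul, RCLike.enorm_conj]
      congr 1
      rw [← ofReal_norm, Complex.norm_real, Real.norm_of_nonneg (heatKernel_nonneg _ _)]
    simp_rw [h1]
    have hmφ : Measurable fun q : SpaceTime k => ‖φ (q - (0, u))‖ₑ :=
      (hφm.comp hT.measurable).enorm
    rw [lintegral_const_mul _ (by fun_prop)]
    gcongr
    refine (lintegral_mul_le_sqrt_mul_sqrt volume hmφ hψm.enorm).trans ?_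
    have h2 := hT.lintegral_comp (f := fun q => ‖φ q‖ₑ * ‖φ q‖ₑ) (by fun_prop)
    rw [h2]
  refine (lintegral_mono hbound).trans_lt ?_
  rw [lintegral_mul_const _ (by fun_prop), lintegral_heatKernel hs, one_mul]
  have hfin : ∀ {χ : SpaceTime k → ℂ}, MemLp χ 2 →
      (∫⁻ q : SpaceTime k, ‖χ q‖ₑ * ‖χ q‖ₑ) ^ (2⁻¹ : ℝ) < ∞ := by
    intro χ hχ
    refine ENNReal.rpow_lt_top_of_nonneg (by norm_num) ?_
    have := eLpNorm_nnreal_pow_eq_lintegral (μ := volume) (f := χ) (p := 2) (by norm_num)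
    norm_num [sq] at this
    rw [← this]
    exact (ENNReal.mul_lt_top hχ.2 hχ.2).ne
  exact ENNReal.mul_lt_top (hfin hφ) (hfin hψ)

theorem timePairVolume_eq_restrict :
    timePairVolume k = volume.restrict (Set.Ici (0 : ℝ) ×ˢ Set.univ) := by
  rw [timePairVolume, Measure.volume_eq_prod, Measure.volume_eq_prod, ← Measure.prod_restrict,
    Measure.restrict_univ]

/-- The heat multiplier `e^{-s|ξ|²}` on the Fourier side corresponds to the form with the spatial
kernel `G(s, y - z)`: average Plancherel's identity for translated functions over the translations,
with weights given by the heat kernel. -/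
theorem integral_exp_mul_fourierL2_mul_conj {s : ℝ} (hs : 0 < s) {φ ψ : SpaceTime k → ℂ}
    (hφm : Measurable φ) (hψm : Measurable ψ) (hφ : MemLp φ 2) (hψ : MemLp ψ 2)
    (hψ0 : ∀ p : SpaceTime k, p.1 < 0 → ψ p = 0) :
    ∫ p : SpaceTime k, ((Real.exp (-(s * ‖p.2‖ ^ 2)) : ℝ) : ℂ) *
        (fourierL2 φ p * conj (fourierL2 ψ p)) =
      ((2 * Real.pi) ^ (k + 1) : ℝ) * ∫ t, (heatKernel s (t.2.1 - t.2.2) : ℂ) *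
        (conj (ψ (t.1, t.2.1)) * φ (t.1, t.2.2)) ∂(timePairVolume k) := by
  have hA : Integrable (fun p => fourierL2 φ p * conj (fourierL2 ψ p)) volume :=
    MemLp.integrable_mul (memLp_fourierL2 hφ) (memLp_conj (memLp_fourierL2 hψ))
  have hI := integrable_heatKernel_mul_shift hs hφm hψm hφ hψ
  have e1 : ∫ t, (heatKernel s (t.2.1 - t.2.2) : ℂ) *
        (conj (ψ (t.1, t.2.1)) * φ (t.1, t.2.2)) ∂(timePairVolume k) =
      ∫ u, (heatKernel s u : ℂ) * ∫ q, φ (q - (0, u)) * conj (ψ q) := by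
    rw [timePairVolume_eq_restrict, setIntegral_eq_integral_of_forall_compl_eq_zero]
    · have h1 := integral_map (μ := volume) (f := fun w : EuclideanSpace ℝ (Fin k) × SpaceTime k =>
        (heatKernel s w.1 : ℂ) * (φ (w.2 - (0, w.1)) * conj (ψ w.2)))
        (measurePreserving_spaceDiff (k := k)).measurable.aemeasurable
        (by rw [measurePreserving_spaceDiff.map_eq]; exact hI.1)
      rw [measurePreserving_spaceDiff.map_eq] at h1
      have h2 := integral_prod _ hI
      simp_rw [← integral_const_mul]
      refine Eq.trans ?_ (h1.symm.trans h2)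
      congr 1; ext t
      simp [mul_comm]
    · rintro ⟨r, y, z⟩ ht
      have hr : r < 0 := by simpa using ht
      simp [hψ0 (r, y) hr]
  rw [e1, ← integral_const_mul]
  have e2 : ∀ u, (((2 * Real.pi) ^ (k + 1) : ℝ) : ℂ) * ((heatKernel s u : ℂ) *
      ∫ q, φ (q - (0, u)) * conj (ψ q)) =
      ∫ p : SpaceTime k, (heatKernel s u : ℂ) *
        (Complex.exp (-Complex.I * ((inner ℝ p.2 u : ℝ) : ℂ)) *
        (fourierL2 φ p * conj (fourierL2 ψ p))) := by
    intro u
    rw [integral_const_mul, integral_cexp_mul_fourierL2_mul_conj hφ hψ]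
    ring
  simp_rw [e2]
  have hJ : Integrable (Function.uncurry fun (u : EuclideanSpace ℝ (Fin k)) (p : SpaceTime k) =>
      (heatKernel s u : ℂ) * (Complex.exp (-Complex.I * ((inner ℝ p.2 u : ℝ) : ℂ)) *
        (fourierL2 φ p * conj (fourierL2 ψ p)))) (volume.prod volume) := by
    have h1 := (integrable_heatKernel (k := k) hs).ofReal (𝕜 := ℂ)
    have h2 := h1.mul_prod hA
    refine (h2.bdd_mul (c := 1) (f := fun w : EuclideanSpace ℝ (Fin k) × SpaceTime k =>
      Complex.exp (-Complex.I * ((inner ℝ w.2.2 w.1 : ℝ) : ℂ))) (by fun_prop)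
      (ae_of_all _ fun w => (norm_cexp_neg_I_mul _).le)).congr (ae_of_all _ fun w => ?_)
    simp only [Function.uncurry]
    exact mul_left_comm _ _ _
  rw [integral_integral_swap hJ]
  refine integral_congr_ae (ae_of_all _ fun p => ?_)
  have e3 : ∀ u, (heatKernel s u : ℂ) * (Complex.exp (-Complex.I * ((inner ℝ p.2 u : ℝ) : ℂ)) *
        (fourierL2 φ p * conj (fourierL2 ψ p))) =
      Complex.exp (-Complex.I * ((inner ℝ p.2 u : ℝ) : ℂ)) * (heatKernel s u : ℂ) *
        (fourierL2 φ p * conj (fourierL2 ψ p)) := fun u => by ring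
  simp only [e3]
  rw [integral_mul_const, integral_cexp_mul_heatKernel hs]

end HeatForm

/-! ### The weighted Fourier transform as an isometry -/

section Spectral

variable {k : ℕ} {β : ℝ}

theorem enorm_ofReal_complex {x : ℝ} (hx : 0 ≤ x) : ‖(x : ℂ)‖ₑ = ENNReal.ofReal x := by
  rw [← ofReal_norm, Complex.norm_real, Real.norm_of_nonneg hx]

theorem ae_snd_ne_zero (hk : 1 ≤ k) : ∀ᵐ p : SpaceTime k, p.2 ≠ 0 := by
  have : Nonempty (Fin k) := ⟨⟨0, hk⟩⟩
  have h : ∀ᵐ z : EuclideanSpace ℝ (Fin k), z ≠ 0 := by rw [ae_iff]; simp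
  exact Measure.quasiMeasurePreserving_snd.ae h

theorem sq_rpow_eq_mul_self {x : ℝ} (hx : 0 < x) (a : ℝ) :
    (x ^ 2) ^ (-((k : ℝ) - a) / 2) = x ^ ((a - k) / 2) * x ^ ((a - k) / 2) := by
  rw [← Real.rpow_add hx, ← Real.rpow_natCast, ← Real.rpow_mul hx.le]
  congr 1; push_cast; ring

/-- The same mixture that yields the Riesz kernel from the heat kernels yields the power
`‖ξ‖ ^ (β - k)` from the heat multipliers. -/
theorem lintegral_rieszWeight_exp (hβ : β < k) {ξ : EuclideanSpace ℝ (Fin k)} (hξ : ξ ≠ 0) :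
    ∫⁻ s, ENNReal.ofReal (Real.exp (-(s * ‖ξ‖ ^ 2))) ∂(rieszWeight k β) =
      ENNReal.ofReal (Real.Gamma (((k : ℝ) - β) / 2)) *
        (ENNReal.ofReal (‖ξ‖ ^ ((β - k) / 2)) * ENNReal.ofReal (‖ξ‖ ^ ((β - k) / 2))) := by
  have hx : 0 < ‖ξ‖ := norm_pos_iff.2 hξ
  have ha : 0 < ((k : ℝ) - β) / 2 := by linarith
  rw [lintegral_rieszWeight _ (by fun_prop), ← ENNReal.ofReal_mul (by positivity),
    ← sq_rpow_eq_mul_self hx, ← ENNReal.ofReal_mul (Real.Gamma_pos_of_pos ha).le, neg_div,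
    ← lintegral_rpow_mul_exp_neg ha (by positivity)]
  refine setLIntegral_congr_fun measurableSet_Ioi fun s hs => ?_
  have hs : 0 < s := hs
  rw [ENNReal.ofReal_mul (by positivity)]

theorem integral_rieszWeight_exp (hβ : β < k) {ξ : EuclideanSpace ℝ (Fin k)} (hξ : ξ ≠ 0) :
    ∫ s, Real.exp (-(s * ‖ξ‖ ^ 2)) ∂(rieszWeight k β) =
      Real.Gamma (((k : ℝ) - β) / 2) * (‖ξ‖ ^ ((β - k) / 2) * ‖ξ‖ ^ ((β - k) / 2)) := by
  have ha : 0 < ((k : ℝ) - β) / 2 := by linarith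
  rw [integral_eq_lintegral_of_nonneg_ae (ae_of_all _ fun s => by positivity) (by fun_prop),
    lintegral_rieszWeight_exp hβ hξ, ← ENNReal.ofReal_mul (by positivity),
    ← ENNReal.ofReal_mul (Real.Gamma_pos_of_pos ha).le, ENNReal.toReal_ofReal]
  have := Real.Gamma_pos_of_pos ha
  positivity

theorem integral_rieszWeight_heatKernel (hβ : 0 < β) {x : EuclideanSpace ℝ (Fin k)}
    (hx : x ≠ 0) :
    ∫ s, heatKernel s x ∂(rieszWeight k β) = rieszHeatConst k β * ‖x‖ ^ (-β) := by
  have hC := rieszHeatConst_pos (k := k) hβ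
  rw [integral_eq_lintegral_of_nonneg_ae (ae_of_all _ fun s => heatKernel_nonneg _ _)
      (Measurable.aestronglyMeasurable (by fun_prop)),
    lintegral_rieszWeight_heatKernel hβ hx, ← ENNReal.ofReal_mul hC.le, ENNReal.toReal_ofReal]
  positivity

/-- The absolutely convergent version of `integral_exp_mul_fourierL2_mul_conj`, for `φ = ψ`. -/
theorem lintegral_exp_mul_fourierL2_le {s : ℝ} (hs : 0 < s) {φ : SpaceTime k → ℂ}
    (hφm : Measurable φ) (hφ : MemLp φ 2) (hφ0 : ∀ p : SpaceTime k, p.1 < 0 → φ p = 0) :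
    ∫⁻ p : SpaceTime k, ENNReal.ofReal (Real.exp (-(s * ‖p.2‖ ^ 2))) *
        (‖fourierL2 φ p‖ₑ * ‖fourierL2 φ p‖ₑ) ≤
      ENNReal.ofReal ((2 * Real.pi) ^ (k + 1)) *
        pairForm (kernelPair fun x => ENNReal.ofReal (heatKernel s x))
          (fun p => ‖φ p‖ₑ) (fun p => ‖φ p‖ₑ) := by
  have hA : Integrable (fun p => fourierL2 φ p * conj (fourierL2 φ p)) volume :=
    MemLp.integrable_mul (memLp_fourierL2 hφ) (memLp_conj (memLp_fourierL2 hφ))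
  have hF : Measurable fun x : SpaceTime k × SpaceTime k => ‖φ x.1‖ₑ * ‖φ x.2‖ₑ :=
    (hφm.enorm.comp measurable_fst).mul (hφm.enorm.comp measurable_snd)
  have hB : Integrable (fun p : SpaceTime k => Real.exp (-(s * ‖p.2‖ ^ 2)) *
      ‖fourierL2 φ p * conj (fourierL2 φ p)‖) volume := by
    refine hA.norm.bdd_mul (c := 1) (by fun_prop) (ae_of_all _ fun p => ?_)
    rw [Real.norm_of_nonneg (by positivity)]
    exact Real.exp_le_one_iff.2 (by have : 0 ≤ s * ‖p.2‖ ^ 2 := by positivity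
                                    linarith)
  have h1 : ∫⁻ p : SpaceTime k, ENNReal.ofReal (Real.exp (-(s * ‖p.2‖ ^ 2))) *
        (‖fourierL2 φ p‖ₑ * ‖fourierL2 φ p‖ₑ) = ‖∫ p : SpaceTime k,
          ((Real.exp (-(s * ‖p.2‖ ^ 2)) : ℝ) : ℂ) *
          (fourierL2 φ p * conj (fourierL2 φ p))‖ₑ := by
    have e : ∀ p : SpaceTime k, ((Real.exp (-(s * ‖p.2‖ ^ 2)) : ℝ) : ℂ) *
          (fourierL2 φ p * conj (fourierL2 φ p)) = ((Real.exp (-(s * ‖p.2‖ ^ 2)) *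
            ‖fourierL2 φ p * conj (fourierL2 φ p)‖ : ℝ) : ℂ) := by
      intro p
      rw [Complex.ofReal_mul, norm_mul, RCLike.norm_conj, Complex.mul_conj,
        Complex.normSq_eq_norm_sq]
      push_cast; ring
    simp_rw [e]
    rw [integral_complex_ofReal, enorm_ofReal_complex (integral_nonneg fun p => by positivity),
      ofReal_integral_eq_lintegral_ofReal hB (ae_of_all _ fun p => by positivity)]
    refine lintegral_congr fun p => ?_
    rw [ENNReal.ofReal_mul (by positivity), ofReal_norm, enorm_mul, RCLike.enorm_conj]
  rw [h1, integral_exp_mul_fourierL2_mul_conj hs hφm hφm hφ hφ hφ0, enorm_mul,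
    enorm_ofReal_complex (by positivity), pairForm, lintegral_kernelPair (by fun_prop) hF]
  gcongr
  refine (enorm_integral_le_lintegral_enorm _).trans (lintegral_mono fun t => ?_)
  rw [enorm_mul, enorm_mul, RCLike.enorm_conj, enorm_ofReal_complex (heatKernel_nonneg _ _)]
  rfl

theorem noisePair_of_not (h : ¬ (k = 1 ∧ β = 1)) :
    noisePair k β = kernelPair (fun x => ENNReal.ofReal (‖x‖ ^ (-β))) := if_neg h

theorem enorm_tildeIntegrand (φ : SpaceTime k → ℂ) (p : SpaceTime k) :
    ‖tildeIntegrand β φ p‖ₑ = ENNReal.ofReal (‖p.2‖ ^ ((β - k) / 2)) * ‖fourierL2 φ p‖ₑ := by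
  rw [tildeIntegrand, enorm_mul, enorm_ofReal_complex (by positivity)]

theorem aestronglyMeasurable_tildeIntegrand {φ : SpaceTime k → ℂ} (hφ : MemLp φ 2) :
    AEStronglyMeasurable (tildeIntegrand β φ) volume := by
  unfold tildeIntegrand
  refine AEStronglyMeasurable.mul ?_ (memLp_fourierL2 hφ).1
  exact (Complex.measurable_ofReal.comp (by fun_prop)).aestronglyMeasurable

theorem lintegral_tildeIntegrand (hk : 1 ≤ k) (hβ : β < k) {φ ψ : SpaceTime k → ℂ}
    (hφ : MemLp φ 2) (hψ : MemLp ψ 2) :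
    ENNReal.ofReal (Real.Gamma (((k : ℝ) - β) / 2)) *
      ∫⁻ p, ‖tildeIntegrand β φ p‖ₑ * ‖tildeIntegrand β ψ p‖ₑ =
    ∫⁻ s, (∫⁻ p : SpaceTime k, ENNReal.ofReal (Real.exp (-(s * ‖p.2‖ ^ 2))) *
        (‖fourierL2 φ p‖ₑ * ‖fourierL2 ψ p‖ₑ)) ∂(rieszWeight k β) := by
  have hm : AEMeasurable (fun p => ‖fourierL2 φ p‖ₑ * ‖fourierL2 ψ p‖ₑ) volume :=
    (memLp_fourierL2 hφ).1.enorm.mul (memLp_fourierL2 hψ).1.enorm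
  have hm' : AEMeasurable (fun p => ‖tildeIntegrand β φ p‖ₑ * ‖tildeIntegrand β ψ p‖ₑ) volume :=
    (aestronglyMeasurable_tildeIntegrand hφ).enorm.mul
      (aestronglyMeasurable_tildeIntegrand hψ).enorm
  rw [lintegral_lintegral_swap, ← lintegral_const_mul'' _ hm']
  · refine lintegral_congr_ae ?_
    filter_upwards [ae_snd_ne_zero hk] with p hp
    rw [lintegral_mul_const _ (by fun_prop), lintegral_rieszWeight_exp hβ hp,
      enorm_tildeIntegrand, enorm_tildeIntegrand]
    ring
  · have h1 : Measurable fun w : ℝ × SpaceTime k =>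
        ENNReal.ofReal (Real.exp (-(w.1 * ‖w.2.2‖ ^ 2))) := by fun_prop
    refine h1.aemeasurable.mul ?_
    exact hm.comp_quasiMeasurePreserving Measure.quasiMeasurePreserving_snd

theorem memLp_two_of_lintegral {α E : Type*} [MeasurableSpace α] [NormedAddCommGroup E]
    {μ : Measure α} {f : α → E} (hf : AEStronglyMeasurable f μ)
    (h : ∫⁻ a, ‖f a‖ₑ * ‖f a‖ₑ ∂μ < ∞) : MemLp f 2 μ := by
  refine ⟨hf, ?_⟩
  have := eLpNorm_nnreal_pow_eq_lintegral (μ := μ) (f := f) (p := 2) (by norm_num)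
  norm_num [sq] at this
  rw [← this] at h
  by_contra h'
  simp only [not_lt, top_le_iff] at h'
  simp [h'] at h

/-- Integrate the bounds for the heat multipliers over their weight. -/
theorem memLp_tildeIntegrand_of_measurable (hk : 1 ≤ k) (hβ0 : 0 < β) (hβ : β < k)
    (hc : ¬ (k = 1 ∧ β = 1)) {φ : SpaceTime k → ℂ} (hφm : Measurable φ) (hφ : MemLp φ 2)
    (hφ0 : ∀ p : SpaceTime k, p.1 < 0 → φ p = 0) (hφN : noiseNormSq β φ < ∞) :
    MemLp (tildeIntegrand β φ) 2 := by
  have hΓ : 0 < Real.Gamma (((k : ℝ) - β) / 2) := Real.Gamma_pos_of_pos (by linarith)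
  refine memLp_two_of_lintegral (aestronglyMeasurable_tildeIntegrand hφ) ?_
  have h := lintegral_tildeIntegrand hk hβ hφ hφ
  have hF : Measurable fun x : SpaceTime k × SpaceTime k => ‖φ x.1‖ₑ * ‖φ x.2‖ₑ :=
    (hφm.enorm.comp measurable_fst).mul (hφm.enorm.comp measurable_snd)
  have h2 : ∫⁻ s, (∫⁻ p : SpaceTime k, ENNReal.ofReal (Real.exp (-(s * ‖p.2‖ ^ 2))) *
        (‖fourierL2 φ p‖ₑ * ‖fourierL2 φ p‖ₑ)) ∂(rieszWeight k β) < ∞ := by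
    refine (lintegral_mono_ae ((ae_rieszWeight_pos β).mono fun s hs =>
      lintegral_exp_mul_fourierL2_le hs hφm hφ hφ0)).trans_lt ?_
    simp only [pairForm]
    rw [lintegral_const_mul _ (measurable_lintegral_heatPair hF),
      ← lintegral_rieszPair_eq hk hβ0 hF,
      ← noisePair_of_not hc]
    rw [noiseNormSq_eq_pairForm β hφ.1, pairForm] at hφN
    exact ENNReal.mul_lt_top ENNReal.ofReal_lt_top (ENNReal.mul_lt_top ENNReal.ofReal_lt_top hφN)
  rw [← h] at h2
  by_contra h'
  simp only [not_lt, top_le_iff] at h'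
  rw [h', ENNReal.mul_top (ENNReal.ofReal_pos.2 hΓ).ne'] at h2
  exact lt_irrefl _ h2

/-- Integrate the identity for the heat multipliers over their weight, on both sides by Fubini's
theorem. -/
theorem integral_tildeIntegrand_of_measurable (hk : 1 ≤ k) (hβ0 : 0 < β) (hβ : β < k)
    (hc : ¬ (k = 1 ∧ β = 1)) {φ ψ : SpaceTime k → ℂ} (hφm : Measurable φ) (hψm : Measurable ψ)
    (hφ : MemLp φ 2) (hψ : MemLp ψ 2) (hφ0 : ∀ p : SpaceTime k, p.1 < 0 → φ p = 0)
    (hψ0 : ∀ p : SpaceTime k, p.1 < 0 → ψ p = 0) (hφN : noiseNormSq β φ < ∞)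
    (hψN : noiseNormSq β ψ < ∞) :
    (Real.Gamma (((k : ℝ) - β) / 2) : ℂ) *
      ∫ p, tildeIntegrand β φ p * conj (tildeIntegrand β ψ p) =
    ((2 * Real.pi) ^ (k + 1) : ℝ) * ((rieszHeatConst k β : ℝ) *
      ∫ x, conj (ψ x.1) * φ x.2 ∂(noisePair k β)) := by
  have hΓ : 0 < Real.Gamma (((k : ℝ) - β) / 2) := Real.Gamma_pos_of_pos (by linarith)
  have hC := rieszHeatConst_pos (k := k) hβ0
  have htφ := memLp_tildeIntegrand_of_measurable hk hβ0 hβ hc hφm hφ hφ0 hφN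
  have htψ := memLp_tildeIntegrand_of_measurable hk hβ0 hβ hc hψm hψ hψ0 hψN
  have hψc : Measurable fun p => conj (ψ p) := continuous_star.measurable.comp hψm
  have hFm : Measurable fun x : SpaceTime k × SpaceTime k => conj (ψ x.1) * φ x.2 :=
    (hψc.comp measurable_fst).mul (hφm.comp measurable_snd)
  have hFi : Integrable (fun x : SpaceTime k × SpaceTime k => conj (ψ x.1) * φ x.2)
      (noisePair k β) := by
    refine integrable_fst_mul_snd hk hβ0 hψc.aestronglyMeasurable hφm.aestronglyMeasurable ?_ hφN
    simpa only [noiseNormSq, RCLike.enorm_conj] using hψN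
  -- both double integrals converge absolutely: the first one as the transforms are in `L²`, the
  -- second one by the Cauchy–Schwarz inequality for the covariance form
  have hI1 : Integrable (Function.uncurry fun (s : ℝ) (p : SpaceTime k) =>
      ((Real.exp (-(s * ‖p.2‖ ^ 2)) : ℝ) : ℂ) * (fourierL2 φ p * conj (fourierL2 ψ p)))
      ((rieszWeight k β).prod volume) := by
    have hm : AEStronglyMeasurable (Function.uncurry fun (s : ℝ) (p : SpaceTime k) =>
      ((Real.exp (-(s * ‖p.2‖ ^ 2)) : ℝ) : ℂ) * (fourierL2 φ p * conj (fourierL2 ψ p)))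
      ((rieszWeight k β).prod volume) := by
      refine AEStronglyMeasurable.mul
        (Complex.measurable_ofReal.comp (by fun_prop)).aestronglyMeasurable ?_
      exact (((memLp_fourierL2 hφ).1.mul (memLp_conj (memLp_fourierL2 hψ)).1)
        ).comp_quasiMeasurePreserving Measure.quasiMeasurePreserving_snd
    refine ⟨hm, ?_⟩
    rw [hasFiniteIntegral_iff_enorm, lintegral_prod _ hm.enorm]
    simp only [Function.uncurry, enorm_mul, RCLike.enorm_conj]
    simp_rw [enorm_ofReal_complex (Real.exp_pos _).le]
    rw [← lintegral_tildeIntegrand hk hβ hφ hψ]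
    refine ENNReal.mul_lt_top ENNReal.ofReal_lt_top ?_
    have := (MemLp.integrable_mul htφ htψ).2
    simpa only [hasFiniteIntegral_iff_enorm, Pi.mul_apply, enorm_mul] using this
  have hI2 : Integrable (Function.uncurry fun (s : ℝ)
      (t : ℝ × EuclideanSpace ℝ (Fin k) × EuclideanSpace ℝ (Fin k)) =>
      (heatKernel s (t.2.1 - t.2.2) : ℂ) * (conj (ψ (t.1, t.2.1)) * φ (t.1, t.2.2)))
      ((rieszWeight k β).prod (timePairVolume k)) := by
    have hm : Measurable (Function.uncurry fun (s : ℝ)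
      (t : ℝ × EuclideanSpace ℝ (Fin k) × EuclideanSpace ℝ (Fin k)) =>
      (heatKernel s (t.2.1 - t.2.2) : ℂ) * (conj (ψ (t.1, t.2.1)) * φ (t.1, t.2.2))) := by
      refine (Complex.measurable_ofReal.comp (by fun_prop)).mul ?_
      exact (hFm.comp measurable_simultaneous).comp measurable_snd
    refine ⟨hm.aestronglyMeasurable, ?_⟩
    rw [hasFiniteIntegral_iff_enorm, lintegral_prod _ hm.enorm.aemeasurable]
    have e : ∀ s, ∫⁻ t, ‖(Function.uncurry fun (s : ℝ)
        (t : ℝ × EuclideanSpace ℝ (Fin k) × EuclideanSpace ℝ (Fin k)) =>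
        (heatKernel s (t.2.1 - t.2.2) : ℂ) * (conj (ψ (t.1, t.2.1)) * φ (t.1, t.2.2))) (s, t)‖ₑ
          ∂(timePairVolume k) =
        ∫⁻ x, ‖conj (ψ x.1) * φ x.2‖ₑ ∂(kernelPair fun x => ENNReal.ofReal (heatKernel s x)) := by
      intro s
      rw [lintegral_kernelPair (by fun_prop) hFm.enorm]
      refine lintegral_congr fun t => ?_
      simp only [Function.uncurry]
      rw [enorm_mul, enorm_ofReal_complex (heatKernel_nonneg _ _)]
      rfl
    simp_rw [e]
    rw [← lintegral_rieszPair_eq hk hβ0 hFm.enorm, ← noisePair_of_not hc]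
    exact ENNReal.mul_lt_top ENNReal.ofReal_lt_top hFi.2
  have hL : (Real.Gamma (((k : ℝ) - β) / 2) : ℂ) *
      ∫ p, tildeIntegrand β φ p * conj (tildeIntegrand β ψ p) =
      ∫ s, (∫ p : SpaceTime k, ((Real.exp (-(s * ‖p.2‖ ^ 2)) : ℝ) : ℂ) *
        (fourierL2 φ p * conj (fourierL2 ψ p))) ∂(rieszWeight k β) := by
    rw [integral_integral_swap hI1, ← integral_const_mul]
    refine integral_congr_ae ?_
    filter_upwards [ae_snd_ne_zero hk] with p hp
    rw [integral_mul_const, integral_complex_ofReal, integral_rieszWeight_exp hβ hp]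
    simp only [tildeIntegrand, map_mul, Complex.conj_ofReal]
    push_cast
    ring
  have hR : (rieszHeatConst k β : ℂ) * ∫ x, conj (ψ x.1) * φ x.2 ∂(noisePair k β) =
      ∫ s, ∫ t, (heatKernel s (t.2.1 - t.2.2) : ℂ) * (conj (ψ (t.1, t.2.1)) * φ (t.1, t.2.2))
        ∂(timePairVolume k) ∂(rieszWeight k β) := by
    have hκ : Measurable fun t : ℝ × EuclideanSpace ℝ (Fin k) × EuclideanSpace ℝ (Fin k) =>
        ENNReal.ofReal (‖t.2.1 - t.2.2‖ ^ (-β)) := by fun_prop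
    rw [integral_integral_swap hI2, noisePair_of_not hc, kernelPair,
      integral_map (by fun_prop) hFm.aestronglyMeasurable,
      integral_withDensity_eq_integral_toReal_smul hκ (by simp), ← integral_const_mul]
    refine integral_congr_ae ?_
    filter_upwards [ae_timePairVolume_ne hk] with t ht
    have h0 : 0 ≤ ‖t.2.1 - t.2.2‖ ^ (-β) := by positivity
    rw [integral_mul_const, integral_complex_ofReal, integral_rieszWeight_heatKernel hβ0 ht,
      ENNReal.toReal_ofReal h0, Complex.real_smul]
    simp only [simultaneous]
    push_cast
    ring
  rw [hL, hR, ← integral_const_mul]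
  refine integral_congr_ae ?_
  filter_upwards [ae_rieszWeight_pos β] with s hs
  exact integral_exp_mul_fourierL2_mul_conj hs hφm hψm hφ hψ hψ0

/-- The constant `c` is made up of the constants of Plancherel's theorem and of the two mixtures. -/
theorem noiseConst_mul_Gamma (hβ0 : 0 < β) (hβ : β < k) (hc : ¬ (k = 1 ∧ β = 1)) :
    noiseConst k β * Real.Gamma (((k : ℝ) - β) / 2) =
      (2 * Real.pi) ^ (k + 1) * rieszHeatConst k β := by
  have hΓ : 0 < Real.Gamma (((k : ℝ) - β) / 2) := Real.Gamma_pos_of_pos (by linarith)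
  have hΓ' : 0 < Real.Gamma (β / 2) := Real.Gamma_pos_of_pos (half_pos hβ0)
  have h4 : (4 * Real.pi) ^ (-(k : ℝ) / 2) = (2 ^ (k : ℝ))⁻¹ * (Real.pi ^ ((k : ℝ) / 2))⁻¹ := by
    rw [show (4 * Real.pi : ℝ) = 2 ^ (2 : ℝ) * Real.pi by norm_num,
      Real.mul_rpow (by positivity) (by positivity), ← Real.rpow_mul (by norm_num),
      ← Real.rpow_neg (by norm_num), ← Real.rpow_neg (by positivity)]
    congr 2 <;> ring
  rw [noiseConst, if_neg hc, rieszHeatConst, h4, Real.rpow_sub (by norm_num)]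
  have h2 : (0 : ℝ) < 2 ^ (k : ℝ) := by positivity
  have h2' : (0 : ℝ) < 2 ^ β := by positivity
  have h3 : (0 : ℝ) < Real.pi ^ ((k : ℝ) / 2) := by positivity
  field_simp

/-- The dichotomy between space-time white noise and the noise with the Riesz kernel. -/
theorem eq_one_or_lt (hβ : (0 < β ∧ β < min (k : ℝ) 2) ∨ (k = 1 ∧ β = 1)) :
    0 < β ∧ β < 2 ∧ ((k = 1 ∧ β = 1) ∨ (β < k ∧ ¬ (k = 1 ∧ β = 1))) := by
  rcases hβ with ⟨h0, h1⟩ | ⟨rfl, rfl⟩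
  · have hk := h1.trans_le (min_le_left _ _)
    refine ⟨h0, h1.trans_le (min_le_right _ _), Or.inr ⟨hk, ?_⟩⟩
    rintro ⟨rfl, rfl⟩
    norm_num at hk
  · norm_num

theorem noiseConst_pos (hβ : (0 < β ∧ β < min (k : ℝ) 2) ∨ (k = 1 ∧ β = 1)) :
    0 < noiseConst k β := by
  obtain ⟨h0, -, hc | ⟨hk, hc⟩⟩ := eq_one_or_lt hβ
  · rw [noiseConst, if_pos hc]; positivity
  · have hΓ : 0 < Real.Gamma (((k : ℝ) - β) / 2) := Real.Gamma_pos_of_pos (by linarith)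
    refine pos_of_mul_pos_left ?_ hΓ.le
    rw [noiseConst_mul_Gamma h0 hk hc]
    exact mul_pos (by positivity) (rieszHeatConst_pos h0)

theorem fourierL2_congr {φ ψ : SpaceTime k → ℂ} (hφ : MemLp φ 2) (h : φ =ᵐ[volume] ψ) :
    fourierL2 φ =ᵐ[volume] fourierL2 ψ := by
  have hψ : MemLp ψ 2 := (memLp_congr_ae h).1 hφ
  simpa using fourierL2_add_mul hφ hψ hψ 0 (by simpa using h)

theorem noiseNormSq_congr {F : Type*} [NormedAddCommGroup F] {φ ψ : SpaceTime k → F}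
    (hφ : AEStronglyMeasurable φ volume) (h : φ =ᵐ[volume] ψ) :
    noiseNormSq β φ = noiseNormSq β ψ := by
  rw [noiseNormSq_eq_pairForm β hφ, noiseNormSq_eq_pairForm β (hφ.congr h)]
  have h' : (fun p => ‖φ p‖ₑ) =ᵐ[volume] fun p => ‖ψ p‖ₑ := by
    filter_upwards [h] with p hp
    rw [hp]
  exact pairForm_congr h' h'

/-- Every integrand of the noise has a Borel version that vanishes at negative times. -/
theorem exists_measurable_noiseDomain {φ : SpaceTime k → ℂ} (hφ : φ ∈ noiseDomain k β ℂ) :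
    ∃ φ' ∈ noiseDomain k β ℂ, Measurable φ' ∧ φ =ᵐ[volume] φ' := by
  obtain ⟨h1, h2, h3⟩ := hφ
  have hS : MeasurableSet {p : SpaceTime k | 0 ≤ p.1} :=
    measurableSet_le (by fun_prop) (by fun_prop)
  have hae : φ =ᵐ[volume] {p : SpaceTime k | 0 ≤ p.1}.indicator (h1.1.mk φ) := by
    filter_upwards [h1.1.ae_eq_mk] with p hp
    by_cases h0 : 0 ≤ p.1
    · rw [Set.indicator_of_mem (by exact h0), hp]
    · rw [Set.indicator_of_notMem (by exact h0), h2 p (not_le.1 h0)]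
  refine ⟨_, ⟨(memLp_congr_ae hae).1 h1, fun p hp => ?_, ?_⟩,
    h1.1.stronglyMeasurable_mk.measurable.indicator hS, hae⟩
  · exact Set.indicator_of_notMem (by simpa using hp) _
  · rwa [← noiseNormSq_congr h1.1 hae]

theorem tildeIntegrand_congr {φ ψ : SpaceTime k → ℂ} (hφ : MemLp φ 2) (h : φ =ᵐ[volume] ψ) :
    tildeIntegrand β φ =ᵐ[volume] tildeIntegrand β ψ := by
  filter_upwards [fourierL2_congr hφ h] with p hp
  rw [tildeIntegrand, tildeIntegrand, hp]

theorem tildeIntegrand_of_eq_one (hc : k = 1 ∧ β = 1) (φ : SpaceTime k → ℂ) :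
    tildeIntegrand β φ = fourierL2 φ := by
  ext p
  simp [tildeIntegrand, hc.1, hc.2]

theorem memLp_tildeIntegrand (hk : 1 ≤ k) (hβ : (0 < β ∧ β < min (k : ℝ) 2) ∨ (k = 1 ∧ β = 1))
    {φ : SpaceTime k → ℂ} (hφ : φ ∈ noiseDomain k β ℂ) : MemLp (tildeIntegrand β φ) 2 := by
  obtain ⟨h0, -, hc | ⟨hkβ, hc⟩⟩ := eq_one_or_lt hβ
  · rw [tildeIntegrand_of_eq_one hc]
    exact memLp_fourierL2 hφ.1
  · obtain ⟨φ', hφ', hm, hae⟩ := exists_measurable_noiseDomain hφ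
    exact (memLp_congr_ae (tildeIntegrand_congr hφ.1 hae)).2
      (memLp_tildeIntegrand_of_measurable hk h0 hkβ hc hm hφ'.1 hφ'.2.1 hφ'.2.2)

/-- The spectral representation of the covariance of the noise. -/
theorem integral_tildeIntegrand_mul_conj (hk : 1 ≤ k)
    (hβ : (0 < β ∧ β < min (k : ℝ) 2) ∨ (k = 1 ∧ β = 1))
    {φ ψ : SpaceTime k → ℂ} (hφ : φ ∈ noiseDomain k β ℂ) (hψ : ψ ∈ noiseDomain k β ℂ) :
    ∫ p, tildeIntegrand β φ p * conj (tildeIntegrand β ψ p) =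
      noiseConst k β * ∫ x, conj (ψ x.1) * φ x.2 ∂(noisePair k β) := by
  obtain ⟨φ', hφ', hφm, hφae⟩ := exists_measurable_noiseDomain hφ
  obtain ⟨ψ', hψ', hψm, hψae⟩ := exists_measurable_noiseDomain hψ
  have e1 : ∫ p, tildeIntegrand β φ p * conj (tildeIntegrand β ψ p) =
      ∫ p, tildeIntegrand β φ' p * conj (tildeIntegrand β ψ' p) := by
    refine integral_congr_ae ?_
    filter_upwards [tildeIntegrand_congr hφ.1 hφae, tildeIntegrand_congr hψ.1 hψae] with p h1 h2
    rw [h1, h2]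
  have e2 : ∫ x, conj (ψ x.1) * φ x.2 ∂(noisePair k β) =
      ∫ x, conj (ψ' x.1) * φ' x.2 ∂(noisePair k β) := by
    refine integral_congr_ae ?_
    filter_upwards [ae_fst_noisePair hψae, ae_snd_noisePair hφae] with x h1 h2
    rw [h1, h2]
  rw [e1, e2]
  obtain ⟨h0, -, hc | ⟨hkβ, hc⟩⟩ := eq_one_or_lt hβ
  · have hFm : Measurable fun x : SpaceTime k × SpaceTime k => conj (ψ' x.1) * φ' x.2 :=
      ((continuous_star.measurable.comp hψm).comp measurable_fst).mul (hφm.comp measurable_snd)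
    rw [tildeIntegrand_of_eq_one hc, tildeIntegrand_of_eq_one hc,
      integral_fourierL2_mul_conj hφ'.1 hψ'.1, noiseConst, if_pos hc, noisePair, if_pos hc,
      integral_map (by fun_prop) hFm.aestronglyMeasurable]
    have hk2 : k + 1 = 2 := by rw [hc.1]
    rw [hk2]
    congr 1
    have hr : ((volume.restrict (Set.Ici (0 : ℝ))).prod volume : Measure (SpaceTime k)) =
        volume.restrict (Set.Ici (0 : ℝ) ×ˢ Set.univ) := by
      rw [Measure.volume_eq_prod, ← Measure.prod_restrict, Measure.restrict_univ]
    rw [hr, setIntegral_eq_integral_of_forall_compl_eq_zero]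
    · exact integral_congr_ae (ae_of_all _ fun q => mul_comm _ _)
    · rintro ⟨r, y⟩ hq
      have : r < 0 := by simpa using hq
      simp [hφ'.2.1 (r, y) this]
  · have hΓ : Real.Gamma (((k : ℝ) - β) / 2) ≠ 0 := (Real.Gamma_pos_of_pos (by linarith)).ne'
    have h := integral_tildeIntegrand_of_measurable hk h0 hkβ hc hφm hψm hφ'.1 hψ'.1 hφ'.2.1
      hψ'.2.1 hφ'.2.2 hψ'.2.2
    have h2 := noiseConst_mul_Gamma h0 hkβ hc
    have h3 : (noiseConst k β : ℂ) * (Real.Gamma (((k : ℝ) - β) / 2) : ℂ) =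
        ((2 * Real.pi) ^ (k + 1) : ℝ) * (rieszHeatConst k β : ℂ) := by exact_mod_cast h2
    refine mul_left_cancel₀ (Complex.ofReal_ne_zero.2 hΓ) ?_
    rw [h, ← mul_assoc, ← h3]
    ring

theorem noiseNormSq_ofReal (φ : SpaceTime k → ℝ) :
    noiseNormSq β (fun p => (φ p : ℂ)) = noiseNormSq β φ := by
  have h : ∀ x : ℝ, ‖(x : ℂ)‖ₑ = ‖x‖ₑ := fun x => by
    rw [← ofReal_norm, Complex.norm_real, ofReal_norm]
  simp only [noiseNormSq, h]

theorem ofReal_mem_noiseDomain {φ : SpaceTime k → ℝ} (hφ : φ ∈ noiseDomain k β ℝ) :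
    (fun p => (φ p : ℂ)) ∈ noiseDomain k β ℂ :=
  ⟨hφ.1.ofReal, fun p hp => by simp [hφ.2.1 p hp], by rw [noiseNormSq_ofReal]; exact hφ.2.2⟩

/-- For real functions the inner products are real. -/
theorem integral_tildeIntegrand_ofReal (hk : 1 ≤ k)
    (hβ : (0 < β ∧ β < min (k : ℝ) 2) ∨ (k = 1 ∧ β = 1))
    {φ ψ : SpaceTime k → ℝ} (hφ : φ ∈ noiseDomain k β ℝ) (hψ : ψ ∈ noiseDomain k β ℝ) :
    ∫ p, tildeIntegrand β (fun p => (φ p : ℂ)) p *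
        conj (tildeIntegrand β (fun p => (ψ p : ℂ)) p) =
      ((noiseConst k β * noiseCov β φ ψ : ℝ) : ℂ) := by
  have h0 := (eq_one_or_lt hβ).1
  have h := integral_tildeIntegrand_mul_conj hk hβ (ofReal_mem_noiseDomain hφ)
    (ofReal_mem_noiseDomain hψ)
  have h' := integral_tildeIntegrand_mul_conj hk hβ (ofReal_mem_noiseDomain hψ)
    (ofReal_mem_noiseDomain hφ)
  have e : ∀ {a b : SpaceTime k → ℝ}, a ∈ noiseDomain k β ℝ → b ∈ noiseDomain k β ℝ →
      ∫ x, conj ((a x.1 : ℝ) : ℂ) * ((b x.2 : ℝ) : ℂ) ∂(noisePair k β) = (noiseCov β a b : ℂ) := by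
    intro a b ha hb
    rw [noiseCov_eq_integral β (integrable_fst_mul_snd hk h0 ha.1.1 hb.1.1 ha.2.2 hb.2.2),
      ← integral_complex_ofReal]
    simp
  rw [e hφ hψ] at h'
  -- the spectral identity exchanges the arguments; as the value is real, conjugation restores them
  have h2 := congrArg conj h'
  rw [← integral_conj] at h2
  simp only [map_mul, Complex.conj_conj, Complex.conj_ofReal] at h2
  rw [Complex.ofReal_mul, ← h2]
  exact integral_congr_ae (ae_of_all _ fun p => mul_comm _ _)

theorem noiseCov_self_le (hk : 1 ≤ k) (h0 : 0 < β) {φ : SpaceTime k → ℝ}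
    (hφ : AEStronglyMeasurable φ volume) (hN : noiseNormSq β φ < ∞) :
    ENNReal.ofReal (noiseCov β φ φ) ≤ noiseNormSq β φ := by
  rw [noiseCov_eq_integral β (integrable_fst_mul_snd hk h0 hφ hφ hN hN)]
  refine (ENNReal.ofReal_le_ofReal (le_abs_self _)).trans ?_
  rw [← Real.norm_eq_abs, ofReal_norm, noiseNormSq_eq_pairForm β hφ, pairForm]
  refine (enorm_integral_le_lintegral_enorm _).trans_eq ?_
  simp_rw [enorm_mul]

/-- The map `φ ↦ |ξ|^{(β-k)/2} ℱφ` is bounded from the space of integrands to `L²`. -/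
theorem eLpNorm_tildeIntegrand_sub_le (hk : 1 ≤ k)
    (hβ : (0 < β ∧ β < min (k : ℝ) 2) ∨ (k = 1 ∧ β = 1))
    {φ ψ : SpaceTime k → ℝ} (hφ : φ ∈ noiseDomain k β ℝ) (hψ : ψ ∈ noiseDomain k β ℝ)
    (hN : noiseNormSq β (fun p => φ p - ψ p) < ∞) :
    eLpNorm (fun p => tildeIntegrand β (fun p => (φ p : ℂ)) p -
        tildeIntegrand β (fun p => (ψ p : ℂ)) p) 2 volume ^ 2 ≤
      ENNReal.ofReal (noiseConst k β) * noiseNormSq β (fun p => φ p - ψ p) := by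
  have hd : (fun p => φ p - ψ p) ∈ noiseDomain k β ℝ :=
    ⟨hφ.1.sub hψ.1, fun p hp => by simp [hφ.2.1 p hp, hψ.2.1 p hp], hN⟩
  have hF := fourierL2_add_mul (ofReal_mem_noiseDomain hd).1 (ofReal_mem_noiseDomain hφ).1
    (ofReal_mem_noiseDomain hψ).1 (-1) (ae_of_all _ fun p => by push_cast; ring)
  have hae : (fun p => tildeIntegrand β (fun p => (φ p : ℂ)) p -
        tildeIntegrand β (fun p => (ψ p : ℂ)) p) =ᵐ[volume]
      tildeIntegrand β (fun p => ((φ p - ψ p : ℝ) : ℂ)) := by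
    filter_upwards [hF] with p hp
    simp only [tildeIntegrand, hp]
    ring
  have hM := memLp_tildeIntegrand hk hβ (ofReal_mem_noiseDomain hd)
  rw [eLpNorm_congr_ae hae, eLpNorm_two_sq_eq_ofReal hM]
  have h1 := integral_tildeIntegrand_ofReal hk hβ hd hd
  rw [integral_mul_conj_self_eq] at h1
  rw [Complex.ofReal_inj.1 h1, ENNReal.ofReal_mul (noiseConst_pos hβ).le]
  gcongr
  exact noiseCov_self_le hk (eq_one_or_lt hβ).1 hd.1.1 hN

end Spectral

/-! ### The fundamental solution as an integrand of the noise -/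

section HeatEnergy

variable {k : ℕ} {β : ℝ}

theorem lintegral_heatKernel_mul_heatKernel_le {s σ : ℝ} (hs : 0 < s) (hσ : 0 < σ)
    (x y : EuclideanSpace ℝ (Fin k)) :
    ∫⁻ z, ENNReal.ofReal (heatKernel σ (y - z)) * ENNReal.ofReal (heatKernel s (x - z)) ≤
      ENNReal.ofReal ((4 * Real.pi * s) ^ (-(k : ℝ) / 2)) := by
  have h : ∫⁻ z, ENNReal.ofReal (heatKernel σ (y - z)) * ENNReal.ofReal (heatKernel s (x - z)) ≤
      ∫⁻ z, ENNReal.ofReal (heatKernel σ (y - z)) *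
        ENNReal.ofReal ((4 * Real.pi * s) ^ (-(k : ℝ) / 2)) := by
    gcongr with z
    exact heatKernel_le hs _
  rwa [lintegral_mul_const _ (by fun_prop), lintegral_heatKernel_sub_left hσ, one_mul] at h

/-- The potential of the heat kernel with respect to the Riesz kernel is bounded. -/
theorem exists_lintegral_riesz_mul_heatKernel_le (hk : 1 ≤ k) (h0 : 0 < β) (hβ : β < k) :
    ∃ K : ℝ, ∀ s : ℝ, 0 < s → ∀ x y : EuclideanSpace ℝ (Fin k),
      ∫⁻ z, ENNReal.ofReal (‖y - z‖ ^ (-β)) * ENNReal.ofReal (heatKernel s (x - z)) ≤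
        ENNReal.ofReal (K * s ^ (-β / 2)) := by
  have : Nonempty (Fin k) := ⟨⟨0, hk⟩⟩
  set a : ℝ := ((k : ℝ) - β) / 2 with ha
  have ha0 : 0 < a := by rw [ha]; linarith
  set b : ℝ := (4 * Real.pi) ^ (-(k : ℝ) / 2) with hb
  have hb0 : 0 < b := by positivity
  have hC := rieszHeatConst_pos (k := k) h0
  refine ⟨(rieszHeatConst k β)⁻¹ * (b * a⁻¹ + b * (β / 2)⁻¹), fun s hs x y => ?_⟩
  have hsplit : ∀ {σ : ℝ}, 0 < σ → (4 * Real.pi * σ) ^ (-(k : ℝ) / 2) = b * σ ^ (-(k : ℝ) / 2) :=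
    fun hσ => Real.mul_rpow (by positivity) hσ.le
  -- the heat kernel with the larger time is estimated by its maximum
  have h1 : ∫⁻ σ in Set.Ioc 0 s, ENNReal.ofReal (σ ^ (a - 1)) *
      ENNReal.ofReal ((4 * Real.pi * s) ^ (-(k : ℝ) / 2)) =
      ENNReal.ofReal (b * a⁻¹ * s ^ (-β / 2)) := by
    have hi : IntegrableOn (fun σ : ℝ => σ ^ (a - 1)) (Set.Ioc 0 s) :=
      (intervalIntegrable_iff_integrableOn_Ioc_of_le hs.le).1
        (intervalIntegral.intervalIntegrable_rpow' (by linarith))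
    rw [lintegral_mul_const _ (by fun_prop), ← ofReal_integral_eq_lintegral_ofReal hi
      ((ae_restrict_mem measurableSet_Ioc).mono fun σ hσ => Real.rpow_nonneg hσ.1.le _),
      ← intervalIntegral.integral_of_le hs.le, integral_rpow (Or.inl (by linarith)),
      ← ENNReal.ofReal_mul (by
        rw [sub_add_cancel, Real.zero_rpow ha0.ne', sub_zero]; positivity), hsplit hs,
      sub_add_cancel, Real.zero_rpow ha0.ne', sub_zero,
      show -β / 2 = a + -(k : ℝ) / 2 by rw [ha]; ring, Real.rpow_add hs]
    congr 1
    field_simp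
  have h2 : ∫⁻ σ in Set.Ioi s, ENNReal.ofReal (σ ^ (a - 1)) *
      ENNReal.ofReal ((4 * Real.pi * σ) ^ (-(k : ℝ) / 2)) =
      ENNReal.ofReal (b * (β / 2)⁻¹ * s ^ (-β / 2)) := by
    have hlt : -β / 2 - 1 < -1 := by linarith
    have e : ∀ σ ∈ Set.Ioi s, ENNReal.ofReal (σ ^ (a - 1)) *
        ENNReal.ofReal ((4 * Real.pi * σ) ^ (-(k : ℝ) / 2)) =
        ENNReal.ofReal (b * σ ^ (-β / 2 - 1)) := by
      intro σ hσ
      have hσ0 : 0 < σ := hs.trans hσ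
      rw [← ENNReal.ofReal_mul (by positivity), hsplit hσ0,
        show -β / 2 - 1 = (a - 1) + -(k : ℝ) / 2 by rw [ha]; ring, Real.rpow_add hσ0]
      congr 1; ring
    rw [setLIntegral_congr_fun measurableSet_Ioi e,
      ← ofReal_integral_eq_lintegral_ofReal ((integrableOn_Ioi_rpow_of_lt hlt hs).const_mul b)
      ((ae_restrict_mem measurableSet_Ioi).mono fun σ hσ =>
        mul_nonneg hb0.le (Real.rpow_nonneg (hs.trans hσ).le _)),
      integral_const_mul, integral_Ioi_rpow_of_lt hlt hs, sub_add_cancel]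
    congr 1
    field_simp
  have h3 : ENNReal.ofReal (rieszHeatConst k β) *
      ∫⁻ z, ENNReal.ofReal (‖y - z‖ ^ (-β)) * ENNReal.ofReal (heatKernel s (x - z)) =
      ∫⁻ σ, ∫⁻ z, ENNReal.ofReal (heatKernel σ (y - z)) * ENNReal.ofReal (heatKernel s (x - z))
        ∂volume ∂(rieszWeight k β) := by
    rw [lintegral_lintegral_swap (by unfold Function.uncurry; fun_prop),
      ← lintegral_const_mul _ (by fun_prop)]
    refine lintegral_congr_ae ?_
    have : ∀ᵐ z : EuclideanSpace ℝ (Fin k), z ≠ y := by rw [ae_iff]; simp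
    filter_upwards [this] with z hz
    rw [lintegral_mul_const _ (by fun_prop),
      lintegral_rieszWeight_heatKernel h0 (sub_ne_zero.2 hz.symm), mul_assoc]
  have h4 : ∫⁻ σ, ∫⁻ z, ENNReal.ofReal (heatKernel σ (y - z)) *
      ENNReal.ofReal (heatKernel s (x - z)) ∂volume ∂(rieszWeight k β) ≤
      ENNReal.ofReal ((b * a⁻¹ + b * (β / 2)⁻¹) * s ^ (-β / 2)) := by
    rw [add_mul, ENNReal.ofReal_add (by positivity) (by positivity), ← h1, ← h2,
      lintegral_rieszWeight _ (by fun_prop), ← Set.Ioc_union_Ioi_eq_Ioi hs.le,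
      lintegral_union measurableSet_Ioi (Set.Ioc_disjoint_Ioi le_rfl)]
    refine add_le_add (setLIntegral_mono (by fun_prop) fun σ hσ => ?_)
      (setLIntegral_mono (by fun_prop) fun σ hσ => ?_)
    · gcongr
      exact lintegral_heatKernel_mul_heatKernel_le hs hσ.1 x y
    · have hσ0 : 0 < σ := hs.trans hσ
      gcongr
      simp_rw [mul_comm (ENNReal.ofReal (heatKernel σ _))]
      exact lintegral_heatKernel_mul_heatKernel_le hσ0 hs y x
  rw [← h3] at h4
  have hC' : ENNReal.ofReal (rieszHeatConst k β) ≠ 0 := (ENNReal.ofReal_pos.2 hC).ne'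
  rw [← ENNReal.mul_le_mul_iff_right hC' ENNReal.ofReal_ne_top, ← ENNReal.ofReal_mul hC.le]
  refine h4.trans_eq ?_
  congr 1
  field_simp

/-- The function `(s, y) ↦ 1_B(s) G(t - s, x - y)`. -/
noncomputable def heatIntegrand (t : ℝ) (B : Set ℝ) (x : EuclideanSpace ℝ (Fin k))
    (p : SpaceTime k) : ℝ :=
  B.indicator (fun s => heatKernel (t - s) (x - p.2)) p.1

theorem enorm_heatIntegrand (t : ℝ) (B : Set ℝ) (x : EuclideanSpace ℝ (Fin k)) (r : ℝ)
    (y : EuclideanSpace ℝ (Fin k)) : ‖heatIntegrand t B x (r, y)‖ₑ =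
      B.indicator (fun s => ENNReal.ofReal (heatKernel (t - s) (x - y))) r := by
  by_cases h : r ∈ B
  · simp [heatIntegrand, h, Real.enorm_eq_ofReal (heatKernel_nonneg _ _)]
  · simp [heatIntegrand, h]

theorem measurable_heatIntegrand (t : ℝ) {B : Set ℝ} (hB : MeasurableSet B)
    (x : EuclideanSpace ℝ (Fin k)) : Measurable (heatIntegrand t B x) := by
  have h : Measurable fun p : SpaceTime k => heatKernel (t - p.1) (x - p.2) := by fun_prop
  exact h.indicator (measurable_fst hB)

/-- Cutting off leaves a function of the same shape. -/
theorem heatIntegrand_sub (t : ℝ) {A B : Set ℝ} (h : A ⊆ B) (x : EuclideanSpace ℝ (Fin k)) :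
    (fun p => heatIntegrand t B x p - heatIntegrand t A x p) = heatIntegrand t (B \ A) x := by
  ext p
  by_cases h1 : p.1 ∈ A
  · simp [heatIntegrand, h1, h h1]
  · by_cases h2 : p.1 ∈ B <;> simp [heatIntegrand, h1, h2]

/-- The norm of the fundamental solution as an integrand: the energy of `G(s, x - ·)` is of order
`s^{-β/2}`, which is integrable at `s = 0` since `β < 2`. -/
theorem exists_noiseNormSq_heatIntegrand_le (hk : 1 ≤ k)
    (hβ : (0 < β ∧ β < min (k : ℝ) 2) ∨ (k = 1 ∧ β = 1)) :
    ∃ K : ℝ, ∀ (t : ℝ) (B : Set ℝ), MeasurableSet B → ∀ x : EuclideanSpace ℝ (Fin k),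
      noiseNormSq β (heatIntegrand t B x) ≤
        ∫⁻ r in B, ENNReal.ofReal (K * (t - r) ^ (-β / 2)) := by
  obtain ⟨h0, -, hc | ⟨hkβ, hc⟩⟩ := eq_one_or_lt hβ
  · refine ⟨(4 * Real.pi) ^ (-β / 2), fun t B hB x => ?_⟩
    rw [noiseNormSq, if_pos hc]
    refine (setLIntegral_le_lintegral _ _).trans ?_
    rw [← lintegral_indicator hB]
    refine lintegral_mono fun r => ?_
    simp only [enorm_heatIntegrand]
    by_cases hr : r ∈ B
    · simp only [Set.indicator_of_mem hr]
      rcases le_or_gt t r with h | h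
      · simp [heatKernel_of_nonpos (sub_nonpos.2 h)]
      · have h' : 0 < t - r := sub_pos.2 h
        refine (lintegral_heatKernel_mul_heatKernel_le h' h' x x).trans_eq ?_
        rw [Real.mul_rpow (by positivity) h'.le, hc.1, hc.2, Nat.cast_one]
    · simp [hr]
  · obtain ⟨K, hK⟩ := exists_lintegral_riesz_mul_heatKernel_le hk h0 hkβ
    refine ⟨K, fun t B hB x => ?_⟩
    rw [noiseNormSq, if_neg hc]
    refine (setLIntegral_le_lintegral _ _).trans ?_
    rw [← lintegral_indicator hB]
    refine lintegral_mono fun r => ?_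
    simp only [enorm_heatIntegrand]
    by_cases hr : r ∈ B
    · simp only [Set.indicator_of_mem hr]
      rcases le_or_gt t r with h | h
      · simp [heatKernel_of_nonpos (sub_nonpos.2 h)]
      · have h' : 0 < t - r := sub_pos.2 h
        have h1 : ∀ y, ∫⁻ z, ENNReal.ofReal (heatKernel (t - r) (x - y)) *
            ENNReal.ofReal (‖y - z‖ ^ (-β)) * ENNReal.ofReal (heatKernel (t - r) (x - z)) ≤
            ENNReal.ofReal (heatKernel (t - r) (x - y)) *
              ENNReal.ofReal (K * (t - r) ^ (-β / 2)) := by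
          intro y
          simp_rw [mul_assoc]
          rw [lintegral_const_mul _ (by fun_prop)]
          gcongr
          exact hK _ h' x y
        refine (lintegral_mono h1).trans_eq ?_
        rw [lintegral_mul_const _ (by fun_prop), lintegral_heatKernel_sub_left h', one_mul]
    · simp [hr]

theorem lintegral_rpow_sub_lt_top (K : ℝ) {t : ℝ} (ht : 0 ≤ t) (hβ : β < 2) :
    ∫⁻ r in Set.Icc 0 t, ENNReal.ofReal (K * (t - r) ^ (-β / 2)) < ∞ := by
  have h := (intervalIntegral.intervalIntegrable_rpow' (a := t) (b := 0) (r := -β / 2)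
    (by linarith)).comp_sub_left t
  simp only [sub_self, sub_zero] at h
  have h2 := (intervalIntegrable_iff_integrableOn_Icc_of_le ht).1 (h.const_mul K)
  exact h2.setLIntegral_lt_top

theorem noiseNormSq_heatIntegrand_lt_top (hk : 1 ≤ k)
    (hβ : (0 < β ∧ β < min (k : ℝ) 2) ∨ (k = 1 ∧ β = 1)) {t : ℝ} (ht : 0 ≤ t) {B : Set ℝ}
    (hB : MeasurableSet B) (hBt : B ⊆ Set.Icc 0 t) (x : EuclideanSpace ℝ (Fin k)) :
    noiseNormSq β (heatIntegrand t B x) < ∞ := by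
  obtain ⟨K, hK⟩ := exists_noiseNormSq_heatIntegrand_le hk hβ
  exact (hK t B hB x).trans_lt ((lintegral_mono_set hBt).trans_lt
    (lintegral_rpow_sub_lt_top K ht (eq_one_or_lt hβ).2.1))

theorem integrable_heatIntegrand (t : ℝ) {B : Set ℝ} (hB : MeasurableSet B)
    (hBf : volume B < ∞) (x : EuclideanSpace ℝ (Fin k)) :
    Integrable (heatIntegrand t B x) volume := by
  have hm := measurable_heatIntegrand t hB x
  refine ⟨hm.aestronglyMeasurable, ?_⟩
  rw [hasFiniteIntegral_iff_enorm, Measure.volume_eq_prod, lintegral_prod _ hm.enorm.aemeasurable]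
  refine lt_of_le_of_lt ?_ hBf
  rw [← lintegral_indicator_one hB]
  refine lintegral_mono fun r => ?_
  simp only [enorm_heatIntegrand]
  by_cases hr : r ∈ B
  · simp only [Set.indicator_of_mem hr, Pi.one_apply]
    rcases le_or_gt t r with h | h
    · simp [heatKernel_of_nonpos (sub_nonpos.2 h)]
    · rw [lintegral_heatKernel_sub_left (sub_pos.2 h)]
  · simp [hr]

/-- The fundamental solution is square integrable away from its singularity. The number `δ` bounds
the distance to it from below. -/
theorem memLp_heatIntegrand {t δ : ℝ} {B : Set ℝ} (hB : MeasurableSet B)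
    (hBf : volume B < ∞) (hδ : 0 < δ) (hBδ : ∀ s ∈ B, s < t → δ ≤ t - s)
    (x : EuclideanSpace ℝ (Fin k)) :
    MemLp (heatIntegrand t B x) 2 volume := by
  have h1 := integrable_heatIntegrand t hB hBf x
  refine memLp_two_of_lintegral h1.1 ?_
  have hb : ∀ p, ‖heatIntegrand t B x p‖ₑ ≤
      ENNReal.ofReal ((4 * Real.pi * δ) ^ (-(k : ℝ) / 2)) := by
    rintro ⟨r, y⟩
    rw [enorm_heatIntegrand]
    by_cases hr : r ∈ B
    · rw [Set.indicator_of_mem hr]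
      rcases le_or_gt t r with h | h
      · simp [heatKernel_of_nonpos (sub_nonpos.2 h)]
      · refine ENNReal.ofReal_le_ofReal ((heatKernel_le (sub_pos.2 h) _).trans ?_)
        refine Real.rpow_le_rpow_of_nonpos (by positivity) ?_ ?_
        · have := hBδ r hr h
          gcongr
        · have : (0 : ℝ) ≤ k := by positivity
          linarith
    · simp [hr]
  calc ∫⁻ p, ‖heatIntegrand t B x p‖ₑ * ‖heatIntegrand t B x p‖ₑ
      ≤ ∫⁻ p, ENNReal.ofReal ((4 * Real.pi * δ) ^ (-(k : ℝ) / 2)) * ‖heatIntegrand t B x p‖ₑ := by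
        gcongr with p
        exact hb p
    _ < ∞ := by
        rw [lintegral_const_mul _ (measurable_heatIntegrand t hB x).enorm]
        exact ENNReal.mul_lt_top ENNReal.ofReal_lt_top h1.2

theorem integral_cexp_mul_heatKernel_sub {u : ℝ} (hu : 0 < u) (x ξ : EuclideanSpace ℝ (Fin k)) :
    ∫ y, Complex.exp (-Complex.I * ((inner ℝ ξ y : ℝ) : ℂ)) * (heatKernel u (x - y) : ℂ) =
      Complex.exp (-Complex.I * ((inner ℝ ξ x : ℝ) : ℂ)) * (Real.exp (-(u * ‖ξ‖ ^ 2)) : ℝ) := by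
  rw [← integral_cexp_mul_heatKernel hu, ← integral_const_mul]
  refine Eq.trans ?_ (integral_sub_right_eq_self (fun z =>
    Complex.exp (-Complex.I * ((inner ℝ ξ x : ℝ) : ℂ)) *
      (Complex.exp (-Complex.I * ((inner ℝ ξ z : ℝ) : ℂ)) * (heatKernel u z : ℂ))) x)
  congr 1; ext y
  rw [← mul_assoc, ← Complex.exp_add, ← neg_sub y x, heatKernel_neg, inner_sub_right]
  congr 2
  push_cast
  ring

/-- The Fourier transform of the fundamental solution, cut off at the time `a`. -/
theorem fourierL1_heatIntegrand {t a : ℝ} (ha0 : 0 ≤ a) (hat : a ≤ t)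
    (x : EuclideanSpace ℝ (Fin k)) {p : SpaceTime k} (hp : p.2 ≠ 0) :
    fourierL1 (fun q => (heatIntegrand t (Set.Icc 0 a) x q : ℂ)) p =
      Complex.exp (-Complex.I * ((inner ℝ p.2 x : ℝ) : ℂ)) *
        (Complex.exp (-((t : ℂ) * ‖p.2‖ ^ 2)) *
        ((Complex.exp ((((‖p.2‖ ^ 2 : ℝ) : ℂ) - Complex.I * (p.1 : ℂ)) * a) - 1) /
          (((‖p.2‖ ^ 2 : ℝ) : ℂ) - Complex.I * (p.1 : ℂ)))) := by
  obtain ⟨τ, ξ⟩ := p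
  simp only at hp ⊢
  have hc : ((‖ξ‖ ^ 2 : ℝ) : ℂ) - Complex.I * (τ : ℂ) ≠ 0 := by
    intro h
    have := congrArg Complex.re h
    rw [Complex.sub_re, Complex.ofReal_re] at this
    simp at this
    exact hp this
  have hint : Integrable (fun q : SpaceTime k =>
      Complex.exp (-Complex.I * ((τ * q.1 + inner ℝ ξ q.2 : ℝ) : ℂ)) *
        (heatIntegrand t (Set.Icc 0 a) x q : ℂ)) volume := by
    have h1 := (integrable_heatIntegrand t (measurableSet_Icc (a := (0 : ℝ)) (b := a))
      (by simp) x).ofReal (𝕜 := ℂ)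
    exact h1.bdd_mul (c := 1) (by fun_prop) (ae_of_all _ fun q => (norm_cexp_neg_I_mul _).le)
  rw [fourierL1, Measure.volume_eq_prod, integral_prod _ (by rwa [← Measure.volume_eq_prod])]
  have e1 : ∀ᵐ s : ℝ, ∫ y, Complex.exp (-Complex.I * ((τ * s + inner ℝ ξ y : ℝ) : ℂ)) *
      (heatIntegrand t (Set.Icc 0 a) x (s, y) : ℂ) = (Set.Icc 0 a).indicator (fun s =>
        Complex.exp (-Complex.I * ((inner ℝ ξ x : ℝ) : ℂ)) *
        (Complex.exp (-((t : ℂ) * ‖ξ‖ ^ 2)) *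
          Complex.exp ((((‖ξ‖ ^ 2 : ℝ) : ℂ) - Complex.I * (τ : ℂ)) * s))) s := by
    have hne : ∀ᵐ s : ℝ, s ≠ t := by rw [ae_iff]; simp
    filter_upwards [hne] with s hs
    by_cases hsa : s ∈ Set.Icc 0 a
    · have hst : 0 < t - s := sub_pos.2 (lt_of_le_of_ne (hsa.2.trans hat) hs)
      simp only [heatIntegrand, Set.indicator_of_mem hsa]
      have e2 : ∀ y : EuclideanSpace ℝ (Fin k),
          Complex.exp (-Complex.I * ((τ * s + inner ℝ ξ y : ℝ) : ℂ)) *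
          (heatKernel (t - s) (x - y) : ℂ) = Complex.exp (-Complex.I * (τ * s : ℝ)) *
          (Complex.exp (-Complex.I * ((inner ℝ ξ y : ℝ) : ℂ)) *
            (heatKernel (t - s) (x - y) : ℂ)) := by
        intro y
        rw [← mul_assoc, ← Complex.exp_add]
        congr 2
        push_cast; ring
      simp_rw [e2]
      rw [integral_const_mul, integral_cexp_mul_heatKernel_sub hst, mul_left_comm]
      congr 1
      rw [Complex.ofReal_exp, ← Complex.exp_add, ← Complex.exp_add]
      congr 1
      push_cast; ring
    · simp [heatIntegrand, hsa]
  rw [integral_congr_ae e1, integral_indicator measurableSet_Icc, integral_Icc_eq_integral_Ioc,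
    ← intervalIntegral.integral_of_le ha0, intervalIntegral.integral_const_mul,
    intervalIntegral.integral_const_mul, integral_exp_mul_complex hc]
  simp

/-- The approximations of `1_{[0,t]}(s) G(t - s, x - y)` that stay away from the singularity at
`s = t`. The cut-off `t - t / (n + 2)` belongs to `[0, t]` for all `n`, and `t = 0` is allowed. -/
noncomputable def heatApprox (t : ℝ) (x : EuclideanSpace ℝ (Fin k)) (n : ℕ) : SpaceTime k → ℝ :=
  heatIntegrand t (Set.Icc 0 (t - t / (n + 2))) x

theorem heatApprox_mem_noiseDomain (hk : 1 ≤ k)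
    (hβ : (0 < β ∧ β < min (k : ℝ) 2) ∨ (k = 1 ∧ β = 1)) {t : ℝ} (ht : 0 ≤ t)
    (x : EuclideanSpace ℝ (Fin k)) (n : ℕ) : heatApprox t x n ∈ noiseDomain k β ℝ := by
  have hd : 0 ≤ t / ((n : ℝ) + 2) := by positivity
  refine ⟨?_, fun p hp => ?_, noiseNormSq_heatIntegrand_lt_top hk hβ ht measurableSet_Icc
    (Set.Icc_subset_Icc_right (by linarith)) x⟩
  · rcases ht.eq_or_lt with rfl | ht
    · exact memLp_heatIntegrand (δ := 1) measurableSet_Icc (by simp) one_pos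
        (fun s hs h => absurd hs.1 (not_le.2 h)) x
    · exact memLp_heatIntegrand (δ := t / (n + 2)) measurableSet_Icc (by simp) (by positivity)
        (fun s hs _ => by linarith [hs.2]) x
  · have hn : p.1 ∉ Set.Icc 0 (t - t / ((n : ℝ) + 2)) := fun h => (not_le.2 hp) h.1
    rw [heatApprox, heatIntegrand, Set.indicator_of_notMem hn]

theorem tendsto_div_add_two (t : ℝ) : Tendsto (fun n : ℕ => t / ((n : ℝ) + 2)) atTop (𝓝 0) :=
  tendsto_const_nhds.div_atTop (tendsto_atTop_add_const_right _ _ tendsto_natCast_atTop_atTop)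

/-- The part of the norm of the fundamental solution beyond the cut-off tends to zero, together
with that of all its further cut-offs. -/
theorem exists_tendsto_noiseNormSq_heatIntegrand (hk : 1 ≤ k)
    (hβ : (0 < β ∧ β < min (k : ℝ) 2) ∨ (k = 1 ∧ β = 1)) {t : ℝ} (ht : 0 ≤ t)
    (x : EuclideanSpace ℝ (Fin k)) :
    ∃ ε : ℕ → ℝ≥0∞, Tendsto ε atTop (𝓝 0) ∧ ∀ n : ℕ, ∀ B : Set ℝ, MeasurableSet B →
      B ⊆ Set.Ioc (t - t / ((n : ℝ) + 2)) t ∩ Set.Icc 0 t →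
        noiseNormSq β (heatIntegrand t B x) ≤ ε n := by
  obtain ⟨K, hK⟩ := exists_noiseNormSq_heatIntegrand_le hk hβ
  refine ⟨fun n : ℕ => ∫⁻ r in Set.Ioc (t - t / ((n : ℝ) + 2)) t,
      (ENNReal.ofReal (K * (t - r) ^ (-β / 2))) ∂(volume.restrict (Set.Icc 0 t)), ?_, ?_⟩
  · refine tendsto_setLIntegral_zero
      (lintegral_rpow_sub_lt_top K ht (eq_one_or_lt hβ).2.1).ne ?_
    have h1 : Tendsto (fun n : ℕ => ENNReal.ofReal (t / ((n : ℝ) + 2))) atTop (𝓝 0) := by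
      simpa using ENNReal.tendsto_ofReal (tendsto_div_add_two t)
    refine tendsto_of_tendsto_of_tendsto_of_le_of_le tendsto_const_nhds h1
      (fun _ => zero_le) fun n => ?_
    refine (Measure.restrict_le_self _).trans ?_
    rw [Real.volume_Ioc]
    simp
  · intro n B hB hBn
    refine (hK t B hB x).trans ?_
    simp only
    rw [Measure.restrict_restrict measurableSet_Ioc]
    exact lintegral_mono_set hBn

theorem noiseNormSq_sub_comm {F : Type*} [NormedAddCommGroup F] (φ ψ : SpaceTime k → F) :
    noiseNormSq β (fun p => φ p - ψ p) = noiseNormSq β (fun p => ψ p - φ p) := by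
  simp only [noiseNormSq]
  simp_rw [fun p => enorm_sub_rev (φ p) (ψ p)]

/-- The explicit transforms of the approximations converge pointwise. -/
theorem tendsto_tildeIntegrand_heatApprox (hk : 1 ≤ k)
    (hβ : (0 < β ∧ β < min (k : ℝ) 2) ∨ (k = 1 ∧ β = 1)) {t : ℝ} (ht : 0 ≤ t)
    (x : EuclideanSpace ℝ (Fin k)) :
    ∀ᵐ p, Tendsto (fun n => tildeIntegrand β (fun q => (heatApprox t x n q : ℂ)) p) atTop
      (𝓝 (harmonizableKernel β t x p)) := by
  have hF : ∀ᵐ p, ∀ n, fourierL2 (fun q => (heatApprox t x n q : ℂ)) p =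
      fourierL1 (fun q => (heatApprox t x n q : ℂ)) p := ae_all_iff.2 fun n =>
    fourierL2_ae_eq_fourierL1 (integrable_heatIntegrand t measurableSet_Icc (by simp) x).ofReal
      (heatApprox_mem_noiseDomain hk hβ ht x n).1.ofReal
  filter_upwards [hF, ae_snd_ne_zero hk] with p h1 h2
  have hle : ∀ n : ℕ, t / ((n : ℝ) + 2) ≤ t := fun n =>
    div_le_self ht (by have : (0 : ℝ) ≤ n := by positivity
                       linarith)
  have h0 : ∀ n : ℕ, 0 ≤ t / ((n : ℝ) + 2) := fun n => by positivity
  simp only [tildeIntegrand, h1, harmonizableKernel]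
  simp only [heatApprox, fun n : ℕ => fourierL1_heatIntegrand (t := t)
    (a := t - t / ((n : ℝ) + 2)) (by linarith [hle n]) (by linarith [h0 n]) x h2]
  rw [mul_comm _ (((‖p.2‖ ^ ((β - k) / 2) : ℝ) : ℂ))]
  have ha : Tendsto (fun n : ℕ => ((t - t / ((n : ℝ) + 2) : ℝ) : ℂ)) atTop (𝓝 (t : ℂ)) := by
    have := (tendsto_const_nhds (x := t)).sub (tendsto_div_add_two t)
    rw [sub_zero] at this
    exact (Complex.continuous_ofReal.tendsto t).comp this
  have hlim : Complex.exp (-Complex.I * ((p.1 * t : ℝ) : ℂ)) -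
      ((Real.exp (-(t * ‖p.2‖ ^ 2)) : ℝ) : ℂ) = Complex.exp (-((t : ℂ) * ‖p.2‖ ^ 2)) *
        (Complex.exp ((((‖p.2‖ ^ 2 : ℝ) : ℂ) - Complex.I * (p.1 : ℂ)) * t) - 1) := by
    rw [mul_sub, ← Complex.exp_add, mul_one, Complex.ofReal_exp]
    congr 2 <;> push_cast <;> ring
  rw [hlim, mul_div_assoc]
  refine Tendsto.const_mul _ (Tendsto.const_mul _ (Tendsto.const_mul _ (Tendsto.div_const
    (Tendsto.sub_const ?_ _) _)))
  exact (Complex.continuous_exp.tendsto _).comp (ha.const_mul _)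

/-- The integrand of the harmonizable field is the limit in `L²` of the weighted Fourier transforms
of the approximations of the fundamental solution. -/
theorem memLp_harmonizableKernel_and_tendsto (hk : 1 ≤ k)
    (hβ : (0 < β ∧ β < min (k : ℝ) 2) ∨ (k = 1 ∧ β = 1)) {t : ℝ} (ht : 0 ≤ t)
    (x : EuclideanSpace ℝ (Fin k)) :
    MemLp (harmonizableKernel β t x) 2 volume ∧
      Tendsto (fun n => eLpNorm (fun p => tildeIntegrand β (fun q => (heatApprox t x n q : ℂ)) p -
        harmonizableKernel β t x p) 2 volume) atTop (𝓝 0) ∧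
      Tendsto (fun n => noiseNormSq β (fun p => heatApprox t x n p -
        heatIntegrand t (Set.Icc 0 t) x p)) atTop (𝓝 0) := by
  obtain ⟨ε, hε, hεB⟩ := exists_tendsto_noiseNormSq_heatIntegrand hk hβ ht x
  have hT : ∀ n, MemLp (tildeIntegrand β (fun q => (heatApprox t x n q : ℂ))) 2 := fun n =>
    memLp_tildeIntegrand hk hβ (ofReal_mem_noiseDomain (heatApprox_mem_noiseDomain hk hβ ht x n))
  have hlim := tendsto_tildeIntegrand_heatApprox hk hβ ht x
  have hsub : ∀ n : ℕ, ∀ b : ℝ, b ≤ t → Set.Icc 0 b \ Set.Icc 0 (t - t / ((n : ℝ) + 2)) ⊆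
      Set.Ioc (t - t / ((n : ℝ) + 2)) t ∩ Set.Icc 0 t := by
    rintro n b hb r ⟨⟨hr0, hrb⟩, hr⟩
    have : t - t / ((n : ℝ) + 2) < r := by
      by_contra h
      exact hr ⟨hr0, not_lt.1 h⟩
    exact ⟨⟨this, hrb.trans hb⟩, hr0, hrb.trans hb⟩
  have hdiff : ∀ n : ℕ, ∀ b : ℝ, b ≤ t → t - t / ((n : ℝ) + 2) ≤ b →
      noiseNormSq β (fun p => heatApprox t x n p - heatIntegrand t (Set.Icc 0 b) x p) ≤ ε n := by
    intro n b hb hnb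
    rw [noiseNormSq_sub_comm, heatApprox, heatIntegrand_sub t (Set.Icc_subset_Icc_right hnb)]
    exact hεB n _ (measurableSet_Icc.diff measurableSet_Icc) (hsub n b hb)
  have hN : Tendsto (fun n => noiseNormSq β (fun p => heatApprox t x n p -
      heatIntegrand t (Set.Icc 0 t) x p)) atTop (𝓝 0) :=
    tendsto_of_tendsto_of_tendsto_of_le_of_le tendsto_const_nhds hε (fun _ => zero_le) fun n =>
      hdiff n t le_rfl (by have : 0 ≤ t / ((n : ℝ) + 2) := by positivity
                           linarith)
  set c := ENNReal.ofReal (noiseConst k β)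
  have hcε : Tendsto (fun n => (c * ε n) ^ (2⁻¹ : ℝ)) atTop (𝓝 0) := by
    refine tendsto_rpow_half ?_
    simpa using ENNReal.Tendsto.const_mul hε (Or.inr ENNReal.ofReal_ne_top)
  -- Fatou's lemma for the differences, which are bounded by the isometry
  have hle : ∀ᶠ n in atTop, eLpNorm (fun p => tildeIntegrand β
      (fun q => (heatApprox t x n q : ℂ)) p - harmonizableKernel β t x p) 2 volume ≤
        (c * ε n) ^ (2⁻¹ : ℝ) := by
    filter_upwards [hε.eventually (gt_mem_nhds ENNReal.zero_lt_top)] with n hn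
    refine (Lp.eLpNorm_lim_le_liminf_eLpNorm (fun m => ((hT n).sub (hT m)).1) _
      (hlim.mono fun p hp => hp.const_sub _)).trans ?_
    refine liminf_le_of_frequently_le' (Eventually.frequently ?_)
    filter_upwards [eventually_ge_atTop n] with m hm
    have hmn : t / ((m : ℝ) + 2) ≤ t / ((n : ℝ) + 2) := by gcongr
    have h0 : 0 ≤ t / ((m : ℝ) + 2) := by positivity
    have h1 := hdiff n (t - t / ((m : ℝ) + 2)) (by linarith) (by linarith)
    have h2 := eLpNorm_tildeIntegrand_sub_le hk hβ (heatApprox_mem_noiseDomain hk hβ ht x n)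
      (heatApprox_mem_noiseDomain hk hβ ht x m) (h1.trans_lt hn)
    have h3 := h2.trans (mul_le_mul_right h1 c)
    have h4 := ENNReal.rpow_le_rpow h3 (z := (2⁻¹ : ℝ)) (by norm_num)
    rwa [← ENNReal.rpow_natCast, ← ENNReal.rpow_mul, Nat.cast_ofNat,
      mul_inv_cancel₀ (by norm_num : (2 : ℝ) ≠ 0), ENNReal.rpow_one] at h4
  have hK : AEStronglyMeasurable (harmonizableKernel β t x) volume :=
    aestronglyMeasurable_of_tendsto_ae atTop (fun n => (hT n).1) hlim
  have htend : Tendsto (fun n => eLpNorm (fun p => tildeIntegrand β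
      (fun q => (heatApprox t x n q : ℂ)) p - harmonizableKernel β t x p) 2 volume) atTop (𝓝 0) :=
    tendsto_of_tendsto_of_tendsto_of_le_of_le' tendsto_const_nhds hcε
      (Eventually.of_forall fun _ => zero_le) hle
  refine ⟨?_, htend, hN⟩
  obtain ⟨n, hn⟩ := (htend.eventually (gt_mem_nhds ENNReal.zero_lt_top)).exists
  have hd : MemLp (fun p => tildeIntegrand β (fun q => (heatApprox t x n q : ℂ)) p -
      harmonizableKernel β t x p) 2 volume := ⟨(hT n).1.sub hK, hn⟩
  refine ((hT n).sub hd).ae_eq (ae_of_all _ fun p => ?_)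
  simp

end HeatEnergy

/-! ### The harmonizable noise and the harmonizable field -/

section Transfer

theorem HeatNoise.reIm_comp {Ω ι T T' : Type*} (Z : ι → T → Ω → ℂ) (g : T' → T) (p : ι ⊕ ι)
    (t : T') :
    reIm (fun i t => Z i (g t)) p t = reIm Z p (g t) := by
  cases p <;> rfl

variable {Ω ι κ : Type*} [MeasurableSpace Ω] {P : Measure Ω}

theorem HeatNoise.HasWienerIntegral.congr {S : Type*} [MeasurableSpace S] {ν : Measure S}
    {W : Set S → Ω → ℂ} {f : S → ℂ} {Z Z' : Ω → ℂ} (hZ : HasWienerIntegral P ν W f Z)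
    (h : Z =ᵐ[P] Z') : HasWienerIntegral P ν W f Z' := by
  obtain ⟨hm, F, hF, hFf, hFZ⟩ := hZ
  refine ⟨hm.ae_eq h, F, hF, hFf, hFZ.congr fun n => eLpNorm_congr_ae ?_⟩
  filter_upwards [h] with ω hω
  rw [hω]

theorem HeatNoise.IsComplexWhiteNoise.hasWienerIntegral_const_mul {S : Type*} [MeasurableSpace S]
    {ν : Measure S} {W : ι → Set S → Ω → ℂ} (hW : IsComplexWhiteNoise P ν W) (i : ι) {f : S → ℂ}
    {Z : Ω → ℂ} (hf : MemLp f 2 ν) (hZ : HasWienerIntegral P ν (W i) f Z) (b : ℂ) :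
    HasWienerIntegral P ν (W i) (fun x => b * f x) (fun ω => b * Z ω) := by
  have hbf : MemLp (fun x => b * f x) 2 ν := hf.const_mul b
  have h := hW.hasWienerIntegral_wienerIntegral i hbf
  refine h.congr ?_
  have h2 := hW.wiener_ae_eq_add_mul i hbf hf hf h hZ hZ (b - 1)
    (ae_of_all _ fun x => by ring)
  filter_upwards [h2] with ω hω
  rw [hω]; ring

/-- A bounded linear image of an integral with respect to a noise is the integral with respect to
the image of the noise. -/
theorem HeatNoise.HasNoiseIntegral.continuousLinearMap {k : ℕ} {β : ℝ} {E F : Type*}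
    [NormedAddCommGroup E] [NormedSpace ℝ E] [NormedAddCommGroup F] [NormedSpace ℝ F]
    {D : Set (SpaceTime k → ℝ)} {X : (SpaceTime k → ℝ) → Ω → E} {g : SpaceTime k → ℝ} {Z : Ω → E}
    (hZ : HasNoiseIntegral P β D X g Z) (L : E →L[ℝ] F) :
    HasNoiseIntegral P β D (fun φ ω => L (X φ ω)) g (fun ω => L (Z ω)) := by
  obtain ⟨hm, Φ, hΦ, hΦg, hΦZ⟩ := hZ
  refine ⟨L.comp_memLp' hm, Φ, hΦ, hΦg, ?_⟩
  have h := ENNReal.Tendsto.const_mul (a := ENNReal.ofReal ‖L‖) hΦZ (Or.inr ENNReal.ofReal_ne_top)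
  rw [mul_zero] at h
  refine tendsto_of_tendsto_of_tendsto_of_le_of_le tendsto_const_nhds h (fun _ => zero_le)
    fun n => ?_
  refine eLpNorm_le_mul_eLpNorm_of_ae_le_mul (ae_of_all _ fun ω => ?_) 2
  rw [← map_sub]
  exact L.le_opNorm _

theorem HeatNoise.IsNoise.comp_injective {k : ℕ} {β : ℝ} {D : Set (SpaceTime k → ℝ)}
    {X : ι → (SpaceTime k → ℝ) → Ω → ℝ} (hX : IsNoise P β D X) {e : κ → ι}
    (he : Function.Injective e) : IsNoise P β D (fun i => X (e i)) where
  gaussian := hX.gaussian.comp_right fun q : κ × D => (e q.1, q.2)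
  centered i := hX.centered (e i)
  covariance i j φ hφ ψ hψ := by
    rw [hX.covariance (e i) (e j) φ hφ ψ hψ]
    by_cases h : i = j
    · rw [if_pos h, if_pos (congrArg e h)]
    · rw [if_neg h, if_neg (he.ne h)]

/-- For a finite index set a Gaussian process is a Gaussian vector. -/
theorem hasGaussianLaw_pi_of_isGaussianProcess {J : Type*} [Fintype J] {Y : J → Ω → ℝ}
    (hY : IsGaussianProcess Y P) : HasGaussianLaw (fun ω j => Y j ω) P :=
  (hY.hasGaussianLaw Finset.univ).map (ContinuousLinearMap.pi (R := ℝ)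
    (φ := fun _ : J => ℝ) fun j => ContinuousLinearMap.proj
      (R := ℝ) (φ := fun _ : (Finset.univ : Finset J) => ℝ) ⟨j, Finset.mem_univ j⟩)

end Transfer

section Harmonizable

variable {k : ℕ} {β : ℝ} {Ω ι : Type*} [MeasurableSpace Ω] {P : Measure Ω}
  {W : ι → Set (SpaceTime k) → Ω → ℂ}

theorem hasWienerIntegral_tildeNoise (hk : 1 ≤ k)
    (hβ : (0 < β ∧ β < min (k : ℝ) 2) ∨ (k = 1 ∧ β = 1)) (hW : IsComplexWhiteNoise P volume W)
    (j : ι) {φ : SpaceTime k → ℂ} (hφ : φ ∈ noiseDomain k β ℂ) :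
    HasWienerIntegral P volume (W j) (tildeIntegrand β φ) (tildeNoise P β W j φ) :=
  hW.hasWienerIntegral_wienerIntegral j (memLp_tildeIntegrand hk hβ hφ)

theorem hasWienerIntegral_harmonizableField (hk : 1 ≤ k)
    (hβ : (0 < β ∧ β < min (k : ℝ) 2) ∨ (k = 1 ∧ β = 1)) (hW : IsComplexWhiteNoise P volume W)
    (j : ι) (t : ℝ≥0) (x : EuclideanSpace ℝ (Fin k)) :
    HasWienerIntegral P volume (W j) (harmonizableKernel β t x) (harmonizableField P β W j t x) :=
  hW.hasWienerIntegral_wienerIntegral j (memLp_harmonizableKernel_and_tendsto hk hβ t.2 x).1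

/-- The normalized real and imaginary parts of `W̃` form a standard noise. -/
theorem isNoise_tildeNoise [IsProbabilityMeasure P] (hk : 1 ≤ k)
    (hβ : (0 < β ∧ β < min (k : ℝ) 2) ∨ (k = 1 ∧ β = 1)) (hW : IsComplexWhiteNoise P volume W) :
    IsNoise P β (noiseDomain k β ℝ) (reIm fun j (φ : SpaceTime k → ℝ) ω =>
      (((noiseConst k β).sqrt)⁻¹ : ℂ) * tildeNoise P β W j (fun p => (φ p : ℂ)) ω) := by
  set b : ℂ := (((noiseConst k β).sqrt)⁻¹ : ℂ) with hb
  have hc := noiseConst_pos hβ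
  have hf : ∀ (_ : ι) (φ : noiseDomain k β ℝ),
      MemLp (fun p => b * tildeIntegrand β (fun p => (φ.1 p : ℂ)) p) 2 volume := fun _ φ =>
    (memLp_tildeIntegrand hk hβ (ofReal_mem_noiseDomain φ.2)).const_mul b
  have hZ : ∀ (j : ι) (φ : noiseDomain k β ℝ), HasWienerIntegral P volume (W j)
      (fun p => b * tildeIntegrand β (fun p => (φ.1 p : ℂ)) p)
      (fun ω => b * tildeNoise P β W j (fun p => (φ.1 p : ℂ)) ω) := fun j φ =>
    hW.hasWienerIntegral_const_mul j (memLp_tildeIntegrand hk hβ (ofReal_mem_noiseDomain φ.2))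
      (hasWienerIntegral_tildeNoise hk hβ hW j (ofReal_mem_noiseDomain φ.2)) b
  have hre := fun (p : ι ⊕ ι) (φ : noiseDomain k β ℝ) =>
    reIm_comp (fun j (φ : SpaceTime k → ℝ) ω => b * tildeNoise P β W j (fun p => (φ p : ℂ)) ω)
      (Subtype.val : noiseDomain k β ℝ → _) p φ
  obtain ⟨hG, h0⟩ := hW.isGaussianProcess_reIm_wiener hZ
  refine ⟨?_, fun p φ hφ => ?_, fun p q φ hφ ψ hψ => ?_⟩
  · convert hG using 2 with q
    exact (hre q.1 q.2).symm
  · rw [← hre p ⟨φ, hφ⟩]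
    exact h0 p ⟨φ, hφ⟩
  · rw [← hre p ⟨φ, hφ⟩, ← hre q ⟨ψ, hψ⟩]
    refine (hW.integral_reIm_wiener hf hZ p q ⟨φ, hφ⟩ ⟨ψ, hψ⟩ (r := noiseCov β φ ψ)
      fun i => ?_).trans (by split_ifs <;> rfl)
    have h := integral_tildeIntegrand_ofReal hk hβ hφ hψ
    have hbb : b * conj b * ((noiseConst k β : ℝ) : ℂ) = 1 := by
      have h1 : b = (((noiseConst k β).sqrt⁻¹ : ℝ) : ℂ) := by rw [hb, Complex.ofReal_inv]
      rw [h1, Complex.conj_ofReal, ← Complex.ofReal_mul, ← Complex.ofReal_mul, ← mul_inv,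
        Real.mul_self_sqrt hc.le, inv_mul_cancel₀ hc.ne', Complex.ofReal_one]
    simp only [map_mul]
    simp_rw [mul_mul_mul_comm b]
    rw [integral_const_mul, h, Complex.ofReal_mul, ← mul_assoc, hbb, one_mul]

theorem noiseNormSq_mono {E F : Type*} [NormedAddCommGroup E] [NormedAddCommGroup F]
    {φ : SpaceTime k → E} {ψ : SpaceTime k → F} (h : ∀ p, ‖φ p‖ₑ ≤ ‖ψ p‖ₑ) :
    noiseNormSq β φ ≤ noiseNormSq β ψ := by
  unfold noiseNormSq
  split_ifs <;> gcongr <;> apply h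

theorem re_mem_noiseDomain {φ : SpaceTime k → ℂ} (hφ : φ ∈ noiseDomain k β ℂ) :
    (fun p => (φ p).re) ∈ noiseDomain k β ℝ :=
  ⟨hφ.1.re, fun p hp => by simp [hφ.2.1 p hp], (noiseNormSq_mono fun p =>
    enorm_le_iff_norm_le.2 (Complex.abs_re_le_norm _)).trans_lt hφ.2.2⟩

theorem im_mem_noiseDomain {φ : SpaceTime k → ℂ} (hφ : φ ∈ noiseDomain k β ℂ) :
    (fun p => (φ p).im) ∈ noiseDomain k β ℝ :=
  ⟨hφ.1.im, fun p hp => by simp [hφ.2.1 p hp], (noiseNormSq_mono fun p =>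
    enorm_le_iff_norm_le.2 (Complex.abs_im_le_norm _)).trans_lt hφ.2.2⟩

theorem tildeNoise_ae_eq_re_add_im (hk : 1 ≤ k)
    (hβ : (0 < β ∧ β < min (k : ℝ) 2) ∨ (k = 1 ∧ β = 1)) (hW : IsComplexWhiteNoise P volume W)
    (j : ι) {φ : SpaceTime k → ℂ} (hφ : φ ∈ noiseDomain k β ℂ) :
    tildeNoise P β W j φ =ᵐ[P] fun ω => tildeNoise P β W j (fun p => ((φ p).re : ℂ)) ω +
      Complex.I * tildeNoise P β W j (fun p => ((φ p).im : ℂ)) ω := by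
  have h1 := ofReal_mem_noiseDomain (re_mem_noiseDomain hφ)
  have h2 := ofReal_mem_noiseDomain (im_mem_noiseDomain hφ)
  have hF := fourierL2_add_mul hφ.1 h1.1 h2.1 Complex.I
    (ae_of_all _ fun q => by simp only [mul_comm Complex.I, Complex.re_add_im])
  refine hW.wiener_ae_eq_add_mul j (memLp_tildeIntegrand hk hβ hφ) (memLp_tildeIntegrand hk hβ h1)
    (memLp_tildeIntegrand hk hβ h2) (hasWienerIntegral_tildeNoise hk hβ hW j hφ)
    (hasWienerIntegral_tildeNoise hk hβ hW j h1) (hasWienerIntegral_tildeNoise hk hβ hW j h2)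
    Complex.I ?_
  filter_upwards [hF] with p hp
  simp only [tildeIntegrand, hp]
  ring

/-- The integrand of `v` is the limit of the transforms of cut-off fundamental solutions, whose
integrals with respect to `W` are the values of `W̃`. -/
theorem isMildSolution_harmonizableField (hk : 1 ≤ k)
    (hβ : (0 < β ∧ β < min (k : ℝ) 2) ∨ (k = 1 ∧ β = 1)) (hW : IsComplexWhiteNoise P volume W) :
    IsMildSolution P β (noiseDomain k β ℝ)
      (fun j φ => tildeNoise P β W j (fun p => (φ p : ℂ))) (harmonizableField P β W) := by
  refine ⟨fun j t x => ?_, fun j x => ?_⟩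
  · obtain ⟨hK, hT, hN⟩ := memLp_harmonizableKernel_and_tendsto hk hβ t.2 x
    have hv := hasWienerIntegral_harmonizableField hk hβ hW j t x
    have hmem := heatApprox_mem_noiseDomain hk hβ t.2 x
    refine ⟨hv.1, heatApprox t x, hmem, hN, ?_⟩
    refine tendsto_eLpNorm_of_le_sq (C := 2) (by norm_num) (fun n => le_of_eq ?_) hT
    exact hW.eLpNorm_wiener_sub j (memLp_tildeIntegrand hk hβ (ofReal_mem_noiseDomain (hmem n))) hK
      (hasWienerIntegral_tildeNoise hk hβ hW j (ofReal_mem_noiseDomain (hmem n))) hv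
  · refine hW.wiener_ae_eq_zero j (memLp_harmonizableKernel_and_tendsto hk hβ (0 : ℝ≥0).2 x).1
      (hasWienerIntegral_harmonizableField hk hβ hW j 0 x) (ae_of_all _ fun p => ?_)
    simp [harmonizableKernel]

/-- Integrals of the same functions with respect to two standard noises have the same law. The
noises may be defined on different classes of functions. -/
theorem identDistrib_of_hasNoiseIntegral {Ω' κ : Type*} [MeasurableSpace Ω'] {P' : Measure Ω'}
    [IsProbabilityMeasure P] [IsProbabilityMeasure P'] [Fintype κ] (hk : 1 ≤ k) (h0 : 0 < β)
    {D D' : Set (SpaceTime k → ℝ)} {X : κ → (SpaceTime k → ℝ) → Ω → ℝ}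
    {X' : κ → (SpaceTime k → ℝ) → Ω' → ℝ} (hX : IsNoise P β D X) (hX' : IsNoise P' β D' X')
    (hD : ∀ φ ∈ D, AEStronglyMeasurable φ volume) (hD' : ∀ φ ∈ D', AEStronglyMeasurable φ volume)
    {T : Type*} {g : T → SpaceTime k → ℝ} (hg : ∀ t, AEStronglyMeasurable (g t) volume)
    (hgN : ∀ t, noiseNormSq β (g t) < ∞) {u : κ → T → Ω → ℝ} {u' : κ → T → Ω' → ℝ}
    (hu : ∀ i t, HasNoiseIntegral P β D (X i) (g t) (u i t))
    (hu' : ∀ i t, HasNoiseIntegral P' β D' (X' i) (g t) (u' i t)) (I : Finset T) :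
    IdentDistrib (fun ω (q : I × κ) => u q.2 q.1 ω) (fun ω (q : I × κ) => u' q.2 q.1 ω) P P' := by
  obtain ⟨hG, hz, hc⟩ := hX.noiseIntegral hk h0 hD hg hgN hu
  obtain ⟨hG', hz', hc'⟩ := hX'.noiseIntegral hk h0 hD' hg hgN hu'
  refine identDistrib_of_gaussian_of_covariance_eq (Y := fun q : I × κ => u q.2 q.1)
    (Y' := fun q : I × κ => u' q.2 q.1) ?_ ?_ (fun q => hz _ _) (fun q => hz' _ _)
    fun q q' => by rw [hc, hc']
  · exact hasGaussianLaw_pi_of_isGaussianProcess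
      (hG.comp_right fun q : I × κ => (q.2, (q.1 : T)))
  · exact hasGaussianLaw_pi_of_isGaussianProcess
      (hG'.comp_right fun q : I × κ => (q.2, (q.1 : T)))

end Harmonizable

theorem proposition6p2 {Ω : Type*} [MeasurableSpace Ω] (P : Measure Ω) [IsProbabilityMeasure P]
    (k d : ℕ) (hk : 1 ≤ k) (β : ℝ)
    (hβ : (0 < β ∧ β < min (k : ℝ) 2) ∨ (k = 1 ∧ β = 1))
    (W : Fin d → Set (SpaceTime k) → Ω → ℂ)
    (hW : IsComplexWhiteNoise P volume W) :
    -- `W̃ⱼ(φ)` and `vⱼ(t, x)` are well defined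
    ((∀ j, ∀ φ ∈ noiseDomain k β ℂ,
        IsFourierL2 φ (fourierL2 φ) ∧
        MemLp (tildeIntegrand β φ) 2 volume ∧
        HasWienerIntegral P volume (W j) (tildeIntegrand β φ) (tildeNoise P β W j φ)) ∧
      (∀ j (t : ℝ≥0) x,
        MemLp (harmonizableKernel β t x) 2 volume ∧
        HasWienerIntegral P volume (W j) (harmonizableKernel β t x)
          (harmonizableField P β W j t x))) ∧
    -- (a)
    (0 < noiseConst k β ∧
      IsNoise P β (noiseDomain k β ℝ)
        (reIm fun j (φ : SpaceTime k → ℝ) ω =>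
          (((noiseConst k β).sqrt)⁻¹ : ℂ) * tildeNoise P β W j (fun p => (φ p : ℂ)) ω) ∧
      (∀ j, ∀ φ ∈ noiseDomain k β ℂ,
        tildeNoise P β W j φ =ᵐ[P] fun ω =>
          tildeNoise P β W j (fun p => ((φ p).re : ℂ)) ω +
            Complex.I * tildeNoise P β W j (fun p => ((φ p).im : ℂ)) ω)) ∧
    -- (b)
    IsMildSolution P β (noiseDomain k β ℝ)
      (fun j φ => tildeNoise P β W j (fun p => (φ p : ℂ)))
      (harmonizableField P β W) ∧
    -- (c)
    (∀ {Ω' : Type*} [MeasurableSpace Ω'] (P' : Measure Ω') [IsProbabilityMeasure P']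
      (What : Fin d → (SpaceTime k → ℝ) → Ω' → ℝ)
      (vhat : Fin d → ℝ≥0 → EuclideanSpace ℝ (Fin k) → Ω' → ℝ),
      IsNoise P' β (testFunctions k) What →
      IsMildSolution P' β (testFunctions k) What vhat →
      ∀ I : Finset (ℝ≥0 × EuclideanSpace ℝ (Fin k)),
        IdentDistrib
          (fun ω (q : I × Fin d) => (harmonizableField P β W q.2 q.1.1.1 q.1.1.2 ω).re)
          (fun ω' (q : I × Fin d) => (noiseConst k β).sqrt * vhat q.2 q.1.1.1 q.1.1.2 ω')
          P P') := by
  have hc := noiseConst_pos hβ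
  refine ⟨⟨fun j φ hφ => ⟨isFourierL2_fourierL2 hφ.1, memLp_tildeIntegrand hk hβ hφ,
      hasWienerIntegral_tildeNoise hk hβ hW j hφ⟩,
    fun j t x => ⟨(memLp_harmonizableKernel_and_tendsto hk hβ t.2 x).1,
      hasWienerIntegral_harmonizableField hk hβ hW j t x⟩⟩,
    ⟨hc, isNoise_tildeNoise hk hβ hW, fun j φ hφ => tildeNoise_ae_eq_re_add_im hk hβ hW j hφ⟩,
    isMildSolution_harmonizableField hk hβ hW, ?_⟩
  intro Ω' _ P' _ What vhat hWhat hvhat I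
  -- the normalized real part of `v` solves the equation with a standard real noise
  let L : ℂ →L[ℝ] ℝ := (noiseConst k β).sqrt⁻¹ • Complex.reCLM
  have hL : ∀ z : ℂ, L z = ((((noiseConst k β).sqrt)⁻¹ : ℂ) * z).re := fun z => by
    rw [← Complex.ofReal_inv, Complex.re_ofReal_mul]
    rfl
  have hX : IsNoise P β (noiseDomain k β ℝ) (fun j (φ : SpaceTime k → ℝ) ω =>
      L (tildeNoise P β W j (fun p => (φ p : ℂ)) ω)) := by
    simp only [hL]
    exact (isNoise_tildeNoise hk hβ hW).comp_injective Sum.inl_injective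
  have hid := identDistrib_of_hasNoiseIntegral hk (eq_one_or_lt hβ).1 hX hWhat
    (fun φ hφ => hφ.1.1) (fun φ hφ => hφ.1.continuous.aestronglyMeasurable)
    (g := fun q : ℝ≥0 × EuclideanSpace ℝ (Fin k) => heatIntegrand q.1 (Set.Icc 0 (q.1 : ℝ)) q.2)
    (fun q => (measurable_heatIntegrand _ measurableSet_Icc _).aestronglyMeasurable)
    (fun q => noiseNormSq_heatIntegrand_lt_top hk hβ q.1.2 measurableSet_Icc subset_rfl _)
    (u := fun j q ω => L (harmonizableField P β W j q.1 q.2 ω)) (u' := fun j q => vhat j q.1 q.2)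
    (fun j q => ((isMildSolution_harmonizableField hk hβ hW).1 j q.1 q.2).continuousLinearMap L)
    (fun j q => hvhat.1 j q.1 q.2) I
  have hm : Measurable fun (f : I × Fin d → ℝ) q => (noiseConst k β).sqrt * f q := by fun_prop
  have hs : (noiseConst k β).sqrt ≠ 0 := (Real.sqrt_pos.2 hc).ne'
  convert hid.comp hm using 1
  · ext ω q
    exact (mul_inv_cancel_left₀ hs _).symm
  · rfl
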